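/- Let $k$ be a field of characteristic $0$ and $V$ a $k$-vector space of finite dimension $N$. For a partition $\lambda=(\lambda_1\ge\dots\ge\lambda_p>0)$ of $n\ge 0$ put $\lambda_i=0$ for $i>p$. Fill the Young diagram of $\lambda$ with $1,\dots,n$ from left to right and top to bottom, and let $P_\lambda,Q_\lambda\subset S_n$ be the subgroups preserving every row, respectively every column. Put $a_\lambda=\frac1{|P_\lambda|}\sum_{g\in P_\lambda}g$, $b_\lambda=\frac1{|Q_\lambda|}\sum_{g\in Q_\lambda}(-1)^g g$, $c_\lambda=a_\lambda b_\lambda$, let $V_\lambda=k[S_n]c_\lambda$ (the Specht module), and let $L_\lambda=\mathrm{Hom}_{S_n}(V_\lambda,V^{\otimes n})$, where $S_n$ permutes the factors of $V^{\otimes n}$ and $g\in GL(V)$ acts on $L_\lambda$ by composition with $g^{\otimes n}$. For $N\ge p$ the Schur polynomial $S_\lambda(x_1,\dots,x_N)$ is defined by $\det(x_i^{\lambda_j+N-j})_{i,j=1}^N=S_\lambda(x)\cdot\det(x_i^{N-j})_{i,j=1}^N$. **Theorem (Weyl character formula).** Each $L_\lambda$ is finite dimensional, and $L_\lambda=0$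 if and only if $N<p$. If $N\ge p$, then for every $g\in GL(V)$ whose eigenvalues, with multiplicity, in an extension field of $k$ over which the characteristic polynomial of $g$ splits are $x_1,\dots,x_N$, $$\mathrm{Tr}_{L_\lambda}(g)=S_\lambda(x_1,\dots,x_N),\qquad\text{and}\qquad \dim L_\lambda=\prod_{1\le i<j\le N}\frac{\lambda_i-\lambda_j+j-i}{j-i}.$$ **Theorem (polynomial representations).** For integers $w_1\ge\dots\ge w_N$ let $r\ge0$ be the least natural number such that all $w_i+r\ge0$, let $\lambda$ be the partition formed by the nonzero numbers among $w_1+r,\dots,w_N+r$, and put $L_w=L_\lambda\otimes(\wedge^N V^*)^{\otimes r}$. Then: 1. for every partition $\lambda$ with at most $N$ parts and every $r\ge0$, the representation $L_\lambda\otimes(\wedge^NV^*)^{\otimes r}$ of $GL(V)$ is isomorphic to $L_{(\lambda_1-r,\dots,\lambda_N-r)}$; 2. every $L_w$ is an irreducible polynomial representation of $GL(V)$, and $L_w\not\cong L_{w'}$ for $w\neq w'$; 3. every finite-dimensional polynomial representation of $GL(V)$ is completely reducible and is isomorphic to a finite direct sum of representations of the form $L_w$. Here a finite-dimensional representation of $GL(V)$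 is called polynomial if its matrix elements, as functions of $g$, belong to $k[g_{ij}][1/\det g]$. -/

import Mathlib

open scoped TensorProduct

universe u v w y

namespace SchurWeyl

noncomputable section

/-! ### Partitions and Specht modules -/

section Partitions

variable {n : ℕ}

/-- The parts `λ₁ ≥ λ₂ ≥ … ≥ λ_p > 0` of a partition, in weakly decreasing order. -/
def sortedParts (l : n.Partition) : List ℕ := l.parts.sort (· ≥ ·)

/-- The `i`-th part (counted from `0`), with the convention that it is `0` for `i ≥ p`. -/
def part (l : n.Partition) (i : ℕ) : ℕ := (sortedParts l).getD i 0

/-- The number `p` of parts. -/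
def numParts (l : n.Partition) : ℕ := l.parts.card

/-- The partition as an ordered sum `n = λ₁ + … + λ_p`.  Filling the Young diagram with
`0, …, n - 1` from left to right and from top to bottom puts the number `m` in row
`(rows l).index m` and column `(rows l).invEmbedding m`. -/
def rows (l : n.Partition) : Composition n where
  blocks := sortedParts l
  blocks_pos hi := l.parts_pos ((Multiset.mem_sort _).1 hi)
  blocks_sum := by
    rw [← Multiset.sum_coe, sortedParts, Multiset.sort_eq, l.parts_sum]

/-- The row of the number `m` in the standard filling. -/
def rowOf (l : n.Partition) (m : Fin n) : ℕ := ((rows l).index m : ℕ)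

/-- The column of the number `m` in the standard filling. -/
def colOf (l : n.Partition) (m : Fin n) : ℕ := ((rows l).invEmbedding m : ℕ)

/-- The subgroup of permutations that preserve all the fibres of a function. -/
def fibreSubgroup (f : Fin n → ℕ) : Subgroup (Equiv.Perm (Fin n)) where
  carrier := {s | ∀ m, f (s m) = f m}
  mul_mem' {a b} ha hb m := by
    rw [Equiv.Perm.mul_apply, ha, hb]
  one_mem' _ := rfl
  inv_mem' {a} ha m := by
    have h := ha (a⁻¹ m)
    rw [← Equiv.Perm.mul_apply, mul_inv_cancel, Equiv.Perm.one_apply] at h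
    exact h.symm

/-- The row subgroup `P_λ`. -/
def rowSubgroup (l : n.Partition) : Subgroup (Equiv.Perm (Fin n)) := fibreSubgroup (rowOf l)

/-- The column subgroup `Q_λ`. -/
def colSubgroup (l : n.Partition) : Subgroup (Equiv.Perm (Fin n)) := fibreSubgroup (colOf l)

variable (k : Type*) [Field k]

open Classical in
/-- `a_λ = |P_λ|⁻¹ ∑_{g ∈ P_λ} g`. -/
def rowProjector (l : n.Partition) : MonoidAlgebra k (Equiv.Perm (Fin n)) :=
  ((Nat.card (rowSubgroup l) : k)⁻¹) •
    ∑ g : Equiv.Perm (Fin n) with g ∈ rowSubgroup l, MonoidAlgebra.single g (1 : k)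

open Classical in
/-- `b_λ = |Q_λ|⁻¹ ∑_{g ∈ Q_λ} (-1)^g g`. -/
def colProjector (l : n.Partition) : MonoidAlgebra k (Equiv.Perm (Fin n)) :=
  ((Nat.card (colSubgroup l) : k)⁻¹) •
    ∑ g : Equiv.Perm (Fin n) with g ∈ colSubgroup l,
      MonoidAlgebra.single g (((Equiv.Perm.sign g : ℤˣ) : ℤ) : k)

/-- The Young symmetrizer `c_λ = a_λ b_λ`. -/
def youngSymmetrizer (l : n.Partition) : MonoidAlgebra k (Equiv.Perm (Fin n)) :=
  rowProjector k l * colProjector k l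

/-- The Specht module `V_λ = k[S_n] c_λ`, a left ideal of `k[S_n]`. -/
abbrev Specht (l : n.Partition) :
    Submodule (MonoidAlgebra k (Equiv.Perm (Fin n))) (MonoidAlgebra k (Equiv.Perm (Fin n))) :=
  Submodule.span _ {youngSymmetrizer k l}

/-- The action of `S_n` on `V_λ` by left multiplication. -/
def spechtRep (l : n.Partition) : Representation k (Equiv.Perm (Fin n)) (Specht k l) :=
  Representation.ofModule' (Specht k l)

end Partitions

/-! ### Tensor powers and the representations `L_λ` -/

section Tensor

variable {k : Type*} [Field k]

/-- The `r`-th tensor power of a representation: `g` acts by `g ⊗ ⋯ ⊗ g`. -/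
def tensorPowerRep {G W : Type*} [Monoid G] [AddCommGroup W] [Module k W]
    (ρ : Representation k G W) (r : ℕ) :
    Representation k G (PiTensorProduct k (fun _ : Fin r => W)) where
  toFun g := PiTensorProduct.map (fun _ => ρ g)
  map_one' := by
    simp only [map_one]
    exact PiTensorProduct.map_one
  map_mul' g h := by
    simp only [map_mul]
    exact PiTensorProduct.map_mul _ _

/-- The `r`-th exterior power of a representation. -/
def exteriorPowerRep {G W : Type*} [Monoid G] [AddCommGroup W] [Module k W]
    (ρ : Representation k G W) (r : ℕ) : Representation k G (⋀[k]^r W) where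
  toFun g := exteriorPower.map r (ρ g)
  map_one' := by
    rw [map_one]
    exact exteriorPower.map_id
  map_mul' g h := by
    apply exteriorPower.linearMap_ext
    ext v
    simp [Function.comp_def]

variable (k) (V : Type*) [AddCommGroup V] [Module k V]

/-- The action of `S_n` on `V^{⊗ n}` that permutes the factors:
`s (v₁ ⊗ ⋯ ⊗ v_n) = v_{s⁻¹(1)} ⊗ ⋯ ⊗ v_{s⁻¹(n)}`. -/
def permRep (n : ℕ) :
    Representation k (Equiv.Perm (Fin n)) (PiTensorProduct k (fun _ : Fin n => V)) where
  toFun s := (PiTensorProduct.reindex k (fun _ : Fin n => V) s).toLinearMap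
  map_one' := by
    ext v
    simp only [LinearMap.compMultilinearMap_apply, LinearEquiv.coe_coe,
      PiTensorProduct.reindex_tprod]
    rfl
  map_mul' s t := by
    ext v
    simp only [LinearMap.compMultilinearMap_apply, LinearEquiv.coe_coe,
      PiTensorProduct.reindex_tprod, Module.End.mul_apply]
    rfl

/-- The tautological representation of `GL(V)` on `V`. -/
def stdRep : Representation k (LinearMap.GeneralLinearGroup k V) V :=
  Units.coeHom (V →ₗ[k] V)

variable {n : ℕ}

/-- The space `L_λ = Hom_{S_n}(V_λ, V^{⊗ n})`. -/
abbrev WeylModule (l : n.Partition) : Type _ :=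
  Representation.IntertwiningMap (spechtRep k l) (permRep k V n)

/-- For `g` in `GL(V)`, `g ⊗ ⋯ ⊗ g` as an `S_n`-equivariant endomorphism of `V^{⊗ n}`. -/
def tensorPowerIntertwining (g : LinearMap.GeneralLinearGroup k V) :
    Representation.IntertwiningMap (permRep k V n) (permRep k V n) where
  toLinearMap := tensorPowerRep (stdRep k V) n g
  isIntertwining' s := by
    apply PiTensorProduct.ext
    ext v
    simp [tensorPowerRep, permRep, PiTensorProduct.reindex_tprod]

/-- The action of `GL(V)` on `L_λ` through `V^{⊗ n}`: `(g f)(x) = g^{⊗ n} (f x)`. -/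
def weylRep (l : n.Partition) :
    Representation k (LinearMap.GeneralLinearGroup k V) (WeylModule k V l) where
  toFun g := Representation.IntertwiningMap.llcomp (spechtRep k l) (permRep k V n) (permRep k V n)
    (tensorPowerIntertwining k V g)
  map_one' := by
    apply LinearMap.ext
    intro f
    apply Representation.IntertwiningMap.ext
    apply LinearMap.ext
    intro x
    change tensorPowerRep (stdRep k V) n 1 (f x) = f x
    rw [map_one]
    rfl
  map_mul' g h := by
    apply LinearMap.ext
    intro f
    apply Representation.IntertwiningMap.ext
    apply LinearMap.ext
    intro x
    change tensorPowerRep (stdRep k V) n (g * h) (f x) =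
      tensorPowerRep (stdRep k V) n g (tensorPowerRep (stdRep k V) n h (f x))
    rw [map_mul]
    rfl

/-! ### Twists by the determinant and general highest weights -/

/-- The underlying space of `L_λ ⊗ (⋀^N V^*)^{⊗ r}`, where `N = dim V`. -/
abbrev TwistedWeylModule (l : n.Partition) (r : ℕ) : Type _ :=
  WeylModule k V l ⊗[k]
    PiTensorProduct k (fun _ : Fin r => ⋀[k]^(Module.finrank k V) (Module.Dual k V))

/-- The representation `L_λ ⊗ (⋀^N V^*)^{⊗ r}` of `GL(V)`, where `N = dim V`. -/
def twistedWeylRep (l : n.Partition) (r : ℕ) :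
    Representation k (LinearMap.GeneralLinearGroup k V) (TwistedWeylModule k V l r) :=
  (weylRep k V l).tprod
    (tensorPowerRep (exteriorPowerRep (stdRep k V).dual (Module.finrank k V)) r)

end Tensor

/-- Sequences of integers `w₁ ≥ w₂ ≥ … ≥ w_N`. -/
abbrev Weight (N : ℕ) : Type := {w : Fin N → ℤ // Antitone w}

/-- The least natural number `r` such that all `wᵢ + r` are nonnegative. -/
def Weight.shift {N : ℕ} (w : Weight N) : ℕ := Finset.univ.sup fun i => (-(w.1 i)).toNat

/-- The multiset of the natural numbers `wᵢ + r`, with `r = w.shift`. -/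
def Weight.shifted {N : ℕ} (w : Weight N) : Multiset ℕ :=
  Finset.univ.val.map fun i => (w.1 i + w.shift).toNat

/-- The partition `w + r·1^N` (zeros omitted), with `r = w.shift`. -/
def Weight.partition {N : ℕ} (w : Weight N) : w.shifted.sum.Partition :=
  Nat.Partition.ofSums _ w.shifted rfl

/-- The weight `(λ₁ - r, …, λ_N - r)` of length `N`, where `λᵢ = 0` for `i > p`. -/
def Weight.ofPartition (N : ℕ) {n : ℕ} (l : n.Partition) (r : ℕ) : Weight N :=
  ⟨fun i => (part l i : ℤ) - r, by
    have key : Antitone (part l) := by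
      intro i j hij
      unfold part
      rcases lt_or_ge j (sortedParts l).length with hj | hj
      · rw [List.getD_eq_getElem _ _ hj, List.getD_eq_getElem _ _ (hij.trans_lt hj)]
        have hs : (sortedParts l).Pairwise (· ≥ ·) := Multiset.pairwise_sort _ _
        rcases hij.eq_or_lt with h | h
        · subst h
          exact le_rfl
        · exact List.pairwise_iff_getElem.1 hs i j _ _ h
      · rw [List.getD_eq_default _ _ hj]
        exact Nat.zero_le _
    intro i j hij
    have := key (show (i : ℕ) ≤ j from hij)
    simp only
    omega⟩

section HighestWeight

variable (k : Type*) [Field k] (V : Type*) [AddCommGroup V] [Module k V]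

/-- The underlying space of `L_w`, for a weight `w` of length `N = dim V`. -/
abbrev HighestWeightModule (w : Weight (Module.finrank k V)) : Type _ :=
  TwistedWeylModule k V w.partition w.shift

/-- The representation `L_w = L_λ ⊗ (⋀^N V^*)^{⊗ r}` of `GL(V)` with highest weight
`w = λ - r·1^N`. -/
def highestWeightRep (w : Weight (Module.finrank k V)) :
    Representation k (LinearMap.GeneralLinearGroup k V) (HighestWeightModule k V w) :=
  twistedWeylRep k V w.partition w.shift

/-- The algebra `k[g_{ij}][1/det g]` of functions on `GL(V)`.  The functions `g ↦ φ (g v)` span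
the same space as the entries of the matrix of `g` in any basis. -/
def polynomialFunctions : Subalgebra k (LinearMap.GeneralLinearGroup k V → k) :=
  Algebra.adjoin k
    ({f | ∃ (φ : Module.Dual k V) (v : V), f = fun g => φ (stdRep k V g v)} ∪
      {fun g => (LinearMap.det (stdRep k V g))⁻¹})

/-- A representation of `GL(V)` is polynomial (algebraic) if its matrix elements lie in
`k[g_{ij}][1/det g]`. -/
def IsPolynomialRep {Y : Type*} [AddCommMonoid Y] [Module k Y]
    (ρ : Representation k (LinearMap.GeneralLinearGroup k V) Y) : Prop :=
  ∀ (ξ : Module.Dual k Y) (y : Y), (fun g => ξ (ρ g y)) ∈ polynomialFunctions k V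

end HighestWeight

/-! ### Schur polynomials -/

section Schur

open MvPolynomial

/-- `det (x_i^{a_j + N - j})`, with rows and columns counted from `0`. -/
def alternant (N : ℕ) (a : ℕ → ℕ) : MvPolynomial (Fin N) ℤ :=
  Matrix.det (Matrix.of fun i j : Fin N => (X i : MvPolynomial (Fin N) ℤ) ^ (a j + (N - 1 - j)))

theorem irreducible_X_sub_X {N : ℕ} {i j : Fin N} (hij : i ≠ j) :
    Irreducible (X i - X j : MvPolynomial (Fin N) ℤ) := by
  have hc : coeff (Finsupp.single i 1) (X i - X j : MvPolynomial (Fin N) ℤ) = 1 := by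
    rw [coeff_sub, coeff_X, coeff_X, if_pos rfl, if_neg, sub_zero]
    rw [Finsupp.single_left_inj one_ne_zero]
    exact hij.symm
  apply irreducible_of_totalDegree_eq_one
  · apply le_antisymm
    · refine (totalDegree_sub _ _).trans ?_
      simp
    · have := le_totalDegree (p := (X i - X j : MvPolynomial (Fin N) ℤ)) (s := Finsupp.single i 1)
        (by rw [mem_support_iff, hc]; exact one_ne_zero)
      simpa using this
  · intro x hx
    have := hx (Finsupp.single i 1)
    rw [hc] at this
    exact isUnit_of_dvd_one this

theorem isRelPrime_X_sub_X {N : ℕ} {i j p q : Fin N} (hij : i < j) (hpq : p < q)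
    (h : ¬ (i = p ∧ j = q)) :
    IsRelPrime (X i - X j : MvPolynomial (Fin N) ℤ) (X p - X q) := by
  rw [(irreducible_X_sub_X hij.ne).isRelPrime_iff_not_dvd]
  rintro ⟨c, hc⟩
  have hev : ∀ f : Fin N → ℤ, f i = f j → f p = f q := by
    intro f hf
    have := congrArg (eval f) hc
    simp only [map_sub, map_mul, eval_X, hf, sub_self, zero_mul] at this
    exact sub_eq_zero.1 this
  by_cases hp : p = i ∨ p = j
  · have hq : q ≠ i ∧ q ≠ j := by
      constructor <;> rintro rfl <;> rcases hp with rfl | rfl <;> simp_all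
      exact absurd hij (by omega)
    have := hev (Pi.single q 1) (by simp [hq.1.symm, hq.2.symm])
    simp [hpq.ne] at this
  · push Not at hp
    have := hev (Pi.single p 1) (by simp [hp.1.symm, hp.2.symm])
    simp [hpq.ne'] at this

theorem X_sub_X_dvd_alternant {N : ℕ} (a : ℕ → ℕ) {i j : Fin N} (hij : i ≠ j) :
    (X i - X j : MvPolynomial (Fin N) ℤ) ∣ alternant N a := by
  rw [← Ideal.mem_span_singleton, ← Ideal.Quotient.eq_zero_iff_mem, alternant, RingHom.map_det]
  apply Matrix.det_zero_of_row_eq hij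
  have h : Ideal.Quotient.mk (Ideal.span {(X i - X j : MvPolynomial (Fin N) ℤ)}) (X i) =
      Ideal.Quotient.mk _ (X j) := by
    rw [Ideal.Quotient.eq]
    exact Ideal.mem_span_singleton_self _
  funext q
  simp [h]

theorem alternant_zero (N : ℕ) :
    alternant N (fun _ => 0) =
      ∏ i : Fin N, ∏ j ∈ Finset.Ioi i, (X (Fin.rev j) - X (Fin.rev i)) := by
  rw [← Matrix.det_vandermonde (fun i : Fin N => (X (Fin.rev i) : MvPolynomial (Fin N) ℤ)),
    ← Matrix.det_submatrix_equiv_self Fin.revPerm, alternant]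
  congr 1
  ext1 i j
  simp only [Matrix.of_apply, Matrix.submatrix_apply, Matrix.vandermonde_apply, Fin.revPerm_apply,
    Fin.rev_rev, Fin.val_rev, zero_add]
  congr 1
  omega

/-- `D_0` divides `D_a`. -/
theorem alternant_zero_dvd (N : ℕ) (a : ℕ → ℕ) :
    alternant N (fun _ => 0) ∣ alternant N a := by
  rw [alternant_zero, Finset.prod_sigma']
  apply Finset.prod_dvd_of_isRelPrime
  · rintro ⟨i, j⟩ hij ⟨p, q⟩ hpq hne
    simp only [Finset.coe_sigma, Set.mem_sigma_iff, Finset.coe_Ioi, Set.mem_Ioi,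
      Finset.mem_coe, Finset.mem_univ, true_and] at hij hpq
    refine isRelPrime_X_sub_X (Fin.rev_lt_rev.2 hij) (Fin.rev_lt_rev.2 hpq) ?_
    rintro ⟨h1, h2⟩
    apply hne
    rw [show j = q from Fin.rev_injective h1, show i = p from Fin.rev_injective h2]
  · rintro ⟨i, j⟩ hij
    simp only [Finset.mem_sigma, Finset.mem_Ioi, Finset.mem_univ, true_and] at hij
    exact X_sub_X_dvd_alternant a (Fin.rev_lt_rev.2 hij).ne

/-- The Schur polynomial `S_λ = D_λ / D_0` in `x_1, …, x_N`; it is characterized by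
`D_λ = D_0 * S_λ`, as `D_0 ≠ 0`. -/
def schurPoly (N : ℕ) {n : ℕ} (l : n.Partition) : MvPolynomial (Fin N) ℤ :=
  (alternant_zero_dvd N (part l)).choose

theorem alternant_eq_mul_schurPoly (N : ℕ) {n : ℕ} (l : n.Partition) :
    alternant N (part l) = alternant N (fun _ => 0) * schurPoly N l :=
  (alternant_zero_dvd N (part l)).choose_spec

end Schur

end

end SchurWeyl

/-!
The proof rests on two computations, one in the group algebra of `S_n` and one with symmetric
polynomials, which are then transported to `GL(V)` through the tensor power `V^{⊗ n}`.

*Specht modules.*  A pigeonhole argument (`exists_swap_or_dominatedBy`) shows that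
`a_λ k[S_n] b_λ` is spanned by `c_λ` and that `a_λ k[S_n] b_μ ≠ 0` forces `λ ⊴ μ`.  As the group
algebra is semisimple, `c_λ² = κ c_λ` with `κ ≠ 0`, and the Specht modules are simple and pairwise
non-isomorphic.  Modulo commutators the `c_λ` span the group algebra, so every trace function `φ`
expands as `φ(x) = ∑_λ κ_λ⁻¹ χ_λ(x) φ(c_λ)` (`traceFunction_eq_sum`); in particular every simple
module is a Specht module (`exists_specht_equiv`).

*Characters.*  Let `Φ(x)` be the trace of `x` composed with `diag(x_1, …, x_N)^{⊗ n}`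
(`wordChar`).  Then `Φ(a_λ)` is a product of complete symmetric polynomials, and the Pieri rule
expresses `Φ(a_λ) D(ρ)` through alternants `D(e)` with `e ⊵ λ + ρ`.  By triangularity of
`χ_μ(a_λ)` in the dominance order the same holds for `Φ(c_λ) D(ρ)`.  On the other hand `b_λ` kills
the words that repeat a letter in a column, so all monomials of `Φ(c_λ) D(ρ)` are `⊴ λ + ρ`.  Hence
`Φ(c_λ) D(ρ)` is a multiple of `D(λ + ρ)`, and the factor is `κ` (`wordChar_youngSymmetrizer_mul`).
Since `L_λ` is the summand of `V^{⊗ n}` cut out by `κ⁻¹ c_λ`, this is the Weyl character formula;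
triangularization reduces a general `g` to the diagonal case.  The dimension follows by setting
`x_i = q^i` and letting `q` tend to `1`.

*Representations of `GL(V)`.*  The operators `g ⊗ ⋯ ⊗ g` span the commutant of `S_n`
(`mem_span_range_tensorPowerRep`), so `L_λ` is irreducible when it is nonzero.  Irreducible
representations are determined by their characters, and tensoring with `⋀^N V^*` is twisting by
`det⁻¹`; this gives the classification of the `L_w`.  For complete reducibility, matrix
coefficients embed a polynomial representation into a finite power of the algebra of polynomial
functions on `GL(V)`, with `GL(V)` acting by right translation.  That algebra is spanned by matrix
coefficients of the `V^{⊗ n} ⊗ det^{-r}`, and `V^{⊗ n}` is a sum of images of modules `L_λ`, so it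
is a sum of copies of the `L_w` (`mem_highestWeightFunctions`).
-/

namespace SchurWeyl

noncomputable section

/-! ### The standard filling of a Young diagram -/

/-- `a ⊴ b` in the dominance order: every partial sum of `a` is at most that of `b`. -/
def DominatedBy (a b : ℕ → ℕ) : Prop :=
  ∀ s, ∑ i ∈ Finset.range s, a i ≤ ∑ i ∈ Finset.range s, b i

theorem DominatedBy.trans {a b c : ℕ → ℕ} (h : DominatedBy a b) (h' : DominatedBy b c) :
    DominatedBy a c := fun s => (h s).trans (h' s)

theorem DominatedBy.antisymm {a b : ℕ → ℕ} (h : DominatedBy a b) (h' : DominatedBy b a) :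
    a = b := by
  funext i
  have h1 := (h (i + 1)).antisymm (h' (i + 1))
  have h2 := (h i).antisymm (h' i)
  rw [Finset.sum_range_succ, Finset.sum_range_succ, h2] at h1
  omega

theorem exists_equiv_of_card_fiber_eq {α α' β : Type*} [Fintype α] [Fintype α'] [DecidableEq β]
    (f : α → β) (g : α' → β)
    (h : ∀ b, (Finset.univ.filter fun a => f a = b).card =
      (Finset.univ.filter fun a => g a = b).card) :
    ∃ s : α ≃ α', ∀ a, g (s a) = f a := by
  have e : ∀ b, Nonempty ({a // f a = b} ≃ {a // g a = b}) := fun b => by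
    refine ⟨Fintype.equivOfCardEq ?_⟩
    rw [Fintype.card_subtype, Fintype.card_subtype, h]
  exact ⟨Equiv.ofFiberEquiv fun b => (e b).some, fun a => Equiv.ofFiberEquiv_map _ a⟩

section Filling

variable {n : ℕ} (l : n.Partition)

theorem length_sortedParts : (sortedParts l).length = numParts l := by
  simp [sortedParts, numParts]

theorem antitone_part : Antitone (part l) := by
  intro i j hij
  unfold part
  rcases lt_or_ge j (sortedParts l).length with hj | hj
  · rw [List.getD_eq_getElem _ _ hj, List.getD_eq_getElem _ _ (hij.trans_lt hj)]
    have hs : (sortedParts l).Pairwise (· ≥ ·) := Multiset.pairwise_sort _ _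
    rcases hij.eq_or_lt with h | h
    · subst h
      exact le_rfl
    · exact List.pairwise_iff_getElem.1 hs i j _ _ h
  · rw [List.getD_eq_default _ _ hj]
    exact Nat.zero_le _

theorem part_pos_iff (i : ℕ) : 0 < part l i ↔ i < numParts l := by
  unfold part
  rw [← length_sortedParts]
  constructor
  · intro h
    by_contra h'
    rw [List.getD_eq_default _ _ (not_lt.1 h')] at h
    exact lt_irrefl _ h
  · intro h
    rw [List.getD_eq_getElem _ _ h]
    exact l.parts_pos ((Multiset.mem_sort _).1 (List.getElem_mem h))

theorem part_injective {l l' : n.Partition} (h : part l = part l') : l = l' := by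
  have hn : numParts l = numParts l' := by
    apply le_antisymm <;> by_contra! hc
    · have := (part_pos_iff l (numParts l')).2 hc
      rw [h] at this
      exact lt_irrefl _ ((part_pos_iff l' _).1 this)
    · have := (part_pos_iff l' (numParts l)).2 hc
      rw [← h] at this
      exact lt_irrefl _ ((part_pos_iff l _).1 this)
  have hs : sortedParts l = sortedParts l' := by
    apply List.ext_getElem
    · rw [length_sortedParts, length_sortedParts, hn]
    · intro i h1 h2
      have := congrFun h i
      unfold part at this
      rwa [List.getD_eq_getElem _ _ h1, List.getD_eq_getElem _ _ h2] at this
  apply Nat.Partition.ext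
  rw [← Multiset.sort_eq l.parts (· ≥ ·), ← Multiset.sort_eq l'.parts (· ≥ ·)]
  exact congrArg _ hs

theorem blocksFun_rows (i : Fin (rows l).length) : (rows l).blocksFun i = part l i := by
  exact (List.getD_eq_getElem (sortedParts l) 0 i.2).symm

theorem length_rows : (rows l).length = numParts l := length_sortedParts l

theorem rowOf_lt (m : Fin n) : rowOf l m < numParts l := by
  rw [← length_rows]
  exact ((rows l).index m).2

theorem colOf_lt_part (m : Fin n) : colOf l m < part l (rowOf l m) := by
  exact ((rows l).invEmbedding m).2.trans_eq (blocksFun_rows l _)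

theorem exists_cell {i j : ℕ} (h : j < part l i) : ∃ m, rowOf l m = i ∧ colOf l m = j := by
  have hi : i < (rows l).length := by
    rw [length_rows, ← part_pos_iff]
    exact (Nat.zero_le _).trans_lt h
  have hj : j < (rows l).blocksFun ⟨i, hi⟩ := by
    rw [blocksFun_rows]
    exact h
  refine ⟨(rows l).embedding ⟨i, hi⟩ ⟨j, hj⟩, ?_, ?_⟩
  · rw [rowOf, Composition.index_embedding]
  · rw [colOf, Composition.invEmbedding_comp]

theorem cell_injective {m m' : Fin n} (h : rowOf l m = rowOf l m') (h' : colOf l m = colOf l m') :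
    m = m' := by
  have h1 : (rows l).index m = (rows l).index m' := Fin.ext h
  have h2 := (rows l).embedding_comp_inv m
  have h3 := (rows l).embedding_comp_inv m'
  rw [← h2, ← h3]
  apply Fin.ext
  rw [Composition.coe_embedding, Composition.coe_embedding]
  exact congrArg₂ (· + ·) (congrArg _ (congrArg Fin.val h1)) h'

theorem card_rowOf_eq (i : ℕ) :
    (Finset.univ.filter fun m => rowOf l m = i).card = part l i := by
  rw [← Finset.card_range (part l i)]
  apply Finset.card_bij fun m _ => colOf l m
  · intro m hm
    rw [Finset.mem_range, ← (Finset.mem_filter.1 hm).2]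
    exact colOf_lt_part l m
  · intro m hm m' hm' h
    exact cell_injective l ((Finset.mem_filter.1 hm).2.trans (Finset.mem_filter.1 hm').2.symm) h
  · intro j hj
    obtain ⟨m, hm, hm'⟩ := exists_cell l (Finset.mem_range.1 hj)
    exact ⟨m, Finset.mem_filter.2 ⟨Finset.mem_univ _, hm⟩, hm'⟩

theorem card_lt_eq_sum {α : Type*} [Fintype α] (f : α → ℕ) (s : ℕ) :
    (Finset.univ.filter fun m => f m < s).card =
      ∑ i ∈ Finset.range s, (Finset.univ.filter fun m => f m = i).card := by
  rw [Finset.card_eq_sum_card_fiberwise (f := f) (t := Finset.range s)]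
  · apply Finset.sum_congr rfl
    intro i hi
    congr 1
    ext m
    simp only [Finset.mem_filter, Finset.mem_univ, true_and, Finset.mem_range] at hi ⊢
    omega
  · intro m hm
    simpa using hm

theorem sum_part (s : ℕ) :
    ∑ i ∈ Finset.range s, part l i = (Finset.univ.filter fun m => rowOf l m < s).card := by
  rw [card_lt_eq_sum]
  exact Finset.sum_congr rfl fun i _ => (card_rowOf_eq l i).symm

/-- Within one column, the rows form an initial segment of `ℕ`, so an injective labelling has at
most as many labels below `s` as there are rows below `s`. -/
theorem card_column_lt_le {f : Fin n → ℕ}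
    (hf : ∀ m m', colOf l m = colOf l m' → f m = f m' → m = m') (c s : ℕ) :
    (Finset.univ.filter fun m => colOf l m = c ∧ f m < s).card ≤
      (Finset.univ.filter fun m => colOf l m = c ∧ rowOf l m < s).card := by
  by_cases h : ∃ m, colOf l m = c ∧ s ≤ rowOf l m
  · obtain ⟨m, hm, hs⟩ := h
    calc _ ≤ (Finset.range s).card := by
          apply Finset.card_le_card_of_injOn f
          · intro m' hm'
            simpa using (Finset.mem_filter.1 hm').2.2
          · intro m₁ h₁ m₂ h₂ h
            exact hf _ _ ((Finset.mem_filter.1 h₁).2.1.trans (Finset.mem_filter.1 h₂).2.1.symm) h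
      _ ≤ _ := by
          apply Finset.card_le_card_of_surjOn (rowOf l)
          intro i hi
          have hi' : i < s := by simpa using hi
          have hlt : c < part l i :=
            hm ▸ (colOf_lt_part l m).trans_le (antitone_part l (hi'.le.trans hs))
          obtain ⟨m', h1, h2⟩ := exists_cell l hlt
          refine ⟨m', ?_, h1⟩
          simp [h1, h2, hi']
  · push Not at h
    apply Finset.card_le_card
    intro m hm
    simp only [Finset.mem_filter, Finset.mem_univ, true_and] at hm ⊢
    exact ⟨hm.1, h m hm.1⟩

theorem card_lt_eq_sum_columns (f : Fin n → ℕ) (s : ℕ) :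
    (Finset.univ.filter fun m => f m < s).card =
      ∑ c ∈ Finset.univ.image (colOf l),
        (Finset.univ.filter fun m => colOf l m = c ∧ f m < s).card := by
  rw [Finset.card_eq_sum_card_fiberwise (f := colOf l) (t := Finset.univ.image (colOf l))]
  · apply Finset.sum_congr rfl
    intro i hi
    congr 1
    ext m
    simp [and_comm]
  · intro m hm
    simp

/-- A labelling that is injective on the columns of `l` has content dominated by `l`. -/
theorem card_lt_le_sum_part {f : Fin n → ℕ}
    (hf : ∀ m m', colOf l m = colOf l m' → f m = f m' → m = m') (s : ℕ) :
    (Finset.univ.filter fun m => f m < s).card ≤ ∑ i ∈ Finset.range s, part l i := by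
  rw [sum_part, card_lt_eq_sum_columns l, card_lt_eq_sum_columns l]
  exact Finset.sum_le_sum fun c _ => card_column_lt_le l hf c s

/-- A labelling of content `l` that is injective on the columns is obtained from the labelling by
row numbers through a permutation inside the columns. -/
theorem exists_mem_colSubgroup {f : Fin n → ℕ}
    (hf : ∀ m m', colOf l m = colOf l m' → f m = f m' → m = m')
    (hc : ∀ i, (Finset.univ.filter fun m => f m = i).card = part l i) :
    ∃ q ∈ colSubgroup l, ∀ m, rowOf l (q m) = f m := by
  have hs : ∀ s, ∀ c ∈ Finset.univ.image (colOf l),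
      (Finset.univ.filter fun m => colOf l m = c ∧ f m < s).card =
        (Finset.univ.filter fun m => colOf l m = c ∧ rowOf l m < s).card := by
    intro s
    rw [← Finset.sum_eq_sum_iff_of_le fun c _ => card_column_lt_le l hf c s,
      ← card_lt_eq_sum_columns, ← card_lt_eq_sum_columns, card_lt_eq_sum, card_lt_eq_sum]
    exact Finset.sum_congr rfl fun i _ => (hc i).trans (card_rowOf_eq l i).symm
  have hsplit : ∀ (g : Fin n → ℕ) (c i : ℕ),
      (Finset.univ.filter fun m => colOf l m = c ∧ g m < i + 1).card =
      (Finset.univ.filter fun m => colOf l m = c ∧ g m < i).card +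
      (Finset.univ.filter fun m => (g m, colOf l m) = (i, c)).card := by
    intro g c i
    rw [← Finset.card_union_of_disjoint]
    · congr 1
      ext m
      simp only [Finset.mem_filter, Finset.mem_univ, true_and, Finset.mem_union, Prod.mk.injEq]
      omega
    · rw [Finset.disjoint_filter]
      intro m _ h h'
      rw [Prod.mk.injEq] at h'
      omega
  obtain ⟨q, hq⟩ := exists_equiv_of_card_fiber_eq (fun m => (f m, colOf l m))
    (fun m => (rowOf l m, colOf l m)) (by
      rintro ⟨i, c⟩
      by_cases hmem : c ∈ Finset.univ.image (colOf l)
      · have h1 := hsplit f c i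
        have h2 := hsplit (rowOf l) c i
        rw [hs _ c hmem, hs _ c hmem] at h1
        omega
      · have : ∀ g : Fin n → ℕ,
            (Finset.univ.filter fun m => (g m, colOf l m) = (i, c)).card = 0 := by
          intro g
          rw [Finset.card_eq_zero, Finset.filter_eq_empty_iff]
          intro m _ h
          rw [Prod.mk.injEq] at h
          exact hmem (Finset.mem_image.2 ⟨m, Finset.mem_univ _, h.2⟩)
        rw [this, this])
  exact ⟨q, fun m => (Prod.mk.inj (hq m)).2, fun m => (Prod.mk.inj (hq m)).1⟩

/-- Von Neumann's lemma for two Young diagrams: either `g` moves two cells of one column of `l'`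
into one row of `l`, or `l ⊴ l'`. -/
theorem exists_swap_or_dominatedBy (l l' : n.Partition) (g : Equiv.Perm (Fin n)) :
    (∃ i j, i ≠ j ∧ Equiv.swap i j ∈ colSubgroup l' ∧
      g * Equiv.swap i j * g⁻¹ ∈ rowSubgroup l) ∨
    (DominatedBy (part l) (part l') ∧
      ∀ i j, colOf l' i = colOf l' j → rowOf l (g i) = rowOf l (g j) → i = j) := by
  have hswap : ∀ (f : Fin n → ℕ) (i j : Fin n), f i = f j →
      Equiv.swap i j ∈ fibreSubgroup f := by
    intro f i j h m
    rcases eq_or_ne m i with rfl | hi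
    · rw [Equiv.swap_apply_left, h]
    rcases eq_or_ne m j with rfl | hj
    · rw [Equiv.swap_apply_right, h]
    rw [Equiv.swap_apply_of_ne_of_ne hi hj]
  by_cases h : ∀ i j, colOf l' i = colOf l' j → rowOf l (g i) = rowOf l (g j) → i = j
  · refine Or.inr ⟨fun s => ?_, h⟩
    refine le_trans (le_of_eq ?_) (card_lt_le_sum_part l' h s)
    rw [sum_part]
    exact (Finset.card_equiv g fun m => by simp).symm
  · push Not at h
    obtain ⟨i, j, h1, h2, h3⟩ := h
    refine Or.inl ⟨i, j, h3, hswap _ _ _ h1, ?_⟩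
    rw [← Equiv.swap_apply_apply]
    exact hswap _ _ _ h2

/-- A permutation is a product of a row and a column permutation, unless it moves some pair of
cells of one column into one row. -/
theorem exists_swap_or_eq_mul (g : Equiv.Perm (Fin n)) :
    (∃ i j, i ≠ j ∧ Equiv.swap i j ∈ colSubgroup l ∧
      g * Equiv.swap i j * g⁻¹ ∈ rowSubgroup l) ∨
    ∃ p ∈ rowSubgroup l, ∃ q ∈ colSubgroup l, g = p * q := by
  rcases exists_swap_or_dominatedBy l l g with h | ⟨-, h⟩
  · exact Or.inl h
  · obtain ⟨q, hq, hq'⟩ := exists_mem_colSubgroup l (f := fun m => rowOf l (g m)) h (by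
      intro i
      rw [← card_rowOf_eq]
      exact Finset.card_equiv g fun m => by simp)
    refine Or.inr ⟨g * q⁻¹, fun m => ?_, q, hq, by group⟩
    have := hq' (q⁻¹ m)
    rw [← Equiv.Perm.mul_apply q, mul_inv_cancel, Equiv.Perm.one_apply] at this
    rw [Equiv.Perm.mul_apply, ← this]

theorem eq_one_of_mem_rowSubgroup_of_mem_colSubgroup {g : Equiv.Perm (Fin n)}
    (h : g ∈ rowSubgroup l) (h' : g ∈ colSubgroup l) : g = 1 := by
  ext m
  rw [cell_injective l (h m) (h' m), Equiv.Perm.one_apply]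

theorem part_eq_of_dominatedBy {l l' : n.Partition} (h : DominatedBy (part l) (part l'))
    (h' : DominatedBy (part l') (part l)) : l = l' :=
  part_injective (h.antisymm h')

end Filling

/-! ### Young symmetrizers -/

section CharProjector

variable {k : Type*} [Field k] {G : Type*} [Group G] [Fintype G]

open Classical in
/-- The idempotent `|H|⁻¹ ∑_{h ∈ H} χ(h) h` of a group algebra, for a character `χ`. -/
def charProjector (H : Subgroup G) (χ : G →* k) : MonoidAlgebra k G :=
  ((Nat.card H : k)⁻¹) • ∑ g : G with g ∈ H, MonoidAlgebra.single g (χ g)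

theorem single_mul_charProjector (H : Subgroup G) (χ : G →* k) {h : G} (hh : h ∈ H) :
    MonoidAlgebra.single h (χ h) * charProjector H χ = charProjector H χ := by
  classical
  rw [charProjector, mul_smul_comm, Finset.mul_sum]
  congr 1
  refine Finset.sum_equiv (Equiv.mulLeft h) (fun g => ?_) (fun g _ => ?_)
  · simp [H.mul_mem_cancel_left hh]
  · rw [MonoidAlgebra.single_mul_single, ← map_mul]
    rfl

theorem charProjector_mul_single (H : Subgroup G) (χ : G →* k) {h : G} (hh : h ∈ H) :
    charProjector H χ * MonoidAlgebra.single h (χ h) = charProjector H χ := by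
  classical
  rw [charProjector, smul_mul_assoc, Finset.sum_mul]
  congr 1
  refine Finset.sum_equiv (Equiv.mulRight h) (fun g => ?_) (fun g _ => ?_)
  · simp [H.mul_mem_cancel_right hh]
  · rw [MonoidAlgebra.single_mul_single, ← map_mul]
    rfl

theorem charProjector_mul_self [CharZero k] (H : Subgroup G) (χ : G →* k) :
    charProjector H χ * charProjector H χ = charProjector H χ := by
  classical
  conv_lhs => enter [1]; rw [charProjector]
  rw [smul_mul_assoc, Finset.sum_mul, Finset.sum_congr rfl (g := fun _ => charProjector H χ)
    (fun g hg => single_mul_charProjector H χ (Finset.mem_filter.1 hg).2), Finset.sum_const,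
    ← Nat.cast_smul_eq_nsmul k, smul_smul]
  have hc : (Finset.univ.filter fun g => g ∈ H).card = Nat.card H := by
    rw [Nat.card_eq_fintype_card, Fintype.card_subtype]
  rw [hc, inv_mul_cancel₀, one_smul]
  exact Nat.cast_ne_zero.2 Nat.card_pos.ne'

end CharProjector

/-- In a semisimple ring, `m A m = 0` only for `m = 0`. -/
theorem eq_zero_of_forall_mul_mul_eq_zero {A : Type*} [Ring A] [IsSemisimpleRing A] {m : A}
    (h : ∀ y, m * y * m = 0) : m = 0 := by
  obtain ⟨e, he, hspan⟩ := IsSemisimpleRing.ideal_eq_span_idempotent (Ideal.span {m})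
  obtain ⟨x, hx⟩ := Ideal.mem_span_singleton'.1
    (show e ∈ Ideal.span {m} from hspan ▸ Ideal.mem_span_singleton_self e)
  obtain ⟨y, hy⟩ := Ideal.mem_span_singleton'.1
    (show m ∈ Ideal.span {e} from hspan ▸ Ideal.mem_span_singleton_self m)
  have : e = 0 := by
    rw [← he.eq]
    conv_lhs => rw [← hx]
    rw [show x * m * (x * m) = x * (m * x * m) by noncomm_ring, h, mul_zero]
  rw [← hy, this, mul_zero]

theorem eq_zero_of_eq_neg_self (k : Type*) [Field k] [CharZero k] {A : Type*} [AddCommGroup A]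
    [Module k A] {x : A} (h : x = -x) : x = 0 := by
  have h2 : (2 : k) • x = 0 := by
    rw [two_smul]
    nth_rewrite 2 [h]
    exact add_neg_cancel x
  exact (smul_eq_zero.1 h2).resolve_left two_ne_zero

section Young

variable {n : ℕ} (k : Type*) [Field k]

/-- The sign character with values in `k`. -/
def signChar (n : ℕ) : Equiv.Perm (Fin n) →* k :=
  ((Int.castRingHom k : ℤ →* k).comp (Units.coeHom ℤ)).comp Equiv.Perm.sign

theorem signChar_mul_self (g : Equiv.Perm (Fin n)) : signChar k n g * signChar k n g = 1 := by
  have : ((Equiv.Perm.sign g : ℤˣ) : ℤ) * ((Equiv.Perm.sign g : ℤˣ) : ℤ) = 1 := by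
    rw [← Units.val_mul, Int.units_mul_self, Units.val_one]
  change (((Equiv.Perm.sign g : ℤˣ) : ℤ) : k) * (((Equiv.Perm.sign g : ℤˣ) : ℤ) : k) = 1
  rw [← Int.cast_mul, this, Int.cast_one]

theorem signChar_swap {i j : Fin n} (h : i ≠ j) : signChar k n (Equiv.swap i j) = -1 := by
  change (((Equiv.Perm.sign (Equiv.swap i j) : ℤˣ) : ℤ) : k) = -1
  rw [Equiv.Perm.sign_swap h]
  simp

theorem rowProjector_eq (l : n.Partition) : rowProjector k l = charProjector (rowSubgroup l) 1 :=
  rfl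

theorem colProjector_eq (l : n.Partition) :
    colProjector k l = charProjector (colSubgroup l) (signChar k n) := rfl

variable {k}

theorem single_mul_rowProjector (l : n.Partition) {g : Equiv.Perm (Fin n)}
    (hg : g ∈ rowSubgroup l) : MonoidAlgebra.single g 1 * rowProjector k l = rowProjector k l :=
  single_mul_charProjector _ (1 : Equiv.Perm (Fin n) →* k) hg

theorem rowProjector_mul_single (l : n.Partition) {g : Equiv.Perm (Fin n)}
    (hg : g ∈ rowSubgroup l) : rowProjector k l * MonoidAlgebra.single g 1 = rowProjector k l :=
  charProjector_mul_single _ (1 : Equiv.Perm (Fin n) →* k) hg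

theorem single_eq_signChar_smul (g : Equiv.Perm (Fin n)) :
    (MonoidAlgebra.single g 1 : MonoidAlgebra k (Equiv.Perm (Fin n))) =
      signChar k n g • MonoidAlgebra.single g (signChar k n g) := by
  rw [MonoidAlgebra.smul_single, smul_eq_mul, signChar_mul_self]

theorem single_mul_colProjector (l : n.Partition) {g : Equiv.Perm (Fin n)}
    (hg : g ∈ colSubgroup l) :
    MonoidAlgebra.single g 1 * colProjector k l = signChar k n g • colProjector k l := by
  rw [single_eq_signChar_smul, smul_mul_assoc, colProjector_eq, single_mul_charProjector _ _ hg]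

theorem colProjector_mul_single (l : n.Partition) {g : Equiv.Perm (Fin n)}
    (hg : g ∈ colSubgroup l) :
    colProjector k l * MonoidAlgebra.single g 1 = signChar k n g • colProjector k l := by
  rw [single_eq_signChar_smul, mul_smul_comm, colProjector_eq, charProjector_mul_single _ _ hg]

theorem single_mul_single_one (g h : Equiv.Perm (Fin n)) :
    (MonoidAlgebra.single g 1 * MonoidAlgebra.single h 1 :
      MonoidAlgebra k (Equiv.Perm (Fin n))) = MonoidAlgebra.single (g * h) 1 := by
  rw [MonoidAlgebra.single_mul_single, one_mul]

/-- The generator `c_λ` of the Specht module. -/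
def spechtGen (k : Type*) [Field k] (l : n.Partition) : Specht k l :=
  ⟨youngSymmetrizer k l, Submodule.mem_span_singleton_self _⟩

theorem exists_smul_spechtGen {l : n.Partition} (x : Specht k l) :
    ∃ r : MonoidAlgebra k (Equiv.Perm (Fin n)), x = r • spechtGen k l := by
  obtain ⟨r, hr⟩ := Submodule.mem_span_singleton.1 x.2
  exact ⟨r, Subtype.ext hr.symm⟩

section Modules

variable {S : Type*} [AddCommGroup S] [Module (MonoidAlgebra k (Equiv.Perm (Fin n))) S]

/-- The homomorphism `V_λ → S`, `x ↦ x m`. -/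
def spechtHom (l : n.Partition) (m : S) :
    Specht k l →ₗ[MonoidAlgebra k (Equiv.Perm (Fin n))] S :=
  (LinearMap.toSpanSingleton _ S m).comp (Submodule.subtype _)

end Modules

variable [CharZero k]

theorem rowProjector_mul_self (l : n.Partition) :
    rowProjector k l * rowProjector k l = rowProjector k l := by
  rw [rowProjector_eq, charProjector_mul_self]

/-- The transposition can be absorbed by either projector, with opposite signs. -/
theorem rowProjector_mul_single_mul_colProjector_eq_zero (l l' : n.Partition)
    {g : Equiv.Perm (Fin n)} (h : ∃ i j, i ≠ j ∧ Equiv.swap i j ∈ colSubgroup l' ∧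
      g * Equiv.swap i j * g⁻¹ ∈ rowSubgroup l) :
    rowProjector k l * MonoidAlgebra.single g 1 * colProjector k l' = 0 := by
  obtain ⟨i, j, hij, hq, hp⟩ := h
  have hneg : rowProjector k l * MonoidAlgebra.single g 1 * colProjector k l' =
      -(rowProjector k l * MonoidAlgebra.single g 1 * colProjector k l') := by
    conv_lhs => rw [← rowProjector_mul_single l hp]
    rw [mul_assoc (rowProjector k l), single_mul_single_one,
      show g * Equiv.swap i j * g⁻¹ * g = g * Equiv.swap i j by group, ← single_mul_single_one,
      ← mul_assoc, mul_assoc _ _ (colProjector k l'), single_mul_colProjector l' hq,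
      signChar_swap k hij, mul_smul_comm, neg_one_smul]
  exact eq_zero_of_eq_neg_self k hneg

theorem colProjector_mul_single_mul_rowProjector_eq_zero (l : n.Partition)
    {g : Equiv.Perm (Fin n)} (h : ∃ i j, i ≠ j ∧ Equiv.swap i j ∈ colSubgroup l ∧
      g⁻¹ * Equiv.swap i j * g⁻¹⁻¹ ∈ rowSubgroup l) :
    colProjector k l * MonoidAlgebra.single g 1 * rowProjector k l = 0 := by
  obtain ⟨i, j, hij, hq, hp⟩ := h
  have hneg : colProjector k l * MonoidAlgebra.single g 1 * rowProjector k l =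
      -(colProjector k l * MonoidAlgebra.single g 1 * rowProjector k l) := by
    conv_lhs => rw [← single_mul_rowProjector l hp]
    rw [← mul_assoc, mul_assoc (colProjector k l), single_mul_single_one,
      show g * (g⁻¹ * Equiv.swap i j * g⁻¹⁻¹) = Equiv.swap i j * g by group,
      ← single_mul_single_one, ← mul_assoc, colProjector_mul_single l hq, signChar_swap k hij,
      neg_one_smul, neg_mul, neg_mul]
  exact eq_zero_of_eq_neg_self k hneg

theorem dominatedBy_of_mul_mul_ne_zero (l l' : n.Partition)
    {x : MonoidAlgebra k (Equiv.Perm (Fin n))}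
    (h : rowProjector k l * x * colProjector k l' ≠ 0) : DominatedBy (part l) (part l') := by
  by_contra hd
  apply h
  induction x using MonoidAlgebra.induction_on with
  | of g =>
    refine rowProjector_mul_single_mul_colProjector_eq_zero l l' ?_
    exact (exists_swap_or_dominatedBy l l' g).resolve_right fun h => hd h.1
  | add x y hx hy =>
    have hx' : rowProjector k l * x * colProjector k l' = 0 := by by_contra h'; exact h' (hx h')
    have hy' : rowProjector k l * y * colProjector k l' = 0 := by by_contra h'; exact h' (hy h')
    rw [mul_add, add_mul, hx', hy', add_zero]
  | smul r x hx =>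
    have hx' : rowProjector k l * x * colProjector k l' = 0 := by by_contra h'; exact h' (hx h')
    rw [mul_smul_comm, smul_mul_assoc, hx', smul_zero]

theorem exists_rowProjector_mul_mul_colProjector (l : n.Partition)
    (x : MonoidAlgebra k (Equiv.Perm (Fin n))) :
    ∃ r : k, rowProjector k l * x * colProjector k l = r • youngSymmetrizer k l := by
  induction x using MonoidAlgebra.induction_on with
  | of g =>
    change ∃ r : k, rowProjector k l * MonoidAlgebra.single g 1 * colProjector k l = _
    rcases exists_swap_or_eq_mul l g with h | ⟨p, hp, q, hq, rfl⟩
    · exact ⟨0, by rw [zero_smul, rowProjector_mul_single_mul_colProjector_eq_zero l l h]⟩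
    · refine ⟨signChar k n q, ?_⟩
      rw [← single_mul_single_one, ← mul_assoc, rowProjector_mul_single l hp, mul_assoc,
        single_mul_colProjector l hq, mul_smul_comm, youngSymmetrizer]
  | add x y hx hy =>
    obtain ⟨r, hr⟩ := hx
    obtain ⟨s, hs⟩ := hy
    exact ⟨r + s, by rw [mul_add, add_mul, hr, hs, add_smul]⟩
  | smul r x hx =>
    obtain ⟨s, hs⟩ := hx
    exact ⟨r * s, by rw [mul_smul_comm, smul_mul_assoc, hs, smul_smul]⟩

theorem exists_colProjector_mul_mul_rowProjector (l : n.Partition)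
    (x : MonoidAlgebra k (Equiv.Perm (Fin n))) :
    ∃ r : k, colProjector k l * x * rowProjector k l =
      r • (colProjector k l * rowProjector k l) := by
  induction x using MonoidAlgebra.induction_on with
  | of g =>
    change ∃ r : k, colProjector k l * MonoidAlgebra.single g 1 * rowProjector k l = _
    rcases exists_swap_or_eq_mul l g⁻¹ with h | ⟨p, hp, q, hq, hg⟩
    · exact ⟨0, by rw [zero_smul, colProjector_mul_single_mul_rowProjector_eq_zero l h]⟩
    · refine ⟨signChar k n q⁻¹, ?_⟩
      rw [show g = q⁻¹ * p⁻¹ by rw [← mul_inv_rev, ← hg, inv_inv], ← single_mul_single_one,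
        ← mul_assoc, colProjector_mul_single l (inv_mem hq), smul_mul_assoc, smul_mul_assoc,
        mul_assoc, single_mul_rowProjector l (inv_mem hp)]
  | add x y hx hy =>
    obtain ⟨r, hr⟩ := hx
    obtain ⟨s, hs⟩ := hy
    exact ⟨r + s, by rw [mul_add, add_mul, hr, hs, add_smul]⟩
  | smul r x hx =>
    obtain ⟨s, hs⟩ := hx
    exact ⟨r * s, by rw [mul_smul_comm, smul_mul_assoc, hs, smul_smul]⟩

/-- As `P_λ ∩ Q_λ = 1`, only `1 = 1 * 1` contributes to the coefficient. -/
theorem coeff_youngSymmetrizer_one_ne_zero (l : n.Partition) :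
    (youngSymmetrizer k l).coeff 1 ≠ 0 := by
  classical
  have key : ((∑ g : Equiv.Perm (Fin n) with g ∈ rowSubgroup l, MonoidAlgebra.single g (1 : k)) *
      ∑ g : Equiv.Perm (Fin n) with g ∈ colSubgroup l,
        MonoidAlgebra.single g (signChar k n g)).coeff 1 = 1 := by
    rw [Finset.sum_mul_sum, MonoidAlgebra.coeff_sum, Finset.sum_apply']
    rw [Finset.sum_eq_single_of_mem 1 (by simp [one_mem])]
    · rw [MonoidAlgebra.coeff_sum, Finset.sum_apply',
        Finset.sum_eq_single_of_mem 1 (by simp [one_mem])]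
      · rw [MonoidAlgebra.single_mul_single, MonoidAlgebra.coeff_single, Finsupp.single_apply]
        simp
      · intro q hq hq1
        rw [MonoidAlgebra.single_mul_single, MonoidAlgebra.coeff_single, Finsupp.single_apply,
          if_neg]
        simpa using hq1
    · intro p hp hp1
      rw [MonoidAlgebra.coeff_sum, Finset.sum_apply']
      apply Finset.sum_eq_zero
      intro q hq
      rw [MonoidAlgebra.single_mul_single, MonoidAlgebra.coeff_single, Finsupp.single_apply, if_neg]
      intro h
      apply hp1
      refine eq_one_of_mem_rowSubgroup_of_mem_colSubgroup l (Finset.mem_filter.1 hp).2 ?_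
      rw [eq_inv_of_mul_eq_one_left h]
      exact inv_mem (Finset.mem_filter.1 hq).2
  rw [youngSymmetrizer, rowProjector_eq, colProjector_eq, charProjector, charProjector,
    smul_mul_smul_comm, MonoidAlgebra.coeff_smul_apply]
  simp only [MonoidHom.one_apply]
  rw [key, smul_eq_mul, mul_one]
  exact mul_ne_zero (inv_ne_zero (Nat.cast_ne_zero.2 Nat.card_pos.ne'))
    (inv_ne_zero (Nat.cast_ne_zero.2 Nat.card_pos.ne'))

theorem youngSymmetrizer_ne_zero (l : n.Partition) : youngSymmetrizer k l ≠ 0 := fun h =>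
  coeff_youngSymmetrizer_one_ne_zero (k := k) l (by rw [h]; rfl)

theorem exists_youngSymmetrizer_mul_mul (l : n.Partition)
    (x : MonoidAlgebra k (Equiv.Perm (Fin n))) :
    ∃ r : k, youngSymmetrizer k l * x * youngSymmetrizer k l = r • youngSymmetrizer k l := by
  obtain ⟨r, hr⟩ := exists_rowProjector_mul_mul_colProjector l
    (colProjector k l * x * rowProjector k l)
  refine ⟨r, ?_⟩
  rw [← hr, youngSymmetrizer]
  noncomm_ring

/-- `c_λ² = κ c_λ` with `κ ≠ 0`: otherwise `c_λ k[S_n] c_λ`, which consists of multiples of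
`c_λ²`, would vanish. -/
theorem exists_youngSymmetrizer_mul_self (l : n.Partition) :
    ∃ r : k, r ≠ 0 ∧
      youngSymmetrizer k l * youngSymmetrizer k l = r • youngSymmetrizer k l := by
  obtain ⟨r, hr⟩ := exists_youngSymmetrizer_mul_mul (k := k) l 1
  rw [mul_one] at hr
  refine ⟨r, fun h0 => youngSymmetrizer_ne_zero (k := k) l ?_, hr⟩
  rw [h0, zero_smul] at hr
  apply eq_zero_of_forall_mul_mul_eq_zero
  intro y
  obtain ⟨s, hs⟩ := exists_colProjector_mul_mul_rowProjector (k := k) l y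
  rw [youngSymmetrizer] at hr ⊢
  calc rowProjector k l * colProjector k l * y * (rowProjector k l * colProjector k l)
      = rowProjector k l * (colProjector k l * y * rowProjector k l) * colProjector k l := by
        noncomm_ring
    _ = s • (rowProjector k l * colProjector k l * (rowProjector k l * colProjector k l)) := by
        rw [hs, mul_smul_comm, smul_mul_assoc]
        congr 1
        noncomm_ring
    _ = 0 := by rw [hr, smul_zero]

/-- The scalar `κ` with `c_λ² = κ c_λ`. -/
def youngScalar (k : Type*) [Field k] [CharZero k] (l : n.Partition) : k :=
  (exists_youngSymmetrizer_mul_self (k := k) l).choose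

theorem youngScalar_ne_zero (l : n.Partition) : youngScalar k l ≠ 0 :=
  (exists_youngSymmetrizer_mul_self (k := k) l).choose_spec.1

theorem youngSymmetrizer_mul_self (l : n.Partition) :
    youngSymmetrizer k l * youngSymmetrizer k l = youngScalar k l • youngSymmetrizer k l :=
  (exists_youngSymmetrizer_mul_self (k := k) l).choose_spec.2

theorem youngSymmetrizer_smul_spechtGen (l : n.Partition) :
    youngSymmetrizer k l • spechtGen k l = youngScalar k l • spechtGen k l :=
  Subtype.ext (youngSymmetrizer_mul_self l)

theorem spechtGen_ne_zero (l : n.Partition) : spechtGen k l ≠ 0 := fun h =>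
  youngSymmetrizer_ne_zero l (congrArg Subtype.val h)

/-- Right multiplication by `c_λ` is the scalar `κ` on `V_λ`. -/
theorem coe_mul_youngSymmetrizer {l : n.Partition} (x : Specht k l) :
    (x : MonoidAlgebra k (Equiv.Perm (Fin n))) * youngSymmetrizer k l =
      youngScalar k l • (x : MonoidAlgebra k (Equiv.Perm (Fin n))) := by
  obtain ⟨r, rfl⟩ := exists_smul_spechtGen x
  change r * youngSymmetrizer k l * youngSymmetrizer k l =
    youngScalar k l • (r * youngSymmetrizer k l)
  rw [mul_assoc, youngSymmetrizer_mul_self, mul_smul_comm]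

instance isSimpleModule_specht (l : n.Partition) :
    IsSimpleModule (MonoidAlgebra k (Equiv.Perm (Fin n))) (Specht k l) := by
  rw [isSimpleModule_iff_toSpanSingleton_surjective]
  refine ⟨⟨⟨0, spechtGen k l, (spechtGen_ne_zero l).symm⟩⟩, fun m hm y => ?_⟩
  obtain ⟨x, rfl⟩ := exists_smul_spechtGen m
  obtain ⟨z, rfl⟩ := exists_smul_spechtGen y
  have hne : x * youngSymmetrizer k l ≠ 0 := fun h => hm (Subtype.ext h)
  obtain ⟨w, hw⟩ : ∃ w, x * youngSymmetrizer k l * w * (x * youngSymmetrizer k l) ≠ 0 := by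
    by_contra! h
    exact hne (eq_zero_of_forall_mul_mul_eq_zero h)
  obtain ⟨r, hr⟩ := exists_youngSymmetrizer_mul_mul (k := k) l (w * x)
  have hr0 : r ≠ 0 := by
    rintro rfl
    apply hw
    rw [show x * youngSymmetrizer k l * w * (x * youngSymmetrizer k l) =
      x * (youngSymmetrizer k l * (w * x) * youngSymmetrizer k l) by noncomm_ring, hr, zero_smul,
      mul_zero]
  refine ⟨z * (r⁻¹ • (youngSymmetrizer k l * w)), Subtype.ext ?_⟩
  change z * (r⁻¹ • (youngSymmetrizer k l * w)) * (x * youngSymmetrizer k l) =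
    z * youngSymmetrizer k l
  rw [mul_smul_comm, smul_mul_assoc, show z * (youngSymmetrizer k l * w) *
    (x * youngSymmetrizer k l) = z * (youngSymmetrizer k l * (w * x) * youngSymmetrizer k l) by
    noncomm_ring, hr, mul_smul_comm, smul_smul, inv_mul_cancel₀ hr0, one_smul]

section Modules

variable {S : Type*} [AddCommGroup S] [Module (MonoidAlgebra k (Equiv.Perm (Fin n))) S]

/-- A simple module on which `c_λ` does not vanish is isomorphic to `V_λ`. -/
theorem nonempty_specht_equiv [IsSimpleModule (MonoidAlgebra k (Equiv.Perm (Fin n))) S]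
    (l : n.Partition) {m : S} (h : youngSymmetrizer k l • m ≠ 0) :
    Nonempty (Specht k l ≃ₗ[MonoidAlgebra k (Equiv.Perm (Fin n))] S) := by
  refine ⟨LinearEquiv.ofBijective (spechtHom l m) (LinearMap.bijective_of_ne_zero fun h0 => h ?_)⟩
  exact LinearMap.congr_fun h0 (spechtGen k l)

end Modules

theorem dominatedBy_of_rowProjector_smul_ne_zero {l l' : n.Partition} {x : Specht k l'}
    (h : rowProjector k l • x ≠ 0) : DominatedBy (part l) (part l') := by
  obtain ⟨r, rfl⟩ := exists_smul_spechtGen x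
  apply dominatedBy_of_mul_mul_ne_zero (k := k) (x := r * rowProjector k l')
  intro h0
  apply h
  apply Subtype.ext
  change rowProjector k l * (r * youngSymmetrizer k l') = 0
  rw [← h0, youngSymmetrizer]
  noncomm_ring

theorem dominatedBy_of_youngSymmetrizer_smul_ne_zero {l l' : n.Partition} {x : Specht k l'}
    (h : youngSymmetrizer k l • x ≠ 0) : DominatedBy (part l) (part l') := by
  obtain ⟨r, rfl⟩ := exists_smul_spechtGen x
  apply dominatedBy_of_mul_mul_ne_zero (k := k) (x := colProjector k l * r * rowProjector k l')
  intro h0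
  apply h
  apply Subtype.ext
  change youngSymmetrizer k l * (r * youngSymmetrizer k l') = 0
  rw [← h0, youngSymmetrizer, youngSymmetrizer]
  noncomm_ring

/-- An isomorphism `V_λ ≃ V_μ` gives `c_λ V_μ ≠ 0` and `c_μ V_λ ≠ 0`, hence `λ ⊴ μ ⊴ λ`. -/
theorem eq_of_specht_equiv {l l' : n.Partition}
    (e : Specht k l ≃ₗ[MonoidAlgebra k (Equiv.Perm (Fin n))] Specht k l') : l = l' := by
  have key : ∀ {l l' : n.Partition}
      (e : Specht k l ≃ₗ[MonoidAlgebra k (Equiv.Perm (Fin n))] Specht k l'),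
      DominatedBy (part l) (part l') := fun {l l'} e => by
    apply dominatedBy_of_youngSymmetrizer_smul_ne_zero (k := k) (x := e (spechtGen k l))
    rw [← map_smul, youngSymmetrizer_smul_spechtGen]
    rw [Ne, LinearEquiv.map_eq_zero_iff]
    exact smul_ne_zero (youngScalar_ne_zero l) (spechtGen_ne_zero l)
  exact part_eq_of_dominatedBy (key e) (key e.symm)

/-- `c_λ` kills the Specht modules other than `V_λ`. -/
theorem youngSymmetrizer_smul_eq_zero {l l' : n.Partition} (h : l ≠ l') (x : Specht k l') :
    youngSymmetrizer k l • x = 0 := by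
  by_contra h0
  exact h (eq_of_specht_equiv (nonempty_specht_equiv l h0).some)

end Young

/-! ### Trace functions on the group algebra of the symmetric group -/

/-- The trace of an endomorphism of rank at most one. -/
theorem trace_eq_of_forall_exists_smul {k S : Type*} [Field k] [AddCommGroup S] [Module k S]
    [FiniteDimensional k S] (T : S →ₗ[k] S) {v : S} (hv : v ≠ 0) (h : ∀ x, ∃ r : k, T x = r • v)
    {c : k} (hc : T v = c • v) : LinearMap.trace k S T = c := by
  have hmem : ∀ x, T x ∈ Submodule.span k {v} := fun x => by
    obtain ⟨r, hr⟩ := h x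
    exact Submodule.mem_span_singleton.2 ⟨r, hr.symm⟩
  let e := LinearEquiv.toSpanNonzeroSingleton k S v hv
  let f : S →ₗ[k] k := e.symm.toLinearMap.comp (T.codRestrict _ hmem)
  have hf : ∀ x, f x • v = T x := fun x =>
    congrArg Subtype.val (e.apply_symm_apply (T.codRestrict _ hmem x))
  have hT : T = (LinearMap.toSpanSingleton k S v).comp f := by
    ext x
    exact (hf x).symm
  rw [hT, LinearMap.trace_comp_comm',
    LinearMap.trace_eq_matrix_trace k (Module.Basis.singleton Unit k)]
  simp only [Matrix.trace, Finset.univ_unique, Matrix.diag_apply, Finset.sum_singleton,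
    LinearMap.toMatrix_apply, Module.Basis.singleton_apply, Module.Basis.singleton_repr,
    LinearMap.comp_apply, LinearMap.toSpanSingleton_apply, one_smul]
  have := hf v
  rw [hc] at this
  exact smul_left_injective k hv this

section

variable {n : ℕ} {k : Type*} [Field k]

/-- The trace of the action of an element of the group algebra on a module. -/
def smulTrace (k : Type*) [Field k] {n : ℕ} (S : Type*) [AddCommGroup S] [Module k S]
    [Module (MonoidAlgebra k (Equiv.Perm (Fin n))) S]
    [IsScalarTower k (MonoidAlgebra k (Equiv.Perm (Fin n))) S] :
    MonoidAlgebra k (Equiv.Perm (Fin n)) →ₗ[k] k :=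
  (LinearMap.trace k S).comp
    (Algebra.lsmul k k S : MonoidAlgebra k (Equiv.Perm (Fin n)) →ₐ[k] _).toLinearMap

theorem smulTrace_apply (S : Type*) [AddCommGroup S] [Module k S]
    [Module (MonoidAlgebra k (Equiv.Perm (Fin n))) S]
    [IsScalarTower k (MonoidAlgebra k (Equiv.Perm (Fin n))) S]
    (x : MonoidAlgebra k (Equiv.Perm (Fin n))) :
    smulTrace k S x = LinearMap.trace k S (Algebra.lsmul k k S x) := rfl

theorem smulTrace_mul_comm (S : Type*) [AddCommGroup S] [Module k S]
    [Module (MonoidAlgebra k (Equiv.Perm (Fin n))) S]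
    [IsScalarTower k (MonoidAlgebra k (Equiv.Perm (Fin n))) S]
    (x y : MonoidAlgebra k (Equiv.Perm (Fin n))) :
    smulTrace k S (x * y) = smulTrace k S (y * x) := by
  rw [smulTrace_apply, smulTrace_apply, map_mul (Algebra.lsmul k k S),
    map_mul (Algebra.lsmul k k S), LinearMap.trace_mul_comm]

theorem smulTrace_eq_zero (S : Type*) [AddCommGroup S] [Module k S]
    [Module (MonoidAlgebra k (Equiv.Perm (Fin n))) S]
    [IsScalarTower k (MonoidAlgebra k (Equiv.Perm (Fin n))) S]
    {x : MonoidAlgebra k (Equiv.Perm (Fin n))} (h : ∀ s : S, x • s = 0) :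
    smulTrace k S x = 0 := by
  rw [smulTrace_apply, show Algebra.lsmul k k S x = 0 from LinearMap.ext h, map_zero]

/-- The span of the commutators of the group algebra; trace functions factor through the
quotient by it. -/
def commutatorSpan (k : Type*) [Field k] (n : ℕ) :
    Submodule k (MonoidAlgebra k (Equiv.Perm (Fin n))) :=
  Submodule.span k {z | ∃ x y, z = x * y - y * x}

/-- The dimension of the quotient by the commutators is at most the number of conjugacy classes,
that is, of partitions. -/
theorem finrank_quotient_commutatorSpan_le :
    Module.finrank k (MonoidAlgebra k (Equiv.Perm (Fin n)) ⧸ commutatorSpan k n) ≤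
      Fintype.card n.Partition := by
  classical
  let π := (commutatorSpan k n).mkQ
  let v : (Fintype.card (Fin n)).Partition →
      MonoidAlgebra k (Equiv.Perm (Fin n)) ⧸ commutatorSpan k n := fun p =>
    if h : ∃ g : Equiv.Perm (Fin n), g.partition = p then π (MonoidAlgebra.single h.choose 1)
    else 0
  have hv : Submodule.span k (Set.range v) = ⊤ := by
    rw [eq_top_iff]
    rintro z -
    obtain ⟨x, rfl⟩ := (commutatorSpan k n).mkQ_surjective z
    induction x using MonoidAlgebra.induction_on with
    | of g =>
      have hex : ∃ g' : Equiv.Perm (Fin n), g'.partition = g.partition := ⟨g, rfl⟩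
      apply Submodule.subset_span
      refine ⟨g.partition, ?_⟩
      simp only [v]
      rw [dif_pos hex]
      obtain ⟨h, hh⟩ := isConj_iff.1 (Equiv.Perm.partition_eq_of_isConj.2 hex.choose_spec)
      change (commutatorSpan k n).mkQ _ = (commutatorSpan k n).mkQ (MonoidAlgebra.single g 1)
      rw [← sub_eq_zero, ← map_sub, Submodule.mkQ_apply, Submodule.Quotient.mk_eq_zero]
      apply Submodule.subset_span
      refine ⟨MonoidAlgebra.single (hex.choose * h⁻¹) 1, MonoidAlgebra.single h 1, ?_⟩
      rw [single_mul_single_one, single_mul_single_one, ← mul_assoc, hh, inv_mul_cancel_right]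
    | add x y hx hy =>
      rw [map_add]
      exact add_mem hx hy
    | smul r x hx =>
      rw [map_smul]
      exact Submodule.smul_mem _ _ hx
  calc _ = (Set.range v).finrank k := by rw [Set.finrank, hv, finrank_top]
    _ ≤ Fintype.card (Fintype.card (Fin n)).Partition := finrank_range_le_card v
    _ = _ := by rw [Fintype.card_fin]

theorem commutatorSpan_le_ker {W : Type*} [AddCommGroup W] [Module k W]
    {φ : MonoidAlgebra k (Equiv.Perm (Fin n)) →ₗ[k] W} (hφ : ∀ x y, φ (x * y) = φ (y * x)) :
    commutatorSpan k n ≤ LinearMap.ker φ := by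
  rw [commutatorSpan, Submodule.span_le]
  rintro _ ⟨x, y, rfl⟩
  simp [hφ x y]

variable [CharZero k]

instance finiteDimensional_specht (l : n.Partition) : FiniteDimensional k (Specht k l) :=
  Module.Finite.of_injective ((Submodule.subtype (Specht k l)).restrictScalars k)
    Subtype.val_injective

theorem smulTrace_specht_youngSymmetrizer_self (l : n.Partition) :
    smulTrace k (Specht k l) (youngSymmetrizer k l) = youngScalar k l := by
  rw [smulTrace_apply]
  refine trace_eq_of_forall_exists_smul _ (spechtGen_ne_zero l) (fun x => ?_)
    (youngSymmetrizer_smul_spechtGen l)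
  obtain ⟨r, rfl⟩ := exists_smul_spechtGen x
  obtain ⟨s, hs⟩ := exists_youngSymmetrizer_mul_mul (k := k) l r
  refine ⟨s, Subtype.ext ?_⟩
  rw [mul_assoc] at hs
  exact hs

theorem smulTrace_specht_youngSymmetrizer_of_ne {l l' : n.Partition} (h : l ≠ l') :
    smulTrace k (Specht k l') (youngSymmetrizer k l) = 0 :=
  smulTrace_eq_zero _ (youngSymmetrizer_smul_eq_zero h)

theorem smulTrace_specht_rowProjector_self (l : n.Partition) :
    smulTrace k (Specht k l) (rowProjector k l) = 1 := by
  rw [smulTrace_apply]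
  refine trace_eq_of_forall_exists_smul _ (spechtGen_ne_zero l) (fun x => ?_) ?_
  · obtain ⟨r, rfl⟩ := exists_smul_spechtGen x
    obtain ⟨s, hs⟩ := exists_rowProjector_mul_mul_colProjector (k := k) l (r * rowProjector k l)
    refine ⟨s, Subtype.ext ?_⟩
    rw [mul_assoc, mul_assoc] at hs
    exact hs
  · rw [one_smul]
    apply Subtype.ext
    change rowProjector k l * (rowProjector k l * colProjector k l) =
      rowProjector k l * colProjector k l
    rw [← mul_assoc, rowProjector_mul_self]

/-- The character of `V_ν` takes a nonzero value at `a_μ` only if `μ ⊴ ν`. -/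
theorem dominatedBy_of_smulTrace_ne_zero {l l' : n.Partition}
    (h : smulTrace k (Specht k l') (rowProjector k l) ≠ 0) :
    DominatedBy (part l) (part l') := by
  by_contra hd
  apply h
  apply smulTrace_eq_zero
  intro s
  by_contra hs
  exact hd (dominatedBy_of_rowProjector_smul_ne_zero hs)

/-- The Young symmetrizers form a basis of the group algebra modulo commutators: they are
separated by the characters of the Specht modules, and there are enough of them. -/
theorem span_youngSymmetrizer_sup_commutatorSpan :
    Submodule.span k (Set.range fun l : n.Partition =>
      (commutatorSpan k n).mkQ (youngSymmetrizer k l)) = ⊤ := by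
  have hli : LinearIndependent k fun l : n.Partition =>
      (commutatorSpan k n).mkQ (youngSymmetrizer k l) := by
    rw [Fintype.linearIndependent_iff]
    intro r hr l
    let φ := (commutatorSpan k n).liftQ (smulTrace k (Specht k l))
      (commutatorSpan_le_ker (smulTrace_mul_comm _))
    have h := congrArg φ hr
    rw [map_sum, map_zero, Finset.sum_eq_single l] at h
    · simp only [map_smul, φ, Submodule.mkQ_apply, Submodule.liftQ_apply,
        smulTrace_specht_youngSymmetrizer_self] at h
      exact (smul_eq_zero.1 h).resolve_right (youngScalar_ne_zero l)
    · intro l' _ hl'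
      simp only [map_smul, φ, Submodule.mkQ_apply, Submodule.liftQ_apply,
        smulTrace_specht_youngSymmetrizer_of_ne hl', smul_zero]
    · simp
  apply hli.span_eq_top_of_card_eq_finrank'
  exact le_antisymm hli.fintype_card_le_finrank finrank_quotient_commutatorSpan_le

/-- The expansion of a trace function in the characters of the Specht modules. -/
theorem traceFunction_eq_sum {W : Type*} [AddCommGroup W] [Module k W]
    {φ : MonoidAlgebra k (Equiv.Perm (Fin n)) →ₗ[k] W} (hφ : ∀ x y, φ (x * y) = φ (y * x))
    (x : MonoidAlgebra k (Equiv.Perm (Fin n))) :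
    φ x = ∑ l : n.Partition,
      (smulTrace k (Specht k l) x * (youngScalar k l)⁻¹) • φ (youngSymmetrizer k l) := by
  let ψ : MonoidAlgebra k (Equiv.Perm (Fin n)) →ₗ[k] W :=
    ∑ l : n.Partition, (smulTrace k (Specht k l)).smulRight
      ((youngScalar k l)⁻¹ • φ (youngSymmetrizer k l))
  have hψ_apply : ∀ x, ψ x = ∑ l : n.Partition,
      (smulTrace k (Specht k l) x * (youngScalar k l)⁻¹) • φ (youngSymmetrizer k l) := fun x => by
    simp only [ψ, LinearMap.sum_apply, LinearMap.smulRight_apply, smul_smul]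
  have hψ : ∀ x y, ψ (x * y) = ψ (y * x) := fun x y => by
    rw [hψ_apply, hψ_apply]
    exact Finset.sum_congr rfl fun l _ => by rw [smulTrace_mul_comm]
  have key : (commutatorSpan k n).liftQ φ (commutatorSpan_le_ker hφ) =
      (commutatorSpan k n).liftQ ψ (commutatorSpan_le_ker hψ) := by
    apply LinearMap.ext_on_range span_youngSymmetrizer_sup_commutatorSpan
    intro l
    rw [Submodule.mkQ_apply, Submodule.liftQ_apply, Submodule.liftQ_apply, hψ_apply,
      Finset.sum_eq_single l]
    · rw [smulTrace_specht_youngSymmetrizer_self, mul_inv_cancel₀ (youngScalar_ne_zero l),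
        one_smul]
    · intro l' _ hl'
      rw [smulTrace_specht_youngSymmetrizer_of_ne hl'.symm, zero_mul, zero_smul]
    · simp
  rw [← hψ_apply]
  exact LinearMap.congr_fun key ((commutatorSpan k n).mkQ x)

/-- Every simple module over the group algebra of `S_n` is a Specht module: otherwise all the
Young symmetrizers kill it, and its character, being a trace function, vanishes. -/
theorem exists_specht_equiv (S : Type*) [AddCommGroup S] [Module k S]
    [Module (MonoidAlgebra k (Equiv.Perm (Fin n))) S]
    [IsScalarTower k (MonoidAlgebra k (Equiv.Perm (Fin n))) S] [FiniteDimensional k S]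
    [IsSimpleModule (MonoidAlgebra k (Equiv.Perm (Fin n))) S] :
    ∃ l : n.Partition,
      Nonempty (Specht k l ≃ₗ[MonoidAlgebra k (Equiv.Perm (Fin n))] S) := by
  by_contra! h
  have h0 : ∀ (l : n.Partition) (s : S), youngSymmetrizer k l • s = 0 := fun l s => by
    by_contra hs
    exact (h l).false (nonempty_specht_equiv l hs).some
  have h1 : smulTrace k S (1 : MonoidAlgebra k (Equiv.Perm (Fin n))) = 0 := by
    rw [traceFunction_eq_sum (smulTrace_mul_comm S) 1]
    exact Finset.sum_eq_zero fun l _ => by rw [smulTrace_eq_zero S (h0 l), smul_zero]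
  rw [smulTrace_apply, map_one, LinearMap.trace_one, Nat.cast_eq_zero] at h1
  have := IsSimpleModule.nontrivial (MonoidAlgebra k (Equiv.Perm (Fin n))) S
  exact Module.finrank_pos.ne' h1

end

/-! ### Alternants and complete symmetric polynomials -/

section Alternants

open MvPolynomial

variable {N : ℕ} (R : Type*) [CommRing R]

/-- The alternant `det (x_i^{e_j})` of an exponent sequence `e`. -/
def expAlternant (e : Fin N → ℕ) : MvPolynomial (Fin N) R :=
  Matrix.det (Matrix.of fun i j : Fin N => (X i : MvPolynomial (Fin N) R) ^ e j)

/-- The complete symmetric polynomial of degree `m`. -/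
def completeSymm (N m : ℕ) : MvPolynomial (Fin N) R :=
  ∑ β ∈ Finset.univ.finsuppAntidiag m, ∏ i : Fin N, X i ^ β i

variable {R}

theorem prod_X_pow_eq_monomial (a : Fin N → ℕ) :
    ∏ i, (X i : MvPolynomial (Fin N) R) ^ a i = monomial (Finsupp.equivFunOnFinite.symm a) 1 := by
  rw [monomial_eq, C_1, one_mul, Finsupp.prod_fintype _ _ fun i => pow_zero _]
  rfl

theorem expAlternant_eq_sum (e : Fin N → ℕ) :
    expAlternant R e = ∑ s : Equiv.Perm (Fin N),
      Equiv.Perm.sign s • monomial (Finsupp.equivFunOnFinite.symm fun i => e (s⁻¹ i)) (1 : R) := by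
  rw [expAlternant, Matrix.det_apply]
  refine Finset.sum_congr rfl fun s _ => ?_
  rw [← prod_X_pow_eq_monomial]
  congr 1
  refine Fintype.prod_equiv s _ _ fun i => ?_
  simp

theorem expAlternant_comp_perm (e : Fin N → ℕ) (s : Equiv.Perm (Fin N)) :
    expAlternant R (fun i => e (s i)) = Equiv.Perm.sign s • expAlternant R e := by
  have := Matrix.det_permute' s (Matrix.of fun i j : Fin N => (X i : MvPolynomial (Fin N) R) ^ e j)
  rw [Units.smul_def, zsmul_eq_mul]
  exact this

theorem expAlternant_eq_zero {e : Fin N → ℕ} (h : ¬ Function.Injective e) :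
    expAlternant R e = 0 := by
  simp only [Function.Injective, not_forall] at h
  obtain ⟨i, j, hij, hne⟩ := h
  exact Matrix.det_zero_of_column_eq hne fun m => by simp [hij]

theorem coeff_sign_smul (d : Fin N →₀ ℕ) (s : Equiv.Perm (Fin N)) (p : MvPolynomial (Fin N) R) :
    coeff d (Equiv.Perm.sign s • p) = Equiv.Perm.sign s • coeff d p := by
  rw [Units.smul_def, Units.smul_def]
  exact map_zsmul (coeffAddMonoidHom d) _ _

theorem exists_perm_of_coeff_expAlternant_ne_zero {e d : Fin N → ℕ}
    (h : coeff (Finsupp.equivFunOnFinite.symm d) (expAlternant R e) ≠ 0) :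
    ∃ s : Equiv.Perm (Fin N), ∀ i, d i = e (s i) := by
  rw [expAlternant_eq_sum, coeff_sum] at h
  obtain ⟨s, -, hs⟩ := Finset.exists_ne_zero_of_sum_ne_zero h
  refine ⟨s⁻¹, fun i => ?_⟩
  rw [coeff_sign_smul, coeff_monomial] at hs
  by_cases hd : (Finsupp.equivFunOnFinite.symm fun i => e (s⁻¹ i)) =
      Finsupp.equivFunOnFinite.symm d
  · exact (congrFun (Finsupp.equivFunOnFinite.symm.injective hd) i).symm
  · rw [if_neg hd, smul_zero] at hs
    exact absurd rfl hs

/-- Two strictly decreasing sequences that are rearrangements of each other agree. -/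
theorem eq_of_strictAnti_comp_perm {e d : Fin N → ℕ} (he : StrictAnti e) (hd : StrictAnti d)
    {s : Equiv.Perm (Fin N)} (h : ∀ i, d i = e (s i)) : s = 1 := by
  have hs : StrictMono s := fun i j hij => by
    have := hd hij
    rw [h, h] at this
    exact he.lt_iff_gt.1 this
  have := Subsingleton.elim (hs.orderIsoOfSurjective s s.surjective) (OrderIso.refl _)
  ext i
  exact congrArg Fin.val (DFunLike.congr_fun this i)

theorem coeff_expAlternant_self {e : Fin N → ℕ} (he : StrictAnti e) :
    coeff (Finsupp.equivFunOnFinite.symm e) (expAlternant R e) = 1 := by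
  rw [expAlternant_eq_sum, coeff_sum, Finset.sum_eq_single 1]
  · simp [coeff_monomial]
  · intro s _ hs
    rw [coeff_sign_smul, coeff_monomial, if_neg, smul_zero]
    intro h
    apply hs
    rw [← inv_eq_one]
    exact eq_of_strictAnti_comp_perm he he fun i =>
      (congrFun (Finsupp.equivFunOnFinite.symm.injective h) i).symm
  · simp

theorem coeff_expAlternant_of_ne {e d : Fin N → ℕ} (he : StrictAnti e) (hd : StrictAnti d)
    (h : d ≠ e) : coeff (Finsupp.equivFunOnFinite.symm d) (expAlternant R e) = 0 := by
  by_contra h0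
  obtain ⟨s, hs⟩ := exists_perm_of_coeff_expAlternant_ne_zero h0
  apply h
  funext i
  rw [hs, eq_of_strictAnti_comp_perm he hd hs, Equiv.Perm.one_apply]

/-- The sum of the first `s` entries of a sequence. -/
def partialSum (e : Fin N → ℕ) (s : ℕ) : ℕ :=
  ∑ j ∈ Finset.univ.filter fun j : Fin N => (j : ℕ) < s, e j

theorem partialSum_add (e d : Fin N → ℕ) (s : ℕ) :
    partialSum (fun i => e i + d i) s = partialSum e s + partialSum d s := Finset.sum_add_distrib

theorem partialSum_succ (e : Fin N → ℕ) (i : Fin N) :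
    partialSum e (i + 1) = partialSum e i + e i := by
  unfold partialSum
  rw [add_comm (Finset.sum _ _), ← Finset.sum_insert (f := e) (by simp)]
  congr 1
  ext j
  simp only [Finset.mem_filter, Finset.mem_univ, true_and, Finset.mem_insert, Fin.ext_iff]
  omega

theorem eq_of_partialSum_eq {e d : Fin N → ℕ} (h : ∀ s, partialSum e s = partialSum d s) :
    e = d := by
  funext i
  have := h (i + 1)
  rw [partialSum_succ, partialSum_succ, h] at this
  omega

/-- A decreasing sequence has the largest partial sums among its rearrangements. -/
theorem partialSum_comp_perm_le {e : Fin N → ℕ} (he : Antitone e) (s : Equiv.Perm (Fin N))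
    (t : ℕ) : partialSum (fun i => e (s i)) t ≤ partialSum e t := by
  have h := Monovary.sum_comp_perm_mul_le_sum_mul (σ := s) (f := fun i => (e i : ℤ))
    (g := fun j : Fin N => if (j : ℕ) < t then (1 : ℤ) else 0) (by
      intro i j hij
      by_cases hi : (i : ℕ) < t <;> by_cases hj : (j : ℕ) < t <;> simp only [hi, hj] at hij <;>
        simp at hij
      have hji : j ≤ i := by
        rw [Fin.le_def]
        omega
      exact Int.ofNat_le.2 (he hji))
  unfold partialSum
  simp only [mul_ite, mul_one, mul_zero] at h
  rw [← Finset.sum_filter, ← Finset.sum_filter] at h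
  exact_mod_cast h

theorem exists_strictAnti_comp_perm {e : Fin N → ℕ} (he : Function.Injective e) :
    ∃ s : Equiv.Perm (Fin N), StrictAnti fun i => e (s i) := by
  refine ⟨Fin.revPerm.trans (Tuple.sort e), fun i j hij => ?_⟩
  have hm : Monotone (e ∘ Tuple.sort e) := Tuple.monotone_sort e
  have hs : StrictMono (e ∘ Tuple.sort e) :=
    hm.strictMono_of_injective (he.comp (Tuple.sort e).injective)
  exact hs (Fin.rev_lt_rev.2 hij)

/-- An element of the span of the alternants `D(e)` with `e ⊵ d` all of whose monomials are
`⊴ d` is a multiple of `D(d)`. -/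
theorem eq_coeff_smul_expAlternant {f : MvPolynomial (Fin N) R} {d : Fin N → ℕ}
    (hd : StrictAnti d)
    (hf : f ∈ Submodule.span R (expAlternant R ''
      {e : Fin N → ℕ | ∀ s, partialSum d s ≤ partialSum e s}))
    (hm : ∀ e : Fin N → ℕ, coeff (Finsupp.equivFunOnFinite.symm e) f ≠ 0 →
      ∀ s, partialSum e s ≤ partialSum d s) :
    f = coeff (Finsupp.equivFunOnFinite.symm d) f • expAlternant R d := by
  have hf' : f ∈ Submodule.span R (expAlternant R ''
      {e : Fin N → ℕ | StrictAnti e ∧ ∀ s, partialSum d s ≤ partialSum e s}) := by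
    refine Submodule.span_le.2 ?_ hf
    rintro _ ⟨e, he, rfl⟩
    by_cases hinj : Function.Injective e
    · obtain ⟨s, hs⟩ := exists_strictAnti_comp_perm hinj
      have h1 : expAlternant R e =
          ((Equiv.Perm.sign s⁻¹ : ℤˣ) : ℤ) • expAlternant R (fun i => e (s i)) := by
        rw [← Units.smul_def, ← expAlternant_comp_perm]
        simp
      rw [h1]
      apply zsmul_mem
      refine Submodule.subset_span ⟨_, ⟨hs, fun t => (he t).trans ?_⟩, rfl⟩
      simpa using partialSum_comp_perm_le hs.antitone s⁻¹ t
    · rw [expAlternant_eq_zero hinj]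
      exact zero_mem _
  obtain ⟨q, hq, rfl⟩ := (Finsupp.mem_span_image_iff_linearCombination R).1 hf'
  rw [Finsupp.mem_supported] at hq
  have hcoeff : ∀ e ∈ q.support, coeff (Finsupp.equivFunOnFinite.symm e)
      (Finsupp.linearCombination R (expAlternant R) q) = q e := by
    intro e he
    rw [Finsupp.linearCombination_apply, Finsupp.sum, coeff_sum, Finset.sum_eq_single_of_mem e he]
    · rw [coeff_smul, coeff_expAlternant_self (hq he).1, smul_eq_mul, mul_one]
    · intro b hb hbe
      rw [coeff_smul, coeff_expAlternant_of_ne (hq hb).1 (hq he).1 hbe.symm, smul_zero]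
  have hsupp : q.support ⊆ {d} := fun e he => by
    rw [Finset.mem_singleton]
    refine eq_of_partialSum_eq fun s => le_antisymm (hm e ?_ s) ((hq he).2 s)
    rw [hcoeff e he]
    exact Finsupp.mem_support_iff.1 he
  obtain ⟨r, rfl⟩ := Finsupp.support_subset_singleton'.1 hsupp
  rw [Finsupp.linearCombination_single, coeff_smul, coeff_expAlternant_self hd, smul_eq_mul,
    mul_one]

open PowerSeries in
/-- A Pieri rule: if the exponents `e_s, e_{s+1}, …` are consecutive, the product `h_m D(e)` is
the sum of the `D(e + β)` over the `β` of size `m` supported on the first `s + 1` entries.  The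
generating function of `h_m D(e)` is the determinant of the columns `x_i^{e_j} / (1 - x_i T)`, and
subtracting `T` times the preceding column turns column `j > s` into `x_i^{e_j}`. -/
theorem completeSymm_mul_expAlternant (m : ℕ) {e : Fin N → ℕ} {s : ℕ}
    (he : ∀ i j : Fin N, s ≤ i → (j : ℕ) = i + 1 → e i = e j + 1) :
    completeSymm R N m * expAlternant R e =
      ∑ β ∈ Finset.univ.finsuppAntidiag m with ∀ j : Fin N, s < j → β j = 0,
        expAlternant R (fun i => e i + β i) := by
  let G : Fin N → PowerSeries (MvPolynomial (Fin N) R) := fun i => PowerSeries.mk fun b => X i ^ b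
  let A : Matrix (Fin N) (Fin N) (PowerSeries (MvPolynomial (Fin N) R)) :=
    Matrix.of fun i j => PowerSeries.C (X i ^ e j)
  let A' : Matrix (Fin N) (Fin N) (PowerSeries (MvPolynomial (Fin N) R)) :=
    Matrix.of fun i j => G i * A i j
  let B : Matrix (Fin N) (Fin N) (PowerSeries (MvPolynomial (Fin N) R)) :=
    Matrix.of fun i j => if s < (j : ℕ) then A i j else A' i j
  have hcoeffG : ∀ i j b, PowerSeries.coeff b (A' i j) = X i ^ (e j + b) := fun i j b => by
    simp only [A', A, G, Matrix.of_apply]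
    rw [PowerSeries.coeff_mul_C, PowerSeries.coeff_mk, pow_add, mul_comm]
  have hdet : A'.det = B.det := by
    have hG : ∀ (i : Fin N) (a : ℕ), G i * PowerSeries.C (X i ^ a) =
        PowerSeries.C (X i ^ a) + PowerSeries.X * (G i * PowerSeries.C (X i ^ (a + 1))) := by
      intro i a
      ext b : 1
      rw [map_add, PowerSeries.coeff_mul_C]
      rcases b with _ | b
      · rw [PowerSeries.coeff_zero_X_mul, PowerSeries.coeff_C]
        simp [G]
      · rw [PowerSeries.coeff_succ_X_mul, PowerSeries.coeff_C, PowerSeries.coeff_mul_C]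
        simp only [G, PowerSeries.coeff_mk, if_neg (Nat.succ_ne_zero b), zero_add]
        ring
    rcases N with _ | N
    · rw [Matrix.det_isEmpty, Matrix.det_isEmpty]
    · refine Matrix.det_eq_of_forall_col_eq_smul_add_pred
        (fun j : Fin N => if s ≤ (j : ℕ) then PowerSeries.X else 0) ?_ ?_
      · intro i
        simp [B]
      · intro i j
        by_cases hj : s ≤ (j : ℕ)
        · have h1 := he j.castSucc j.succ hj (by simp)
          have h2 : B i j.succ = A i j.succ := if_pos (by simpa using Nat.lt_succ_of_le hj)
          rw [h2, if_pos hj]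
          simp only [A', A, Matrix.of_apply]
          rw [h1]
          exact hG i (e j.succ)
        · have h2 : B i j.succ = A' i j.succ := if_neg (by simpa using not_le.1 hj)
          rw [h2, if_neg hj, zero_mul, add_zero]
  have h1 : PowerSeries.coeff m A'.det = completeSymm R N m * expAlternant R e := by
    have hA : A.det = PowerSeries.C (expAlternant R e) := by
      rw [expAlternant, RingHom.map_det]
      rfl
    rw [Matrix.det_mul_column, hA, PowerSeries.coeff_mul_C, PowerSeries.coeff_prod, completeSymm]
    simp only [G, PowerSeries.coeff_mk]
  have hB : ∀ i j b, PowerSeries.coeff b (B i j) =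
      if s < (j : ℕ) ∧ b ≠ 0 then 0 else X i ^ (e j + b) := by
    intro i j b
    simp only [B, Matrix.of_apply]
    by_cases hj : s < (j : ℕ)
    · simp only [if_pos hj, A, Matrix.of_apply, PowerSeries.coeff_C]
      by_cases hb : b = 0 <;> simp [hb, hj]
    · rw [if_neg hj, if_neg (fun h => hj h.1), hcoeffG]
  rw [← h1, hdet, Matrix.det_apply, map_sum]
  simp only [Units.smul_def, map_zsmul, PowerSeries.coeff_prod, hB]
  simp only [expAlternant, Matrix.det_apply]
  conv_rhs => rw [Finset.sum_comm]
  refine Finset.sum_congr rfl fun σ _ => ?_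
  rw [← Finset.smul_sum, Finset.sum_filter]
  simp only [Units.smul_def]
  congr 1
  refine Finset.sum_congr rfl fun β _ => ?_
  split_ifs with h
  · refine Finset.prod_congr rfl fun j _ => ?_
    rw [if_neg fun h' => h'.2 (h j h'.1)]
    rfl
  · push Not at h
    obtain ⟨j, h1, h2⟩ := h
    exact Finset.prod_eq_zero (Finset.mem_univ j) (if_pos ⟨h1, h2⟩)

/-- The staircase `(N - 1, …, 1, 0)`. -/
def staircase (N : ℕ) : Fin N → ℕ := fun j => N - 1 - j

/-- Every alternant that occurs in `h_{a_0} ⋯ h_{a_{p-1}} D(ρ)` dominates `a + ρ`, by repeated use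
of the Pieri rule. -/
theorem prod_completeSymm_mul_expAlternant_mem (a : ℕ → ℕ) (p : ℕ) :
    (∏ t ∈ Finset.range p, completeSymm R N (a t)) * expAlternant R (staircase N) ∈
      Submodule.span R (expAlternant R '' {e : Fin N → ℕ |
        (∀ j : Fin N, p ≤ j → e j = staircase N j) ∧
        ∀ s ≤ p, (∑ t ∈ Finset.range s, a t) + partialSum (staircase N) s ≤ partialSum e s}) := by
  induction p with
  | zero =>
    rw [Finset.range_zero, Finset.prod_empty, one_mul]
    refine Submodule.subset_span ⟨_, ⟨fun _ _ => rfl, fun s hs => ?_⟩, rfl⟩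
    rw [Nat.le_zero.1 hs, Finset.range_zero, Finset.sum_empty, zero_add]
  | succ p ih =>
    rw [Finset.prod_range_succ, mul_comm _ (completeSymm R N (a p)), mul_assoc]
    have hmap := Submodule.mem_map_of_mem (f := LinearMap.mulLeft R (completeSymm R N (a p))) ih
    rw [Submodule.map_span, LinearMap.mulLeft_apply] at hmap
    refine Submodule.span_le.2 ?_ hmap
    rintro _ ⟨_, ⟨e, ⟨he1, he2⟩, rfl⟩, rfl⟩
    rw [LinearMap.mulLeft_apply, completeSymm_mul_expAlternant (s := p)]
    · refine Submodule.sum_mem _ fun β hβ => Submodule.subset_span ⟨_, ⟨?_, ?_⟩, rfl⟩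
      · intro j hj
        rw [(Finset.mem_filter.1 hβ).2 j hj, add_zero, he1 j (Nat.le_of_succ_le hj)]
      · intro s hs
        rw [partialSum_add e β]
        rcases hs.lt_or_eq with hs | rfl
        · exact (he2 s (Nat.lt_succ_iff.1 hs)).trans (Nat.le_add_right _ _)
        · have hβ1 : partialSum β (p + 1) = a p := by
            rw [← (Finset.mem_finsuppAntidiag.1 (Finset.mem_filter.1 hβ).1).1, partialSum]
            refine Finset.sum_subset (Finset.filter_subset _ _) fun j _ hj => ?_
            refine (Finset.mem_filter.1 hβ).2 j ?_
            simp only [Finset.mem_filter, Finset.mem_univ, true_and] at hj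
            omega
          have hρ : partialSum (staircase N) (p + 1) + partialSum e p ≤
              partialSum e (p + 1) + partialSum (staircase N) p := by
            by_cases hp : p < N
            · have h1 := partialSum_succ e ⟨p, hp⟩
              have h2 := partialSum_succ (staircase N) ⟨p, hp⟩
              have h3 := he1 ⟨p, hp⟩ le_rfl
              simp only at h1 h2
              omega
            · have : ∀ f : Fin N → ℕ, partialSum f (p + 1) = partialSum f p := fun f => by
                unfold partialSum
                congr 1
                ext j
                simp only [Finset.mem_filter, Finset.mem_univ, true_and]
                omega
              rw [this, this, add_comm]
          have h4 := he2 p le_rfl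
          rw [Finset.sum_range_succ, hβ1]
          omega
    · intro i j hi hij
      rw [he1 i hi, he1 j (by omega)]
      simp only [staircase]
      omega

end Alternants

/-! ### The characters of the Young symmetrizers on words -/

section WordCharacter

open MvPolynomial

variable {n N : ℕ} {k : Type*} [Field k]

/-- The polynomial `∑ x_{f(1)} ⋯ x_{f(n)}` over the words `f` fixed by a permutation `s`; this is
the power sum attached to the cycle type of `s`. -/
def permPoly (k : Type*) [Field k] (N : ℕ) (s : Equiv.Perm (Fin n)) : MvPolynomial (Fin N) k :=
  ∑ f : Fin n → Fin N with ∀ m, f (s m) = f m, ∏ m, X (f m)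

/-- The linear extension of `permPoly` to the group algebra: the character of
`diag(x_1, …, x_N)` times an element of the group algebra on the `n`-th tensor power. -/
def wordChar (k : Type*) [Field k] (n N : ℕ) :
    MonoidAlgebra k (Equiv.Perm (Fin n)) →ₗ[k] MvPolynomial (Fin N) k :=
  (Finsupp.linearCombination k (permPoly k N)).comp
    (MonoidAlgebra.coeffLinearEquiv k).toLinearMap

theorem wordChar_single (s : Equiv.Perm (Fin n)) (r : k) :
    wordChar k n N (MonoidAlgebra.single s r) = r • permPoly k N s :=
  Finsupp.linearCombination_single k r s

theorem permPoly_mul_comm (s t : Equiv.Perm (Fin n)) :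
    permPoly k N (s * t) = permPoly k N (t * s) := by
  unfold permPoly
  refine Finset.sum_equiv (Equiv.arrowCongr s.symm (Equiv.refl _)) (fun f => ?_) fun f _ => ?_
  · rw [Finset.mem_filter_univ, Finset.mem_filter_univ]
    exact ⟨fun h m => h (s m), fun h m => by simpa using h (s.symm m)⟩
  · exact (Fintype.prod_equiv s _ _ fun m => rfl).symm

theorem linearMap_ext_single {W : Type*} [AddCommGroup W] [Module k W]
    {φ ψ : MonoidAlgebra k (Equiv.Perm (Fin n)) →ₗ[k] W}
    (h : ∀ g, φ (MonoidAlgebra.single g 1) = ψ (MonoidAlgebra.single g 1)) : φ = ψ := by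
  refine (MonoidAlgebra.basis (Equiv.Perm (Fin n)) k).ext fun g => ?_
  rw [MonoidAlgebra.basis_apply]
  exact h g

theorem wordChar_mul_comm (x y : MonoidAlgebra k (Equiv.Perm (Fin n))) :
    wordChar k n N (x * y) = wordChar k n N (y * x) := by
  have h : (LinearMap.mul k (MonoidAlgebra k (Equiv.Perm (Fin n)))).compr₂ (wordChar k n N) =
      (LinearMap.mul k (MonoidAlgebra k (Equiv.Perm (Fin n)))).flip.compr₂ (wordChar k n N) := by
    refine linearMap_ext_single fun g => linearMap_ext_single fun h => ?_
    simp only [LinearMap.compr₂_apply, LinearMap.flip_apply, LinearMap.mul_apply']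
    rw [single_mul_single_one, single_mul_single_one, wordChar_single, wordChar_single,
      permPoly_mul_comm]
  exact LinearMap.congr_fun (LinearMap.congr_fun h x) y

section Content

variable {ι : Type*} [DecidableEq ι]

/-- The content of a word `f` along a labelling `r`: the number of places with label `i` and
letter `j`. -/
def content (r : Fin n → ι) (f : Fin n → Fin N) (i : ι) : Fin N →₀ ℕ :=
  Finsupp.equivFunOnFinite.symm fun j => (Finset.univ.filter fun m => (r m, f m) = (i, j)).card

theorem content_apply (r : Fin n → ι) (f : Fin n → Fin N) (i : ι) (j : Fin N) :
    content r f i j = (Finset.univ.filter fun m => (r m, f m) = (i, j)).card := rfl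

variable [Fintype ι]

/-- The words of a given content along `r` form one orbit of the stabilizer of `r`; hence the
stabilizers of these words inside it have as many elements in total as the stabilizer of `r`. -/
theorem sum_card_stabilizer (r : Fin n → ι) (f₀ : Fin n → Fin N) :
    ∑ f : Fin n → Fin N with content r f = content r f₀,
      (Finset.univ.filter fun s : Equiv.Perm (Fin n) => (∀ m, r (s m) = r m) ∧
        ∀ m, f (s m) = f m).card =
      (Finset.univ.filter fun s : Equiv.Perm (Fin n) => ∀ m, r (s m) = r m).card := by
  symm
  rw [Finset.card_eq_sum_card_fiberwise (f := fun s : Equiv.Perm (Fin n) => fun m => f₀ (s m))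
    (t := Finset.univ.filter fun f : Fin n → Fin N => content r f = content r f₀)]
  · refine Finset.sum_congr rfl fun f hf => ?_
    have hf' := (Finset.mem_filter.1 hf).2
    obtain ⟨t, ht⟩ := exists_equiv_of_card_fiber_eq (fun m => (r m, f m))
      (fun m => (r m, f₀ m)) (by
        rintro ⟨i, j⟩
        rw [← content_apply, ← content_apply, hf'])
    have ht1 : ∀ m, r (t m) = r m := fun m => (Prod.mk.inj (ht m)).1
    have ht2 : ∀ m, f₀ (t m) = f m := fun m => (Prod.mk.inj (ht m)).2
    symm
    refine Finset.card_equiv (Equiv.mulLeft (t : Equiv.Perm (Fin n))) fun s => ?_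
    simp only [Finset.mem_filter, Finset.mem_univ, true_and, Equiv.coe_mulLeft,
      Equiv.Perm.mul_apply, ht1, ht2, funext_iff]
  · intro s hs
    have hs' := (Finset.mem_filter.1 hs).2
    simp only [Finset.coe_filter, Finset.mem_univ, true_and, Set.mem_ofPred_eq]
    funext i
    ext j
    rw [content_apply, content_apply]
    refine Finset.card_equiv s fun m => ?_
    simp [hs']

theorem prod_X_eq_prod_content (r : Fin n → ι) (f : Fin n → Fin N) :
    ∏ m, (X (f m) : MvPolynomial (Fin N) k) = ∏ i, ∏ j, X j ^ content r f i j := by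
  rw [← Fintype.prod_prod_type' (fun i j => (X j : MvPolynomial (Fin N) k) ^ content r f i j),
    ← Finset.prod_fiberwise_of_maps_to (g := fun m => (r m, f m)) (t := Finset.univ) (by simp)]
  refine Finset.prod_congr rfl fun p _ => ?_
  rw [content_apply, ← Finset.prod_const]
  refine Finset.prod_congr rfl fun m hm => ?_
  rw [← (Prod.mk.inj (Finset.mem_filter.1 hm).2).2]

theorem content_mem (r : Fin n → ι) (f : Fin n → Fin N) :
    content r f ∈ Fintype.piFinset fun i =>
      Finset.univ.finsuppAntidiag (Finset.univ.filter fun m => r m = i).card := by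
  rw [Fintype.mem_piFinset]
  intro i
  rw [Finset.mem_finsuppAntidiag]
  refine ⟨?_, Finset.subset_univ _⟩
  rw [Finset.card_eq_sum_card_fiberwise (f := f) (t := Finset.univ) (by simp)]
  refine Finset.sum_congr rfl fun j _ => ?_
  rw [content_apply]
  congr 1
  ext m
  simp [Prod.ext_iff]

theorem exists_content_eq (r : Fin n → ι) {B : ι → Fin N →₀ ℕ}
    (hB : B ∈ Fintype.piFinset fun i =>
      Finset.univ.finsuppAntidiag (Finset.univ.filter fun m => r m = i).card) :
    ∃ f : Fin n → Fin N, content r f = B := by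
  have hcard : ∀ (i : ι) (j : Fin N), (Finset.univ.filter
      fun t : (Σ i : ι, Σ j : Fin N, Fin (B i j)) => (t.1, t.2.1) = (i, j)).card = B i j := by
    intro i j
    rw [← Fintype.card_fin (B i j), ← Finset.card_univ]
    symm
    refine Finset.card_bij (fun x _ => ⟨i, j, x⟩) (by simp) (by simp) ?_
    rintro ⟨i', j', x⟩ h
    obtain ⟨rfl, rfl⟩ := Prod.mk.inj (Finset.mem_filter.1 h).2
    exact ⟨x, Finset.mem_univ _, rfl⟩
  obtain ⟨e, he⟩ := exists_equiv_of_card_fiber_eq r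
    (fun t : (Σ i : ι, Σ j : Fin N, Fin (B i j)) => t.1) (by
      intro i
      have h1 := (Finset.mem_finsuppAntidiag.1 (Fintype.mem_piFinset.1 hB i)).1
      rw [← h1, Finset.card_eq_sum_card_fiberwise (f := fun t => t.2.1) (t := Finset.univ)
        (by simp)]
      refine Finset.sum_congr rfl fun j _ => ?_
      rw [← hcard]
      congr 1
      ext t
      simp [Prod.ext_iff])
  refine ⟨fun a => (e a).2.1, ?_⟩
  funext i
  ext j
  rw [content_apply, ← hcard i j]
  refine Finset.card_equiv e fun m => ?_
  simp [he]

/-- Averaging over the permutations that preserve a labelling `r` gives the product of the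
complete symmetric polynomials of the block sizes: by `sum_card_stabilizer` each array of contents
is counted once. -/
theorem sum_permPoly_eq (r : Fin n → ι) :
    ∑ s : Equiv.Perm (Fin n) with ∀ m, r (s m) = r m, permPoly k N s =
      ((Finset.univ.filter fun s : Equiv.Perm (Fin n) => ∀ m, r (s m) = r m).card : k) •
        ∏ i, completeSymm k N (Finset.univ.filter fun m => r m = i).card := by
  simp only [completeSymm]
  rw [Finset.prod_univ_sum, Finset.smul_sum]
  simp only [permPoly]
  have h1 : ∑ s : Equiv.Perm (Fin n) with ∀ m, r (s m) = r m,
      ∑ f : Fin n → Fin N with ∀ m, f (s m) = f m, ∏ m, (X (f m) : MvPolynomial (Fin N) k) =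
      ∑ f : Fin n → Fin N, ((Finset.univ.filter fun s : Equiv.Perm (Fin n) =>
        (∀ m, r (s m) = r m) ∧ ∀ m, f (s m) = f m).card : k) •
          ∏ m, (X (f m) : MvPolynomial (Fin N) k) := by
    rw [Finset.sum_comm' (t' := Finset.univ) (s' := fun f => Finset.univ.filter
      fun s : Equiv.Perm (Fin n) => (∀ m, r (s m) = r m) ∧ ∀ m, f (s m) = f m) (by simp)]
    refine Finset.sum_congr rfl fun f _ => ?_
    rw [Finset.sum_const, Nat.cast_smul_eq_nsmul]
  rw [h1, ← Finset.sum_fiberwise_of_maps_to (g := content r) fun f _ => content_mem r f]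
  refine Finset.sum_congr rfl fun B hB => ?_
  obtain ⟨f₀, rfl⟩ := exists_content_eq r hB
  rw [← sum_card_stabilizer r f₀, Nat.cast_sum, Finset.sum_smul]
  refine Finset.sum_congr rfl fun f hf => ?_
  rw [prod_X_eq_prod_content r f, (Finset.mem_filter.1 hf).2]

end Content

end WordCharacter

/-! ### The Frobenius character formula -/

section Frobenius

open MvPolynomial

variable {n N : ℕ} {k : Type*} [Field k]

theorem mem_rowSubgroup_iff {l : n.Partition} {g : Equiv.Perm (Fin n)} :
    g ∈ rowSubgroup l ↔ ∀ m, rowOf l (g m) = rowOf l m := Iff.rfl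

/-- The coefficient of a word `f` in an element of the group algebra applied to `f`. -/
def wordCoeff (k : Type*) [Field k] (f : Fin n → Fin N) :
    MonoidAlgebra k (Equiv.Perm (Fin n)) →ₗ[k] k :=
  (Finsupp.linearCombination k fun s => if ∀ m, f (s m) = f m then (1 : k) else 0).comp
    (MonoidAlgebra.coeffLinearEquiv k).toLinearMap

theorem wordCoeff_single (f : Fin n → Fin N) (s : Equiv.Perm (Fin n)) (r : k) :
    wordCoeff k f (MonoidAlgebra.single s r) = r • if ∀ m, f (s m) = f m then (1 : k) else 0 :=
  Finsupp.linearCombination_single k r s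

theorem wordChar_eq_sum (y : MonoidAlgebra k (Equiv.Perm (Fin n))) :
    wordChar k n N y = ∑ f : Fin n → Fin N, wordCoeff k f y • ∏ m, X (f m) := by
  have h : wordChar k n N = ∑ f : Fin n → Fin N,
      (wordCoeff k f).smulRight (∏ m, (X (f m) : MvPolynomial (Fin N) k)) := by
    refine linearMap_ext_single fun g => ?_
    rw [wordChar_single, one_smul, permPoly, Finset.sum_filter, LinearMap.sum_apply]
    refine Finset.sum_congr rfl fun f _ => ?_
    rw [LinearMap.smulRight_apply, wordCoeff_single, one_smul]
    split_ifs <;> simp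
  rw [h, LinearMap.sum_apply]
  rfl

theorem prod_X_word (f : Fin n → Fin N) :
    ∏ m, (X (f m) : MvPolynomial (Fin N) k) =
      monomial (Finsupp.equivFunOnFinite.symm
        fun j => (Finset.univ.filter fun m => f m = j).card) 1 := by
  rw [← prod_X_pow_eq_monomial, ← Finset.prod_fiberwise_of_maps_to (g := f) (t := Finset.univ)
    (by simp)]
  refine Finset.prod_congr rfl fun j _ => ?_
  rw [← Finset.prod_const]
  exact Finset.prod_congr rfl fun m hm => by rw [(Finset.mem_filter.1 hm).2]

theorem coeff_wordChar (y : MonoidAlgebra k (Equiv.Perm (Fin n))) (d : Fin N → ℕ) :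
    coeff (Finsupp.equivFunOnFinite.symm d) (wordChar k n N y) =
      ∑ f : Fin n → Fin N with (fun j => (Finset.univ.filter fun m => f m = j).card) = d,
        wordCoeff k f y := by
  rw [wordChar_eq_sum, coeff_sum, Finset.sum_filter]
  refine Finset.sum_congr rfl fun f _ => ?_
  rw [coeff_smul, prod_X_word, coeff_monomial]
  simp only [EmbeddingLike.apply_eq_iff_eq]
  split_ifs <;> simp

theorem partialSum_content (f : Fin n → Fin N) (s : ℕ) :
    partialSum (fun j => (Finset.univ.filter fun m => f m = j).card) s =
      (Finset.univ.filter fun m => (f m : ℕ) < s).card := by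
  rw [partialSum, Finset.card_eq_sum_card_fiberwise (f := f)
    (t := Finset.univ.filter fun j : Fin N => (j : ℕ) < s) (fun m hm => by simpa using hm)]
  refine Finset.sum_congr rfl fun j hj => ?_
  congr 1
  ext m
  simp only [Finset.mem_filter, Finset.mem_univ, true_and]
  exact ⟨fun h => ⟨h ▸ (Finset.mem_filter.1 hj).2, h⟩, fun h => h.2⟩

theorem partialSum_part {l : n.Partition} (hl : numParts l ≤ N) (s : ℕ) :
    partialSum (fun j : Fin N => part l j) s = ∑ i ∈ Finset.range s, part l i := by
  have h : ∀ i, numParts l ≤ i → part l i = 0 := fun i hi => by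
    by_contra h
    exact absurd ((part_pos_iff l i).1 (Nat.pos_of_ne_zero h)) hi.not_gt
  rw [partialSum, Finset.sum_filter,
    Fin.sum_univ_eq_sum_range (fun i => if i < s then part l i else 0) N, ← Finset.sum_filter]
  refine Finset.sum_subset (fun i hi => ?_) fun i hi hi' => h i (hl.trans ?_)
  · simp only [Finset.mem_filter, Finset.mem_range] at hi ⊢
    exact hi.2
  · simp only [Finset.mem_filter, Finset.mem_range] at hi hi'
    omega

theorem strictAnti_staircase : StrictAnti (staircase N) := by
  intro i j hij
  have h : (i : ℕ) < j := hij
  have := j.2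
  simp only [staircase]
  omega

theorem strictAnti_part_add_staircase (l : n.Partition) :
    StrictAnti fun j : Fin N => part l j + staircase N j := by
  intro i j hij
  have h1 := antitone_part l (show (i : ℕ) ≤ j from hij.le)
  have h2 : (i : ℕ) < j := hij
  simp only [staircase]
  have := j.2
  omega

theorem map_alternant (a : ℕ → ℕ) :
    MvPolynomial.map (Int.castRingHom k) (alternant N a) =
      expAlternant k fun j => a j + staircase N j := by
  rw [alternant, expAlternant, RingHom.map_det]
  congr 1
  ext1 i j
  simp [staircase]

variable [CharZero k]

/-- If two places of one column carry the same letter, their transposition fixes the word, while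
`b_λ` changes sign under it. -/
theorem wordCoeff_mul_colProjector_eq_zero (l : n.Partition) {f : Fin n → Fin N} {m m' : Fin n}
    (hc : colOf l m = colOf l m') (hf : f m = f m') (hne : m ≠ m')
    (x : MonoidAlgebra k (Equiv.Perm (Fin n))) : wordCoeff k f (x * colProjector k l) = 0 := by
  have hswap : ∀ {α : Type} (h : Fin n → α), h m = h m' →
      ∀ a, h (Equiv.swap m m' a) = h a := fun h hh a => by
    rw [Equiv.swap_apply_def]
    split_ifs with h1 h2
    · rw [h1, hh]
    · rw [h2, hh]
    · rfl
  have hQ : Equiv.swap m m' ∈ colSubgroup l := hswap (colOf l) hc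
  have key : ∀ y : MonoidAlgebra k (Equiv.Perm (Fin n)),
      wordCoeff k f (y * MonoidAlgebra.single (Equiv.swap m m') 1) = wordCoeff k f y := by
    intro y
    have : (wordCoeff k f).comp (LinearMap.mulRight k (MonoidAlgebra.single (Equiv.swap m m') 1)) =
        wordCoeff k f := by
      refine linearMap_ext_single fun g => ?_
      rw [LinearMap.comp_apply, LinearMap.mulRight_apply, single_mul_single_one,
        wordCoeff_single, wordCoeff_single]
      congr 2
      rw [eq_iff_iff, ← (Equiv.swap m m').forall_congr_right]
      simp only [Equiv.Perm.mul_apply, Equiv.swap_apply_self, hswap f hf]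
    exact LinearMap.congr_fun this y
  have h := key (x * colProjector k l)
  rw [mul_assoc, colProjector_mul_single l hQ, signChar_swap k hne] at h
  refine eq_zero_of_eq_neg_self k ?_
  rw [neg_one_smul, mul_neg, map_neg] at h
  exact h.symm

/-- All monomials of `wordChar c_λ` are dominated by `λ`. -/
theorem partialSum_le_of_coeff_wordChar_ne_zero {l : n.Partition} {d : Fin N → ℕ}
    (h : coeff (Finsupp.equivFunOnFinite.symm d) (wordChar k n N (youngSymmetrizer k l)) ≠ 0)
    (s : ℕ) : partialSum d s ≤ ∑ i ∈ Finset.range s, part l i := by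
  rw [coeff_wordChar] at h
  obtain ⟨f, hf, hne⟩ := Finset.exists_ne_zero_of_sum_ne_zero h
  rw [← (Finset.mem_filter.1 hf).2, partialSum_content]
  refine card_lt_le_sum_part l (f := fun m => (f m : ℕ)) (fun m m' hc hm => ?_) s
  by_contra hmm
  exact hne (wordCoeff_mul_colProjector_eq_zero l hc (Fin.val_injective hm) hmm _)

theorem wordChar_rowProjector (l : n.Partition) {p : ℕ} (hp : numParts l ≤ p) :
    wordChar k n N (rowProjector k l) = ∏ t ∈ Finset.range p, completeSymm k N (part l t) := by
  classical
  let r : Fin n → Fin p := fun m => ⟨rowOf l m, (rowOf_lt l m).trans_le hp⟩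
  have hr : ∀ s : Equiv.Perm (Fin n), s ∈ rowSubgroup l ↔ ∀ m, r (s m) = r m := fun s =>
    forall_congr' fun m => by simp [r]
  have hfilter : (Finset.univ.filter fun s => s ∈ rowSubgroup l) =
      Finset.univ.filter fun s : Equiv.Perm (Fin n) => ∀ m, r (s m) = r m := by
    ext s
    simp [hr]
  have hcard : Nat.card (rowSubgroup l) =
      (Finset.univ.filter fun s : Equiv.Perm (Fin n) => ∀ m, r (s m) = r m).card := by
    rw [← hfilter, Nat.card_eq_fintype_card, Fintype.card_subtype]
  rw [rowProjector, map_smul, map_sum]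
  simp only [wordChar_single, one_smul]
  rw [hfilter, sum_permPoly_eq, smul_smul, ← hcard, inv_mul_cancel₀, one_smul,
    ← Fin.prod_univ_eq_prod_range]
  · refine Finset.prod_congr rfl fun i _ => ?_
    congr 1
    rw [← card_rowOf_eq l]
    congr 1
    ext m
    simp [r, Fin.ext_iff]
  · exact Nat.cast_ne_zero.2 Nat.card_pos.ne'

theorem wordChar_rowProjector_mul_mem (l : n.Partition) :
    wordChar k n N (rowProjector k l) * expAlternant k (staircase N) ∈
      Submodule.span k (expAlternant k '' {e : Fin N → ℕ | ∀ s,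
        (∑ t ∈ Finset.range s, part l t) + partialSum (staircase N) s ≤ partialSum e s}) := by
  rw [wordChar_rowProjector l (Nat.le_add_right _ N)]
  refine Submodule.span_mono (Set.image_mono ?_)
    (prod_completeSymm_mul_expAlternant_mem (R := k) (N := N) (part l) (numParts l + N))
  rintro e ⟨-, he⟩ s
  rcases le_total s (numParts l + N) with hs | hs
  · exact he s hs
  · have h1 : ∀ e : Fin N → ℕ, partialSum e s = partialSum e (numParts l + N) := fun e => by
      unfold partialSum
      congr 1
      ext j
      simp only [Finset.mem_filter, Finset.mem_univ, true_and]
      omega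
    have h2 : ∑ t ∈ Finset.range s, part l t = ∑ t ∈ Finset.range (numParts l + N), part l t := by
      refine (Finset.sum_subset (Finset.range_mono hs) fun t _ ht => ?_).symm
      by_contra h
      have := (part_pos_iff l t).1 (Nat.pos_of_ne_zero h)
      rw [Finset.mem_range] at ht
      omega
    rw [h1, h1, h2]
    exact he _ le_rfl

/-- Triangularity of the trace functions in the dominance order, solved for the Young
symmetrizers: each `wordChar c_λ * D_0` only involves alternants that dominate `λ + ρ`. -/
theorem wordChar_youngSymmetrizer_mul_mem (l : n.Partition) :
    wordChar k n N (youngSymmetrizer k l) * expAlternant k (staircase N) ∈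
      Submodule.span k (expAlternant k '' {e : Fin N → ℕ | ∀ s,
        (∑ t ∈ Finset.range s, part l t) + partialSum (staircase N) s ≤ partialSum e s}) := by
  let lt : n.Partition → n.Partition → Prop := fun a b => a ≠ b ∧ DominatedBy (part b) (part a)
  have : IsTrans _ lt := ⟨fun a b c hab hbc => ⟨fun h => by
    subst h
    exact hab.1 (part_injective (hbc.2.antisymm hab.2)), hbc.2.trans hab.2⟩⟩
  have : Std.Irrefl lt := ⟨fun a h => h.1 rfl⟩
  have wf : WellFounded lt := Finite.wellFounded_of_trans_of_irrefl lt
  induction l using wf.induction with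
  | _ l ih =>
    have h := traceFunction_eq_sum (wordChar_mul_comm (k := k) (n := n) (N := N))
      (rowProjector k l)
    rw [← Finset.add_sum_erase _ _ (Finset.mem_univ l), smulTrace_specht_rowProjector_self,
      one_mul] at h
    have h' : wordChar k n N (youngSymmetrizer k l) = youngScalar k l •
        (wordChar k n N (rowProjector k l) - ∑ l' ∈ Finset.univ.erase l,
          (smulTrace k (Specht k l') (rowProjector k l) * (youngScalar k l')⁻¹) •
            wordChar k n N (youngSymmetrizer k l')) := by
      rw [h, add_sub_cancel_right, smul_smul, mul_inv_cancel₀ (youngScalar_ne_zero l), one_smul]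
    rw [h', smul_mul_assoc, sub_mul, Finset.sum_mul]
    refine Submodule.smul_mem _ _ (Submodule.sub_mem _ (wordChar_rowProjector_mul_mem l)
      (Submodule.sum_mem _ fun l' hl' => ?_))
    rw [smul_mul_assoc]
    by_cases h0 : smulTrace k (Specht k l') (rowProjector k l) = 0
    · rw [h0, zero_mul, zero_smul]
      exact Submodule.zero_mem _
    · have hd := dominatedBy_of_smulTrace_ne_zero h0
      refine Submodule.smul_mem _ _ (Submodule.span_mono (Set.image_mono ?_)
        (ih l' ⟨Finset.ne_of_mem_erase hl', hd⟩))
      exact fun e he s => (Nat.add_le_add_right (hd s) _).trans (he s)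

/-- The words of content `l` form a transitive permutation representation with stabilizer
`P_l`, so their character is the trace of `x ↦ a_l x y` on the group algebra. -/
theorem coeff_part_wordChar {l : n.Partition} (hl : numParts l ≤ N)
    (y : MonoidAlgebra k (Equiv.Perm (Fin n))) :
    coeff (Finsupp.equivFunOnFinite.symm fun j : Fin N => part l j) (wordChar k n N y) =
      LinearMap.trace k (MonoidAlgebra k (Equiv.Perm (Fin n)))
        (LinearMap.mulLeft k (rowProjector k l) ∘ₗ LinearMap.mulRight k y) := by
  classical
  induction y using MonoidAlgebra.induction_on with
  | add x y hx hy =>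
    have : LinearMap.mulRight k (x + y) = LinearMap.mulRight k x + LinearMap.mulRight k y := by
      ext
      simp [mul_add]
    rw [map_add, coeff_add, hx, hy, this, LinearMap.comp_add, map_add]
  | smul r x hx =>
    have : LinearMap.mulRight k (r • x) = r • LinearMap.mulRight k x := by
      ext
      simp
    rw [map_smul, coeff_smul, hx, this, LinearMap.comp_smul, map_smul]
  | of t =>
    have hP : (Nat.card (rowSubgroup l) : k) ≠ 0 := Nat.cast_ne_zero.2 Nat.card_pos.ne'
    change coeff _ (wordChar k n N (MonoidAlgebra.single t 1)) = LinearMap.trace k _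
      (LinearMap.mulLeft k (rowProjector k l) ∘ₗ LinearMap.mulRight k (MonoidAlgebra.single t 1))
    have htrace : LinearMap.trace k _ (LinearMap.mulLeft k (rowProjector k l) ∘ₗ
        LinearMap.mulRight k (MonoidAlgebra.single t 1)) = ∑ g : Equiv.Perm (Fin n),
          (Nat.card (rowSubgroup l) : k)⁻¹ *
            if ∀ m, rowOf l (g (t m)) = rowOf l (g m) then 1 else 0 := by
      rw [LinearMap.trace_eq_matrix_trace k (MonoidAlgebra.basis (Equiv.Perm (Fin n)) k)]
      refine Finset.sum_congr rfl fun g _ => ?_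
      rw [Matrix.diag_apply, LinearMap.toMatrix_apply, MonoidAlgebra.basis_apply,
        LinearMap.comp_apply, LinearMap.mulRight_apply, LinearMap.mulLeft_apply,
        single_mul_single_one, rowProjector, smul_mul_assoc, Finset.sum_mul]
      simp only [single_mul_single_one]
      change ((Nat.card (rowSubgroup l) : k)⁻¹ • ∑ i : Equiv.Perm (Fin n) with i ∈ rowSubgroup l,
        MonoidAlgebra.single (i * (g * t)) (1 : k)).coeff g = _
      rw [MonoidAlgebra.coeff_smul_apply, MonoidAlgebra.coeff_sum, Finset.sum_apply', smul_eq_mul,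
        Finset.sum_filter]
      congr 1
      rw [Finset.sum_eq_single (g * t⁻¹ * g⁻¹)]
      · rw [MonoidAlgebra.coeff_single, Finsupp.single_apply,
          if_pos (show g * t⁻¹ * g⁻¹ * (g * t) = g by group)]
        have hiff : g * t⁻¹ * g⁻¹ ∈ rowSubgroup l ↔ ∀ m, rowOf l (g (t m)) = rowOf l (g m) := by
          rw [← inv_mem_iff, mem_rowSubgroup_iff, ← g.forall_congr_right]
          simp
        split_ifs <;> tauto
      · intro s _ hs
        rw [MonoidAlgebra.coeff_single, Finsupp.single_apply]
        refine (congrArg (ite _ · 0) (if_neg fun h => ?_)).trans (ite_self _)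
        apply hs
        rw [← eq_mul_inv_iff_mul_eq] at h
        rw [h]
        group
      · simp
    have hword : coeff (Finsupp.equivFunOnFinite.symm fun j : Fin N => part l j)
        (wordChar k n N (MonoidAlgebra.single t 1)) = ((Finset.univ.filter fun f : Fin n → Fin N =>
          ((fun j => (Finset.univ.filter fun m => f m = j).card) = fun j : Fin N => part l j) ∧
            ∀ m, f (t m) = f m).card : k) := by
      rw [coeff_wordChar]
      simp only [wordCoeff_single, one_smul]
      rw [Finset.sum_boole, Finset.filter_filter]
    let r : Fin n → Fin N := fun m => ⟨rowOf l m, (rowOf_lt l m).trans_le hl⟩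
    have hr : ∀ m m', r m = r m' ↔ rowOf l m = rowOf l m' := fun m m' => by simp [r, Fin.ext_iff]
    have hr' : ∀ j : Fin N, (Finset.univ.filter fun m => r m = j).card = part l j := fun j => by
      rw [← card_rowOf_eq l]
      simp [r, Fin.ext_iff]
    have hcard : (Finset.univ.filter fun g : Equiv.Perm (Fin n) =>
        ∀ m, rowOf l (g (t m)) = rowOf l (g m)).card =
        (Finset.univ.filter fun f : Fin n → Fin N =>
          ((fun j => (Finset.univ.filter fun m => f m = j).card) = fun j : Fin N => part l j) ∧
            ∀ m, f (t m) = f m).card * Nat.card (rowSubgroup l) := by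
      rw [Finset.card_eq_sum_card_fiberwise (f := fun g : Equiv.Perm (Fin n) => fun m => r (g m))
        (t := Finset.univ.filter fun f : Fin n → Fin N =>
          ((fun j => (Finset.univ.filter fun m => f m = j).card) = fun j : Fin N => part l j) ∧
            ∀ m, f (t m) = f m), Finset.sum_const_nat]
      · intro f hf
        obtain ⟨hf1, hf2⟩ := (Finset.mem_filter.1 hf).2
        obtain ⟨g₀, hg₀⟩ := exists_equiv_of_card_fiber_eq f r (fun j => by
          rw [hr']
          exact congrFun hf1 j)
        rw [Nat.card_eq_fintype_card, Fintype.card_subtype]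
        symm
        refine Finset.card_equiv (Equiv.mulRight (g₀ : Equiv.Perm (Fin n))) fun s => ?_
        rw [Finset.mem_filter_univ, Finset.mem_filter, Finset.mem_filter_univ,
          mem_rowSubgroup_iff]
        have h1 : (∀ m, rowOf l (s m) = rowOf l m) ↔ ∀ m, r (s (g₀ m)) = r (g₀ m) := by
          rw [← (show Equiv.Perm (Fin n) from g₀).forall_congr_right]
          simp only [hr]
        simp only [hg₀] at h1
        rw [h1, Equiv.coe_mulRight]
        simp only [Equiv.Perm.mul_apply, _root_.funext_iff]
        refine ⟨fun h => ⟨fun m => ?_, h⟩, fun h => h.2⟩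
        rw [← hr]
        exact (h (t m)).trans ((hf2 m).trans (h m).symm)
      · intro g hg
        have hg' := (Finset.mem_filter.1 hg).2
        refine Finset.mem_coe.2 (Finset.mem_filter.2 ⟨Finset.mem_univ _, ?_, fun m => ?_⟩)
        · funext j
          rw [← hr' j]
          exact Finset.card_equiv g fun m => by simp
        · exact (hr _ _).2 (hg' m)
    rw [hword, htrace, ← Finset.mul_sum, Finset.sum_boole, hcard, Nat.cast_mul, mul_comm,
      mul_assoc, mul_inv_cancel₀ hP, mul_one]

/-- The map `x ↦ a_λ x c_λ` has rank one and acts on `c_λ` as the scalar `κ`. -/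
theorem coeff_part_wordChar_youngSymmetrizer {l : n.Partition} (hl : numParts l ≤ N) :
    coeff (Finsupp.equivFunOnFinite.symm fun j : Fin N => part l j)
      (wordChar k n N (youngSymmetrizer k l)) = youngScalar k l := by
  rw [coeff_part_wordChar hl]
  refine trace_eq_of_forall_exists_smul _ (youngSymmetrizer_ne_zero l) (fun x => ?_) ?_
  · obtain ⟨r, hr⟩ := exists_rowProjector_mul_mul_colProjector (k := k) l (x * rowProjector k l)
    refine ⟨r, ?_⟩
    rw [← hr]
    simp [youngSymmetrizer, mul_assoc]
  · rw [← youngSymmetrizer_mul_self]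
    simp [youngSymmetrizer, ← mul_assoc, rowProjector_mul_self]

/-- The Frobenius character formula.  The left side is a combination of alternants `D(e)` with
`e ⊵ λ + ρ`, but all its monomials are `⊴ λ + ρ`, so only `D(λ + ρ)` remains; its coefficient is
that of `x^λ` in `wordChar c_λ`. -/
theorem wordChar_youngSymmetrizer_mul {l : n.Partition} (hl : numParts l ≤ N) :
    wordChar k n N (youngSymmetrizer k l) * expAlternant k (staircase N) =
      youngScalar k l • expAlternant k fun j : Fin N => part l j + staircase N j := by
  set d : Fin N → ℕ := fun j => part l j + staircase N j with hd
  have hds : ∀ s, partialSum d s =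
      (∑ t ∈ Finset.range s, part l t) + partialSum (staircase N) s := fun s => by
    rw [← partialSum_part hl, ← partialSum_add]
  -- a monomial of the product is a product of dominated monomials
  have hle : ∀ e : (Fin N →₀ ℕ) × (Fin N →₀ ℕ),
      coeff (Finsupp.equivFunOnFinite.symm e.1) (wordChar k n N (youngSymmetrizer k l)) *
        coeff (Finsupp.equivFunOnFinite.symm e.2) (expAlternant k (staircase N)) ≠ 0 →
      (∀ s, partialSum e.1 s ≤ ∑ t ∈ Finset.range s, part l t) ∧
      ∀ s, partialSum e.2 s ≤ partialSum (staircase N) s := by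
    intro e he
    refine ⟨fun s => partialSum_le_of_coeff_wordChar_ne_zero (k := k) (d := e.1)
      (left_ne_zero_of_mul he) s, ?_⟩
    · obtain ⟨t, ht⟩ := exists_perm_of_coeff_expAlternant_ne_zero (R := k) (e := staircase N)
        (d := e.2) (right_ne_zero_of_mul he)
      intro s
      have : (e.2 : Fin N → ℕ) = fun i => staircase N (t i) := funext ht
      rw [this]
      exact partialSum_comp_perm_le strictAnti_staircase.antitone t s
  rw [eq_coeff_smul_expAlternant (d := d) (strictAnti_part_add_staircase l)
    (f := wordChar k n N (youngSymmetrizer k l) * expAlternant k (staircase N))]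
  · congr 1
    rw [coeff_mul, Finset.sum_eq_single
      ((Finsupp.equivFunOnFinite.symm fun j : Fin N => part l j),
        (Finsupp.equivFunOnFinite.symm (staircase N)))]
    · rw [coeff_part_wordChar_youngSymmetrizer hl, coeff_expAlternant_self, mul_one]
      exact strictAnti_staircase
    · intro e he hne
      by_contra h0
      obtain ⟨h1, h2⟩ := hle e (by simpa using h0)
      have hsum : ∀ s, partialSum e.1 s + partialSum e.2 s = partialSum d s := fun s => by
        rw [← partialSum_add]
        have := Finset.HasAntidiagonal.mem_antidiagonal.1 he
        congr 1
        funext i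
        exact DFunLike.congr_fun this i
      apply hne
      refine Prod.ext ?_ ?_
      · apply DFunLike.coe_injective
        refine eq_of_partialSum_eq fun s => ?_
        have := hsum s
        have := h1 s
        have := h2 s
        have := hds s
        rw [Finsupp.coe_equivFunOnFinite_symm, partialSum_part hl]
        omega
      · apply DFunLike.coe_injective
        refine eq_of_partialSum_eq fun s => ?_
        have := hsum s
        have := h1 s
        have := h2 s
        have := hds s
        rw [Finsupp.coe_equivFunOnFinite_symm]
        omega
    · intro h
      refine absurd (Finset.HasAntidiagonal.mem_antidiagonal.2 ?_) h
      ext i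
      rfl
  · refine Submodule.span_mono (Set.image_mono ?_) (wordChar_youngSymmetrizer_mul_mem l)
    exact fun e he s => (hds s).trans_le (he s)
  · intro e he s
    rw [coeff_mul] at he
    obtain ⟨p, hp, hne⟩ := Finset.exists_ne_zero_of_sum_ne_zero he
    obtain ⟨h1, h2⟩ := hle p (by simpa using hne)
    have : e = fun i => p.1 i + p.2 i := by
      funext i
      exact (DFunLike.congr_fun (Finset.HasAntidiagonal.mem_antidiagonal.1 hp) i).symm
    rw [this, partialSum_add, hds]
    exact Nat.add_le_add (h1 s) (h2 s)

theorem wordChar_youngSymmetrizer {l : n.Partition} (hl : numParts l ≤ N) :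
    wordChar k n N (youngSymmetrizer k l) =
      youngScalar k l • MvPolynomial.map (Int.castRingHom k) (schurPoly N l) := by
  have h0 : expAlternant k (staircase N) ≠ 0 := by
    intro h
    have := coeff_expAlternant_self (R := k) (e := staircase N) strictAnti_staircase
    rw [h, coeff_zero] at this
    exact zero_ne_one this
  have h1 := congrArg (MvPolynomial.map (Int.castRingHom k)) (alternant_eq_mul_schurPoly N l)
  rw [map_mul, map_alternant, map_alternant] at h1
  simp only [zero_add] at h1
  apply mul_right_cancel₀ h0
  rw [wordChar_youngSymmetrizer_mul hl, h1, smul_mul_assoc, mul_comm]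

end Frobenius

/-! ### Traces of permutations composed with tensor powers of endomorphisms -/

section Triangular

theorem coe_aeval_restrict {K W : Type*} [Field K] [AddCommGroup W] [Module K W]
    {g : W →ₗ[K] W} {H : Submodule K W} (hg : ∀ x ∈ H, g x ∈ H) (p : Polynomial K) (x : H) :
    ((Polynomial.aeval (g.restrict hg) p x : H) : W) = Polynomial.aeval g p x := by
  induction p using Polynomial.induction_on' with
  | add p q hp hq => simp [hp, hq]
  | monomial m r =>
    have h : ∀ m, (((g.restrict hg ^ m) x : H) : W) = (g ^ m) (x : W) := fun m => by
      induction m with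
      | zero => rfl
      | succ m ih => rw [pow_succ', pow_succ', Module.End.mul_apply, Module.End.mul_apply,
          LinearMap.coe_restrict_apply, ih]
    simp [Polynomial.aeval_monomial, h]

/-- Triangularization of an endomorphism whose minimal polynomial splits. -/
theorem exists_basis_mem_span_Ici {K : Type*} [Field K] (N : ℕ) :
    ∀ {W : Type w} [AddCommGroup W] [Module K W] [FiniteDimensional K W] (g : W →ₗ[K] W),
      Module.finrank K W = N → (minpoly K g).Splits →
      ∃ b : Module.Basis (Fin N) K W, ∀ j, g (b j) ∈ Submodule.span K (b '' Set.Ici j) := by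
  induction N with
  | zero => exact fun g hN _ => ⟨Module.finBasisOfFinrankEq K _ hN, fun j => j.elim0⟩
  | succ N ih =>
    intro W _ _ _ g hN hg
    have : Nontrivial W := Module.nontrivial_of_finrank_eq_succ hN
    obtain ⟨x, hx⟩ :=
      hg.exists_eval_eq_zero (minpoly.degree_pos (Algebra.IsIntegral.isIntegral g)).ne'
    have hev : Module.End.HasEigenvalue g x := Module.End.hasEigenvalue_of_isRoot hx
    -- a hyperplane that contains the image of `g - x` is invariant under `g`
    have hlt : LinearMap.range (g - algebraMap K (Module.End K W) x) < ⊤ := by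
      rw [lt_top_iff_ne_top, Ne, LinearMap.range_eq_top, ← LinearMap.injective_iff_surjective]
      intro hinj
      obtain ⟨v, hv⟩ := hev.exists_hasEigenvector
      refine hv.2 (hinj ?_)
      rw [map_zero, LinearMap.sub_apply, hv.apply_eq_smul, Module.algebraMap_end_apply, sub_self]
    obtain ⟨f, hf0, hf⟩ := Submodule.exists_le_ker_of_lt_top _ hlt
    have hfg : ∀ z, f (g z) = x * f z := fun z => by
      have := hf (LinearMap.mem_range_self _ z)
      rw [LinearMap.mem_ker, LinearMap.sub_apply, map_sub, Module.algebraMap_end_apply, map_smul,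
        sub_eq_zero] at this
      exact this
    have hinv : ∀ z ∈ LinearMap.ker f, g z ∈ LinearMap.ker f := fun z hz => by
      rw [LinearMap.mem_ker, hfg, LinearMap.mem_ker.1 hz, mul_zero]
    have hdvd : minpoly K (g.restrict hinv) ∣ minpoly K g := by
      refine minpoly.dvd K _ (LinearMap.ext fun z => Subtype.ext ?_)
      rw [coe_aeval_restrict, minpoly.aeval]
      rfl
    have hdim : Module.finrank K (LinearMap.ker f) = N := by
      have := Module.Dual.finrank_ker_add_one_of_ne_zero hf0
      omega
    obtain ⟨b', hb'⟩ := ih (g.restrict hinv) hdim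
      (hg.of_dvd (minpoly.ne_zero (Algebra.IsIntegral.isIntegral g)) hdvd)
    obtain ⟨z, hz⟩ : ∃ z, f z ≠ 0 := by
      by_contra! h
      exact hf0 (LinearMap.ext h)
    let b : Module.Basis (Fin (N + 1)) K W := Module.Basis.mkFinCons z b'
      (fun c y hy h => by
        have := congrArg f h
        rw [map_add, map_smul, LinearMap.mem_ker.1 hy, add_zero, map_zero, smul_eq_mul] at this
        exact (mul_eq_zero.1 this).resolve_right hz)
      (fun y => ⟨-(f y / f z), by simp [hz]⟩)
    have hb : (b : Fin (N + 1) → W) = Fin.cons z ((↑) ∘ b') := Module.Basis.coe_mkFinCons ..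
    refine ⟨b, fun j => ?_⟩
    refine Fin.cases ?_ (fun j => ?_) j
    · have : (Set.Ici (0 : Fin (N + 1))) = Set.univ := Set.eq_univ_of_forall fun i => Fin.zero_le i
      rw [this, Set.image_univ, b.span_eq]
      exact Submodule.mem_top
    · have h := Submodule.mem_map_of_mem (f := (LinearMap.ker f).subtype) (hb' j)
      rw [Submodule.map_span, ← Set.image_comp] at h
      have hbj : b j.succ = b' j := by rw [hb]; rfl
      rw [hbj]
      refine Submodule.span_mono ?_ h
      rintro _ ⟨i, hi, rfl⟩
      exact ⟨i.succ, Fin.succ_le_succ_iff.2 hi, by rw [hb]; rfl⟩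

end Triangular

section MatrixTrace

variable {n N : ℕ}

/-- The trace of `G ⊗ ⋯ ⊗ G` composed with a permutation of the tensor factors, in terms of
the matrix entries. -/
def matrixPermTrace {R : Type*} [CommRing R] (G : Matrix (Fin N) (Fin N) R)
    (s : Equiv.Perm (Fin n)) : R :=
  ∑ f : Fin n → Fin N, ∏ m, G (f m) (f (s⁻¹ m))

theorem map_matrixPermTrace {R S : Type*} [CommRing R] [CommRing S] (φ : R →+* S)
    (G : Matrix (Fin N) (Fin N) R) (s : Equiv.Perm (Fin n)) :
    φ (matrixPermTrace G s) = matrixPermTrace (G.map φ) s := by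
  simp [matrixPermTrace]

theorem trace_map_comp_permRep {K W : Type*} [Field K] [AddCommGroup W] [Module K W]
    (b : Module.Basis (Fin N) K W) (g : W →ₗ[K] W) (s : Equiv.Perm (Fin n)) :
    LinearMap.trace K _ ((PiTensorProduct.map fun _ : Fin n => g) ∘ₗ permRep K W n s) =
      matrixPermTrace (LinearMap.toMatrix b b g) s := by
  rw [LinearMap.trace_eq_matrix_trace K (Basis.piTensorProduct fun _ : Fin n => b), Matrix.trace]
  refine Finset.sum_congr rfl fun f _ => ?_
  rw [Matrix.diag_apply, LinearMap.toMatrix_apply, Basis.piTensorProduct_apply,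
    LinearMap.comp_apply]
  have : permRep K W n s (PiTensorProduct.tprod K fun i => b (f i)) =
      PiTensorProduct.tprod K fun i => b (f (s⁻¹ i)) := PiTensorProduct.reindex_tprod _ _
  rw [this, PiTensorProduct.map_tprod, Basis.piTensorProduct_repr_tprod_apply]
  simp only [LinearMap.toMatrix_apply]

open MvPolynomial in
/-- For a triangular matrix only the words fixed by the permutation contribute to the trace. -/
theorem matrixPermTrace_of_isLowerTriangular {K : Type*} [Field K] {G : Matrix (Fin N) (Fin N) K}
    (hG : ∀ i j, i < j → G i j = 0) (s : Equiv.Perm (Fin n)) :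
    matrixPermTrace G s = aeval (fun i => G i i) (permPoly K N s) := by
  rw [permPoly, map_sum, Finset.sum_filter, matrixPermTrace]
  refine Finset.sum_congr rfl fun f _ => ?_
  split_ifs with h
  · rw [map_prod]
    refine Finset.prod_congr rfl fun m _ => ?_
    have := h (s⁻¹ m)
    rw [← Equiv.Perm.mul_apply, mul_inv_cancel, Equiv.Perm.one_apply] at this
    rw [aeval_X, ← this]
  · obtain ⟨m, hm⟩ : ∃ m, f m < f (s⁻¹ m) := by
      by_contra! hle
      -- the letters have the same sum before and after the permutation
      have hsum : ∑ m, (f (s⁻¹ m) : ℕ) = ∑ m, (f m : ℕ) :=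
        Equiv.sum_comp s⁻¹ fun m => (f m : ℕ)
      have heq := (Finset.sum_eq_sum_iff_of_le fun m _ => Fin.le_def.1 (hle m)).1 hsum
      refine h fun m => ?_
      have := heq (s m) (Finset.mem_univ _)
      rw [← Equiv.Perm.mul_apply, inv_mul_cancel, Equiv.Perm.one_apply] at this
      exact (Fin.ext this).symm
    exact Finset.prod_eq_zero (Finset.mem_univ m) (hG _ _ hm)

open MvPolynomial in
theorem aeval_permPoly_comp_perm {K : Type*} [Field K] (x : Fin N → K) (t : Equiv.Perm (Fin N))
    (s : Equiv.Perm (Fin n)) :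
    aeval (fun i => x (t i)) (permPoly K N s) = aeval x (permPoly K N s) := by
  simp only [permPoly, map_sum, map_prod, aeval_X]
  refine Finset.sum_equiv (Equiv.arrowCongr (Equiv.refl _) t) (fun f => ?_) fun f _ => rfl
  rw [Finset.mem_filter_univ, Finset.mem_filter_univ]
  exact forall_congr' fun m => t.injective.eq_iff.symm

open MvPolynomial in
theorem matrixPermTrace_eq_aeval {K : Type*} [Field K] {G : Matrix (Fin N) (Fin N) K}
    {x : Fin N → K} (hx : G.charpoly = ∏ i, (Polynomial.X - Polynomial.C (x i)))
    (s : Equiv.Perm (Fin n)) : matrixPermTrace G s = aeval x (permPoly K N s) := by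
  have hsplit : (minpoly K G.toLin').Splits := by
    refine Polynomial.Splits.of_dvd (g := G.charpoly) ?_ G.charpoly_monic.ne_zero ?_
    · rw [hx]
      exact Polynomial.Splits.prod fun _ _ => Polynomial.Splits.X_sub_C _
    · rw [← Matrix.charpoly_toLin']
      exact LinearMap.minpoly_dvd_charpoly _
  obtain ⟨b, hb⟩ := exists_basis_mem_span_Ici N G.toLin' (by simp) hsplit
  set T := LinearMap.toMatrix b b G.toLin' with hT
  have hlow : ∀ i j, i < j → T i j = 0 := fun i j hij => by
    rw [hT, LinearMap.toMatrix_apply]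
    by_contra h
    exact absurd (b.mem_span_image.1 (hb j) (Finsupp.mem_support_iff.2 h)) (not_le.2 hij)
  have htrace : matrixPermTrace G s = matrixPermTrace T s := by
    rw [hT, ← trace_map_comp_permRep, trace_map_comp_permRep (Pi.basisFun K (Fin N))]
    congr 1
    exact (LinearMap.toMatrix'_toLin' G).symm
  have hchar : ∏ i, (Polynomial.X - Polynomial.C (T i i)) =
      ∏ i, (Polynomial.X - Polynomial.C (x i)) := by
    rw [← hx, ← Matrix.charpoly_toLin', ← LinearMap.charpoly_toMatrix _ b, ← hT,
      ← Matrix.charpoly_transpose, Matrix.charpoly_of_isUpperTriangular]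
    · rfl
    · intro i j hij
      exact hlow j i hij
  have hms : Finset.univ.val.map (fun i => T i i) = Finset.univ.val.map x := by
    have := congrArg Polynomial.roots hchar
    rw [Polynomial.roots_prod _ _
        (Finset.prod_ne_zero_iff.2 fun i _ => Polynomial.X_sub_C_ne_zero _),
      Polynomial.roots_prod _ _
        (Finset.prod_ne_zero_iff.2 fun i _ => Polynomial.X_sub_C_ne_zero _)] at this
    simpa only [Polynomial.roots_X_sub_C, Multiset.bind_singleton] using this
  classical
  obtain ⟨t, ht⟩ := exists_equiv_of_card_fiber_eq (fun i => T i i) x (fun y => by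
    have := congrArg (Multiset.count y) hms
    rw [Multiset.count_map, Multiset.count_map] at this
    simp only [eq_comm (a := y)] at this
    exact this)
  rw [htrace, matrixPermTrace_of_isLowerTriangular hlow, ← aeval_permPoly_comp_perm x t]
  simp only [ht]

end MatrixTrace

/-! ### The characters of the Weyl modules -/

section WeylCharacter

variable {n : ℕ} {k : Type*} [Field k] {V : Type*} [AddCommGroup V] [Module k V]

theorem weylModule_apply_smul {l : n.Partition} (f : WeylModule k V l)
    (y : MonoidAlgebra k (Equiv.Perm (Fin n))) (x : Specht k l) :
    f (y • x) = (permRep k V n).asAlgebraHom y (f x) := by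
  induction y using MonoidAlgebra.induction_on with
  | of g =>
    have : MonoidAlgebra.of k _ g • x = spechtRep k l g x := rfl
    rw [this, f.isIntertwining, Representation.asAlgebraHom_of]
  | add y z hy hz => rw [add_smul, map_add, hy, hz, map_add, LinearMap.add_apply]
  | smul r y hy => rw [smul_assoc, map_smul, hy, map_smul, LinearMap.smul_apply]

/-- The value of a homomorphism on the generator `c_λ` of the Specht module. -/
def evalGen (k V : Type*) [Field k] [AddCommGroup V] [Module k V] (l : n.Partition) :
    WeylModule k V l →ₗ[k] PiTensorProduct k (fun _ : Fin n => V) where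
  toFun f := f (spechtGen k l)
  map_add' _ _ := rfl
  map_smul' _ _ := rfl

theorem coe_spechtRep (l : n.Partition) (g : Equiv.Perm (Fin n)) (x : Specht k l) :
    ((spechtRep k l g x : Specht k l) : MonoidAlgebra k (Equiv.Perm (Fin n))) =
      MonoidAlgebra.of k _ g * x := rfl

/-- The linear map `x ↦ x • t` from the Specht module, for a tensor `t`. -/
def smulTensor (l : n.Partition) (t : PiTensorProduct k (fun _ : Fin n => V)) :
    Specht k l →ₗ[k] PiTensorProduct k (fun _ : Fin n => V) :=
  LinearMap.applyₗ t ∘ₗ (permRep k V n).asAlgebraHom.toLinearMap ∘ₗ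
    (Specht k l).subtype.restrictScalars k

theorem smulTensor_apply (l : n.Partition) (t : PiTensorProduct k (fun _ : Fin n => V))
    (x : Specht k l) : smulTensor l t x =
      (permRep k V n).asAlgebraHom (x : MonoidAlgebra k (Equiv.Perm (Fin n))) t := rfl

theorem smulTensor_spechtRep (l : n.Partition) (t : PiTensorProduct k (fun _ : Fin n => V))
    (g : Equiv.Perm (Fin n)) (x : Specht k l) :
    smulTensor l t (spechtRep k l g x) = permRep k V n g (smulTensor l t x) := by
  rw [smulTensor_apply, coe_spechtRep, map_mul, Representation.asAlgebraHom_of,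
    Module.End.mul_apply, smulTensor_apply]

/-- The homomorphism `x ↦ x • t` from the Specht module, for a tensor `t`. -/
def ofTensor (l : n.Partition) :
    PiTensorProduct k (fun _ : Fin n => V) →ₗ[k] WeylModule k V l where
  toFun t := ⟨smulTensor l t, fun g => LinearMap.ext fun x => smulTensor_spechtRep l t g x⟩
  map_add' s t := Representation.IntertwiningMap.ext <| LinearMap.ext fun x =>
    map_add ((permRep k V n).asAlgebraHom (x : MonoidAlgebra k (Equiv.Perm (Fin n)))) s t
  map_smul' r t := Representation.IntertwiningMap.ext <| LinearMap.ext fun x =>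
    map_smul ((permRep k V n).asAlgebraHom (x : MonoidAlgebra k (Equiv.Perm (Fin n)))) r t

theorem evalGen_weylRep (l : n.Partition) (g : LinearMap.GeneralLinearGroup k V)
    (f : WeylModule k V l) :
    evalGen k V l (weylRep k V l g f) = tensorPowerRep (stdRep k V) n g (evalGen k V l f) := rfl

section

variable [CharZero k]

theorem ofTensor_evalGen (l : n.Partition) (f : WeylModule k V l) :
    ofTensor l (evalGen k V l f) = youngScalar k l • f := by
  apply Representation.IntertwiningMap.ext
  ext x
  change (permRep k V n).asAlgebraHom (x : MonoidAlgebra k (Equiv.Perm (Fin n)))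
    (f (spechtGen k l)) = youngScalar k l • f x
  rw [← weylModule_apply_smul, ← map_smul]
  congr 1
  exact Subtype.ext (coe_mul_youngSymmetrizer x)

end

variable [FiniteDimensional k V]

open MvPolynomial

theorem algebraMap_trace_tensorPowerRep (K : Type*) [Field K] [Algebra k K]
    (g : LinearMap.GeneralLinearGroup k V) (x : Fin (Module.finrank k V) → K)
    (hx : (LinearMap.charpoly (g : V →ₗ[k] V)).map (algebraMap k K) =
      ∏ i, (Polynomial.X - Polynomial.C (x i))) (y : MonoidAlgebra k (Equiv.Perm (Fin n))) :
    algebraMap k K (LinearMap.trace k _ (tensorPowerRep (stdRep k V) n g ∘ₗ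
        (permRep k V n).asAlgebraHom y)) =
      aeval x (wordChar k n (Module.finrank k V) y) := by
  have h : Algebra.linearMap k K ∘ₗ LinearMap.trace k _ ∘ₗ
      LinearMap.mulLeft k (tensorPowerRep (stdRep k V) n g) ∘ₗ
        ((permRep k V n).asAlgebraHom).toLinearMap =
      (aeval x).toLinearMap ∘ₗ wordChar k n (Module.finrank k V) := by
    refine linearMap_ext_single fun s => ?_
    have h1 := trace_map_comp_permRep (Module.finBasis k V) (g : V →ₗ[k] V) s
    have h2 : ((LinearMap.toMatrix (Module.finBasis k V) (Module.finBasis k V)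
        (g : V →ₗ[k] V)).map (algebraMap k K)).charpoly =
        ∏ i, (Polynomial.X - Polynomial.C (x i)) := by
      rw [Matrix.charpoly_map, LinearMap.charpoly_toMatrix, hx]
    simp only [LinearMap.comp_apply, AlgHom.toLinearMap_apply, LinearMap.mulLeft_apply]
    rw [wordChar_single, Representation.asAlgebraHom_single_one, one_smul]
    refine (congrArg (algebraMap k K) h1).trans ?_
    rw [map_matrixPermTrace, matrixPermTrace_eq_aeval h2]
    simp [permPoly]
  exact LinearMap.congr_fun h y

theorem charpoly_one_map :
    (LinearMap.charpoly ((1 : LinearMap.GeneralLinearGroup k V) : V →ₗ[k] V)).map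
      (algebraMap k k) = ∏ i : Fin (Module.finrank k V),
        (Polynomial.X - Polynomial.C ((fun _ => 1 : Fin (Module.finrank k V) → k) i)) := by
  rw [← LinearMap.charpoly_toMatrix _ (Module.finBasis k V), Units.val_one,
    LinearMap.toMatrix_one, Matrix.charpoly_one]
  simp

variable [CharZero k]

/-- As `ofTensor ∘ evalGen = κ` and `evalGen ∘ ofTensor = c_λ`, the module `L_λ` is a direct summand
of the tensor power with projection `κ⁻¹ c_λ`. -/
theorem weylRep_character (l : n.Partition) (g : LinearMap.GeneralLinearGroup k V) :
    (weylRep k V l).character g = (youngScalar k l)⁻¹ *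
      LinearMap.trace k _ (tensorPowerRep (stdRep k V) n g ∘ₗ
        (permRep k V n).asAlgebraHom (youngSymmetrizer k l)) := by
  have h1 : weylRep k V l g = (youngScalar k l)⁻¹ • (ofTensor l ∘ₗ
      (tensorPowerRep (stdRep k V) n g ∘ₗ evalGen k V l)) := by
    apply LinearMap.ext
    intro f
    rw [LinearMap.smul_apply, LinearMap.comp_apply, LinearMap.comp_apply, ← evalGen_weylRep,
      ofTensor_evalGen, smul_smul, inv_mul_cancel₀ (youngScalar_ne_zero l), one_smul]
  rw [Representation.character, h1, map_smul, LinearMap.trace_comp_comm', LinearMap.comp_assoc]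
  rfl

/-- The Weyl character formula. -/
theorem algebraMap_weylRep_character {l : n.Partition} (hl : numParts l ≤ Module.finrank k V)
    (K : Type*) [Field K] [Algebra k K]
    (g : LinearMap.GeneralLinearGroup k V) (x : Fin (Module.finrank k V) → K)
    (hx : (LinearMap.charpoly (g : V →ₗ[k] V)).map (algebraMap k K) =
      ∏ i, (Polynomial.X - Polynomial.C (x i))) :
    algebraMap k K ((weylRep k V l).character g) =
      aeval x (schurPoly (Module.finrank k V) l) := by
  rw [weylRep_character, map_mul, algebraMap_trace_tensorPowerRep K g x hx,
    wordChar_youngSymmetrizer hl, map_smul, Algebra.smul_def, ← mul_assoc, ← map_mul,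
    inv_mul_cancel₀ (youngScalar_ne_zero l), map_one, one_mul]
  rw [aeval_def, eval₂_map, aeval_def]
  congr 1
  exact RingHom.ext_int _ _

theorem finrank_weylModule_eq_eval {l : n.Partition} (hl : numParts l ≤ Module.finrank k V) :
    (Module.finrank k (WeylModule k V l) : ℤ) =
      eval (fun _ => 1) (schurPoly (Module.finrank k V) l) := by
  have h := algebraMap_weylRep_character hl k 1 (fun _ => 1) charpoly_one_map
  rw [Representation.char_one] at h
  have h2 : (aeval (fun _ => (1 : k))) (schurPoly (Module.finrank k V) l) =
      ((eval (fun _ => 1) (schurPoly (Module.finrank k V) l) : ℤ) : k) := by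
    have : (aeval (fun _ => (1 : k)) :
        MvPolynomial (Fin (Module.finrank k V)) ℤ →ₐ[ℤ] k).toRingHom =
        (Int.castRingHom k).comp (eval fun _ => 1) :=
      MvPolynomial.ringHom_ext (fun r => by simp) fun i => by simp
    exact RingHom.congr_fun this _
  rw [h2, Algebra.algebraMap_self, RingHom.id_apply] at h
  exact_mod_cast h

/-- If there are fewer than `numParts l` letters, every word repeats a letter in some column, so
the trace of `c_λ` vanishes. -/
theorem weylModule_subsingleton {l : n.Partition} (hl : Module.finrank k V < numParts l) :
    Subsingleton (WeylModule k V l) := by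
  have h0 : wordChar k n (Module.finrank k V) (youngSymmetrizer k l) = 0 := by
    rw [wordChar_eq_sum]
    refine Finset.sum_eq_zero fun f _ => ?_
    by_cases hinj : ∀ m m', colOf l m = colOf l m' → f m = f m' → m = m'
    · exfalso
      have h := card_lt_le_sum_part l (f := fun m => (f m : ℕ))
        (fun m m' hc hm => hinj m m' hc (Fin.val_injective hm)) (Module.finrank k V)
      rw [sum_part] at h
      obtain ⟨m, hm, -⟩ := exists_cell l ((part_pos_iff l _).2 hl)
      refine absurd h (not_le.2 (Finset.card_lt_card ?_))
      refine ⟨fun m _ => by simp, fun hsub => ?_⟩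
      have := hsub (Finset.mem_filter.2 ⟨Finset.mem_univ m, (f m).2⟩)
      rw [Finset.mem_filter] at this
      omega
    · push Not at hinj
      obtain ⟨m, m', hc, hf, hne⟩ := hinj
      rw [youngSymmetrizer, wordCoeff_mul_colProjector_eq_zero l hc hf hne, zero_smul]
  have h := algebraMap_trace_tensorPowerRep k (1 : LinearMap.GeneralLinearGroup k V) (fun _ => 1)
    charpoly_one_map (youngSymmetrizer k l)
  rw [h0, map_zero, Algebra.algebraMap_self, RingHom.id_apply] at h
  have h1 := weylRep_character l (1 : LinearMap.GeneralLinearGroup k V)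
  rw [h, mul_zero, Representation.char_one, Nat.cast_eq_zero] at h1
  exact Module.finrank_zero_iff.1 h1

end WeylCharacter

section Dimension

open MvPolynomial

/-- Specialization of an alternant at `1, q, …, q^{N-1}`. -/
theorem aeval_alternant_pow (N : ℕ) (a : ℕ → ℕ) :
    aeval (fun i : Fin N => (Polynomial.X : Polynomial ℤ) ^ (i : ℕ)) (alternant N a) =
      ∏ i : Fin N, ∏ j ∈ Finset.Ioi i, ((Polynomial.X : Polynomial ℤ) ^ (a j + (N - 1 - j)) -
        Polynomial.X ^ (a i + (N - 1 - i))) := by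
  rw [← Matrix.det_vandermonde fun i : Fin N => (Polynomial.X : Polynomial ℤ) ^ (a i + (N - 1 - i)),
    ← Matrix.det_transpose, alternant, AlgHom.map_det]
  congr 1
  ext1 i j
  simp only [AlgHom.mapMatrix_apply, Matrix.map_apply, Matrix.of_apply, map_pow, aeval_X,
    Matrix.transpose_apply, Matrix.vandermonde_apply]
  rw [← pow_mul, ← pow_mul, mul_comm]

/-- The dimension formula, from the specialization `x_i = q^i` in the limit `q → 1`. -/
theorem prod_sub_eq_mul_eval_schurPoly (N : ℕ) {n : ℕ} (l : n.Partition) :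
    ∏ i : Fin N, ∏ j ∈ Finset.Ioi i,
      ((part l i : ℤ) - part l j + j - i) =
      (∏ i : Fin N, ∏ j ∈ Finset.Ioi i, ((j : ℤ) - i)) * eval (fun _ => 1) (schurPoly N l) := by
  let S := aeval (fun i : Fin N => (Polynomial.X : Polynomial ℤ) ^ (i : ℕ)) (schurPoly N l)
  let G : (ℕ → ℕ) → Polynomial ℤ := fun a => ∏ i : Fin N, ∏ j ∈ Finset.Ioi i,
    ((∑ t ∈ Finset.range (a i + (N - 1 - i)), Polynomial.X ^ t) -
      ∑ t ∈ Finset.range (a j + (N - 1 - j)), Polynomial.X ^ t)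
  have hS : S.eval 1 = eval (fun _ => 1) (schurPoly N l) := by
    have : (Polynomial.evalRingHom 1).comp (aeval fun i : Fin N =>
        (Polynomial.X : Polynomial ℤ) ^ (i : ℕ)).toRingHom = eval fun _ => 1 :=
      MvPolynomial.ringHom_ext (fun r => by simp) fun i => by simp
    exact RingHom.congr_fun this _
  have hG : ∀ a, aeval (fun i : Fin N => (Polynomial.X : Polynomial ℤ) ^ (i : ℕ)) (alternant N a) =
      (∏ i : Fin N, ∏ _j ∈ Finset.Ioi i, (1 - Polynomial.X)) * G a := by
    intro a
    rw [aeval_alternant_pow]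
    simp only [G, ← Finset.prod_mul_distrib]
    refine Finset.prod_congr rfl fun i _ => Finset.prod_congr rfl fun j _ => ?_
    rw [mul_sub, mul_neg_geom_sum, mul_neg_geom_sum]
    ring
  have h := congrArg (aeval fun i : Fin N => (Polynomial.X : Polynomial ℤ) ^ (i : ℕ))
    (alternant_eq_mul_schurPoly N l)
  have hne : ∏ i : Fin N, ∏ _j ∈ Finset.Ioi i, (1 - Polynomial.X : Polynomial ℤ) ≠ 0 := by
    refine Finset.prod_ne_zero_iff.2 fun i _ => Finset.prod_ne_zero_iff.2 fun j _ => ?_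
    rw [← neg_ne_zero, neg_sub]
    exact Polynomial.X_sub_C_ne_zero 1
  rw [map_mul, hG, hG, mul_assoc] at h
  have h' := congrArg (Polynomial.eval 1) (mul_left_cancel₀ hne h)
  have hG1 : ∀ a, (G a).eval 1 = ∏ i : Fin N, ∏ j ∈ Finset.Ioi i,
      ((a i : ℤ) - a j + j - i) := by
    intro a
    simp only [G, Polynomial.eval_prod]
    refine Finset.prod_congr rfl fun i _ => Finset.prod_congr rfl fun j hj => ?_
    simp only [Polynomial.eval_sub, Polynomial.eval_finsetSum, Polynomial.eval_pow,
      Polynomial.eval_X, one_pow, Finset.sum_const, Finset.card_range, nsmul_eq_mul, mul_one]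
    have := i.2
    have := j.2
    omega
  simp only [Polynomial.eval_mul, hG1] at h'
  simpa [S, ← hS] using h'

theorem finrank_weylModule {n : ℕ} {k : Type*} [Field k] [CharZero k] {V : Type*}
    [AddCommGroup V] [Module k V] [FiniteDimensional k V] {l : n.Partition}
    (hl : numParts l ≤ Module.finrank k V) :
    (Module.finrank k (WeylModule k V l) : ℚ) =
      ∏ i : Fin (Module.finrank k V), ∏ j ∈ Finset.Ioi i,
        ((part l i : ℚ) - part l j + j - i) / ((j : ℚ) - i) := by
  have h := prod_sub_eq_mul_eval_schurPoly (Module.finrank k V) l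
  rw [← finrank_weylModule_eq_eval hl] at h
  have hne : (∏ i : Fin (Module.finrank k V), ∏ j ∈ Finset.Ioi i, ((j : ℚ) - i)) ≠ 0 := by
    refine Finset.prod_ne_zero_iff.2 fun i _ => Finset.prod_ne_zero_iff.2 fun j hj => ?_
    have : (i : ℕ) < j := Fin.lt_def.1 (Finset.mem_Ioi.1 hj)
    exact sub_ne_zero.2 (Nat.cast_injective.ne this.ne')
  simp only [Finset.prod_div_distrib]
  rw [eq_div_iff hne, mul_comm]
  exact_mod_cast h.symm

/-- If `L_λ` vanishes, so does one of the factors `λ_i - λ_j + j - i`, and these are positive. -/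
theorem subsingleton_weylModule_iff {n : ℕ} {k : Type*} [Field k] [CharZero k] {V : Type*}
    [AddCommGroup V] [Module k V] [FiniteDimensional k V] {l : n.Partition} :
    Subsingleton (WeylModule k V l) ↔ Module.finrank k V < numParts l := by
  refine ⟨fun h => ?_, weylModule_subsingleton⟩
  by_contra! hl
  have h0 : Module.finrank k (WeylModule k V l) = 0 := Module.finrank_zero_of_subsingleton
  have h1 := finrank_weylModule hl
  rw [h0, Nat.cast_zero, eq_comm, Finset.prod_eq_zero_iff] at h1
  obtain ⟨i, -, hi⟩ := h1
  obtain ⟨j, hj, hij⟩ := Finset.prod_eq_zero_iff.1 hi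
  have hlt : (i : ℕ) < j := Fin.lt_def.1 (Finset.mem_Ioi.1 hj)
  have h2 : (part l j : ℚ) ≤ part l i := Nat.cast_le.2 (antitone_part l hlt.le)
  have h3 : (i : ℚ) < (j : ℕ) := Nat.cast_lt.2 hlt
  rcases div_eq_zero_iff.1 hij with h | h <;> linarith

end Dimension

/-! ### Schur–Weyl duality and irreducibility -/

section SchurWeylDuality

variable {n : ℕ} {k : Type*} [Field k] {V : Type*} [AddCommGroup V] [Module k V]

open MvPolynomial in
/-- The determinant of a generic linear combination, as a polynomial in the coefficients. -/
theorem exists_eval_eq_det [FiniteDimensional k V] {ι : Type*} [Fintype ι] (Y : ι → V →ₗ[k] V) :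
    ∃ Q : MvPolynomial ι k, ∀ t : ι → k, eval t Q = LinearMap.det (∑ a, t a • Y a) := by
  let b := Module.finBasis k V
  refine ⟨Matrix.det (Matrix.of fun i j => ∑ a, X a * C (LinearMap.toMatrix b b (Y a) i j)),
    fun t => ?_⟩
  rw [RingHom.map_det, ← LinearMap.det_toMatrix b]
  congr 1
  ext i j
  simp only [RingHom.mapMatrix_apply, Matrix.map_apply, Matrix.of_apply, map_sum, map_mul, eval_X,
    eval_C, map_smul, Matrix.sum_apply, Matrix.smul_apply, smul_eq_mul]

open MvPolynomial in
/-- A functional that vanishes on all `g ⊗ ⋯ ⊗ g` vanishes on all symmetrized tensor products of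
endomorphisms: the values on `(t₀ + ∑ tᵢ Yᵢ)^{⊗ n}` form a polynomial in the `tᵢ` that vanishes
wherever the determinant does not. -/
theorem sum_map_perm_eq_zero [Infinite k] [FiniteDimensional k V]
    (φ : Module.Dual k (Module.End k (PiTensorProduct k (fun _ : Fin n => V))))
    (hφ : ∀ g : LinearMap.GeneralLinearGroup k V, φ (tensorPowerRep (stdRep k V) n g) = 0)
    (Y : Fin n → V →ₗ[k] V) :
    ∑ s : Equiv.Perm (Fin n), φ (PiTensorProduct.map fun i => Y (s i)) = 0 := by
  classical
  let Z : Option (Fin n) → V →ₗ[k] V := fun a => a.elim 1 Y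
  obtain ⟨Q, hQ⟩ := exists_eval_eq_det Z
  let P : MvPolynomial (Option (Fin n)) k :=
    ∑ h : Fin n → Option (Fin n), C (φ (PiTensorProduct.map fun i => Z (h i))) * ∏ i, X (h i)
  have hP : ∀ t, eval t P = φ (PiTensorProduct.map fun _ => ∑ a, t a • Z a) := by
    intro t
    have h1 : (PiTensorProduct.map fun _ : Fin n => ∑ a, t a • Z a) =
        ∑ h : Fin n → Option (Fin n), (∏ i, t (h i)) • PiTensorProduct.map fun i => Z (h i) := by
      have := (PiTensorProduct.mapMultilinear k (fun _ : Fin n => V) fun _ => V).map_sum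
        fun (_ : Fin n) (a : Option (Fin n)) => t a • Z a
      simp only [MultilinearMap.map_smul_univ] at this
      exact this
    rw [h1, map_sum, map_sum]
    refine Finset.sum_congr rfl fun h _ => ?_
    rw [map_mul, eval_C, map_prod, map_smul, smul_eq_mul, mul_comm]
    simp only [eval_X]
  have hPQ : P * Q = 0 := by
    refine MvPolynomial.funext fun t => ?_
    rw [map_mul, map_zero, hP, hQ]
    by_cases hdet : LinearMap.det (∑ a, t a • Z a) = 0
    · rw [hdet, mul_zero]
    · obtain ⟨g, hg⟩ := (LinearMap.isUnit_iff_isUnit_det _).2 (isUnit_iff_ne_zero.2 hdet)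
      have := hφ g
      rw [← hg]
      exact mul_eq_zero_of_left this _
  have hQ0 : Q ≠ 0 := by
    intro h
    have := hQ (fun a => a.elim 1 fun _ => 0)
    rw [h, map_zero, Fintype.sum_option] at this
    simp [Z] at this
  have hP0 : P = 0 := (mul_eq_zero.1 hPQ).resolve_right hQ0
  let d : Option (Fin n) →₀ ℕ := ∑ i : Fin n, Finsupp.single (some i) 1
  have hd : ∀ h : Fin n → Option (Fin n), (∏ i, (X (h i) : MvPolynomial (Option (Fin n)) k)) =
      monomial (∑ i, Finsupp.single (h i) 1) 1 := fun h => by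
    have := map_prod (monomialOneHom k (Option (Fin n)))
      (fun i => Multiplicative.ofAdd (Finsupp.single (h i) 1)) Finset.univ
    rw [← ofAdd_sum] at this
    exact this.symm
  have hcoeff : coeff d P = ∑ h : Fin n → Option (Fin n) with
      (∑ i, Finsupp.single (h i) 1) = d, φ (PiTensorProduct.map fun i => Z (h i)) := by
    rw [coeff_sum, Finset.sum_filter]
    refine Finset.sum_congr rfl fun h _ => ?_
    rw [coeff_C_mul, hd, coeff_monomial]
    split_ifs <;> simp
  rw [hP0, coeff_zero] at hcoeff
  rw [hcoeff]
  refine Finset.sum_bij (fun s _ => fun i => some (s i)) (fun s _ => ?_) (fun s _ t _ hst => ?_)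
    (fun h hh => ?_) fun s _ => rfl
  · rw [Finset.mem_filter_univ]
    exact Equiv.sum_comp s fun i => Finsupp.single (some i) 1
  · ext i
    exact congrArg Fin.val (Option.some.inj (congrFun hst i))
  · rw [Finset.mem_filter_univ] at hh
    have hval : ∀ a, d a = (Finset.univ.filter fun i => h i = a).card := fun a => by
      rw [← hh, Finsupp.finsetSum_apply, Finset.card_filter]
      exact Finset.sum_congr rfl fun i _ => by rw [Finsupp.single_apply]
    have hsome : ∀ i, ∃ j, h i = some j := fun i => by
      rw [← Option.isSome_iff_exists, ← Option.ne_none_iff_isSome]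
      intro hi
      have h0 : d none = 0 := by simp [d, Finsupp.finsetSum_apply]
      rw [hval, Finset.card_eq_zero] at h0
      exact absurd (Finset.mem_filter.2 ⟨Finset.mem_univ i, hi⟩) (h0 ▸ Finset.notMem_empty i)
    choose s hs using hsome
    have hsurj : Function.Surjective s := fun j => by
      have h1 : d (some j) = 1 := by simp [d, Finsupp.finsetSum_apply, Finsupp.single_apply]
      rw [hval] at h1
      obtain ⟨i, hi⟩ := Finset.card_pos.1 (h1.symm ▸ one_pos)
      exact ⟨i, Option.some.inj ((hs i).symm.trans (Finset.mem_filter.1 hi).2)⟩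
    exact ⟨Equiv.ofBijective s (Finite.surjective_iff_bijective.1 hsurj), Finset.mem_univ _,
      funext fun i => (hs i).symm⟩

theorem permRep_comp_map_comp (Y : Fin n → V →ₗ[k] V) (s : Equiv.Perm (Fin n)) :
    permRep k V n s ∘ₗ PiTensorProduct.map Y ∘ₗ permRep k V n s⁻¹ =
      PiTensorProduct.map fun i => Y (s⁻¹ i) := by
  apply PiTensorProduct.ext
  ext v
  simp only [LinearMap.compMultilinearMap_apply, LinearMap.comp_apply]
  have h : ∀ (s : Equiv.Perm (Fin n)) (v : Fin n → V), permRep k V n s (PiTensorProduct.tprod k v) =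
      PiTensorProduct.tprod k fun i => v (s⁻¹ i) := fun s v => PiTensorProduct.reindex_tprod _ _
  rw [h, PiTensorProduct.map_tprod, h, PiTensorProduct.map_tprod]
  refine congrArg (PiTensorProduct.tprod k) (funext fun i => congrArg (Y (s⁻¹ i)) ?_)
  rw [← Equiv.Perm.mul_apply, inv_mul_cancel, Equiv.Perm.one_apply]

/-- The tensor products of endomorphisms span the endomorphisms of the tensor power. -/
theorem mem_span_range_map [FiniteDimensional k V]
    (T : Module.End k (PiTensorProduct k (fun _ : Fin n => V))) :
    T ∈ Submodule.span k (Set.range fun Y : Fin n → V →ₗ[k] V => PiTensorProduct.map Y) := by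
  let b := Module.finBasis k V
  let B := Basis.piTensorProduct fun _ : Fin n => b
  have hT : T = ∑ f, ∑ f', B.repr (T (B f')) f • PiTensorProduct.map fun i =>
      (b.coord (f' i)).smulRight (b (f i)) := by
    refine B.ext fun h => ?_
    simp only [LinearMap.sum_apply, LinearMap.smul_apply]
    conv_lhs => rw [← B.sum_repr (T (B h))]
    refine Finset.sum_congr rfl fun f _ => ?_
    rw [Finset.sum_eq_single h]
    · congr 1
      simp [B, PiTensorProduct.map_tprod]
    · intro f' _ hf'
      obtain ⟨i, hi⟩ := Function.ne_iff.1 hf'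
      rw [show B h = _ from Basis.piTensorProduct_apply (fun _ : Fin n => b) h,
        PiTensorProduct.map_tprod, MultilinearMap.map_coord_zero _ i, smul_zero]
      simp [hi.symm]
    · simp
  rw [hT]
  exact Submodule.sum_mem _ fun f _ => Submodule.sum_mem _ fun f' _ =>
    Submodule.smul_mem _ _ (Submodule.subset_span ⟨_, rfl⟩)

/-- Schur–Weyl duality: the commutant of the symmetric group is spanned by `GL(V)`. -/
theorem mem_span_range_tensorPowerRep [CharZero k] [FiniteDimensional k V]
    (T : Module.End k (PiTensorProduct k (fun _ : Fin n => V)))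
    (hT : ∀ s, T ∘ₗ permRep k V n s = permRep k V n s ∘ₗ T) :
    T ∈ Submodule.span k (Set.range fun g : LinearMap.GeneralLinearGroup k V =>
      (tensorPowerRep (stdRep k V) n g : Module.End k _)) := by
  by_contra hmem
  obtain ⟨φ, hφT, hφ⟩ := Submodule.exists_le_ker_of_notMem hmem
  have hφ' : ∀ g, φ (tensorPowerRep (stdRep k V) n g) = 0 := fun g =>
    hφ (Submodule.subset_span ⟨g, rfl⟩)
  let Φ : Module.Dual k (Module.End k (PiTensorProduct k (fun _ : Fin n => V))) :=
    ∑ s : Equiv.Perm (Fin n), φ ∘ₗ LinearMap.mulLeft k (permRep k V n s) ∘ₗ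
      LinearMap.mulRight k (permRep k V n s⁻¹)
  have hΦ : ∀ S, Φ S = ∑ s, φ (permRep k V n s ∘ₗ S ∘ₗ permRep k V n s⁻¹) := fun S => by
    simp only [Φ, LinearMap.sum_apply]
    rfl
  have hΦ0 : Φ T = 0 := by
    refine Submodule.span_induction ?_ (map_zero Φ) ?_ ?_ (mem_span_range_map T)
    · rintro _ ⟨Y, rfl⟩
      rw [hΦ]
      simp only [permRep_comp_map_comp]
      rw [← sum_map_perm_eq_zero φ hφ' Y]
      exact Equiv.sum_comp (Equiv.inv (Equiv.Perm (Fin n)))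
        fun s => φ (PiTensorProduct.map fun i => Y (s i))
    · intro x y _ _ hx hy
      rw [map_add, hx, hy, add_zero]
    · intro r x _ hx
      rw [map_smul, hx, smul_zero]
  have hΦ1 : Φ T = (Fintype.card (Equiv.Perm (Fin n)) : k) * φ T := by
    rw [hΦ, Finset.sum_congr rfl fun s _ => ?_, Finset.sum_const, Finset.card_univ, nsmul_eq_mul]
    rw [hT, ← LinearMap.comp_assoc, ← Module.End.mul_eq_comp (permRep k V n s), ← map_mul,
      mul_inv_cancel, map_one]
    rfl
  rw [hΦ1] at hΦ0
  exact hφT ((mul_eq_zero.1 hΦ0).resolve_left (Nat.cast_ne_zero.2 Fintype.card_ne_zero))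

end SchurWeylDuality

section Irreducible

theorem isIrreducible_of_forall_mem_span {G k W : Type*} [Monoid G] [Field k] [AddCommGroup W]
    [Module k W] [Nontrivial W] (ρ : Representation k G W)
    (h : ∀ x ≠ 0, ∀ y, y ∈ Submodule.span k (Set.range fun g => ρ g x)) : ρ.IsIrreducible where
  exists_pair_ne := ⟨⊥, ⊤, fun h => by
    obtain ⟨x, hx⟩ := exists_ne (0 : W)
    have : x ∈ (⊥ : Subrepresentation ρ) := h ▸ (Submodule.mem_top : x ∈ (⊤ : Submodule k W))
    exact hx ((Submodule.mem_bot k).1 this)⟩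
  eq_bot_or_eq_top U := by
    by_cases hU : ∀ x ∈ U.toSubmodule, x = 0
    · exact Or.inl (Subrepresentation.toSubmodule_injective ((Submodule.eq_bot_iff _).2 hU))
    · push Not at hU
      obtain ⟨x, hx, hx0⟩ := hU
      refine Or.inr (Subrepresentation.toSubmodule_injective (eq_top_iff.2 fun y _ => ?_))
      refine Submodule.span_le.2 ?_ (h x hx0 y)
      rintro _ ⟨g, rfl⟩
      exact U.apply_mem_toSubmodule g hx

variable {n : ℕ} {k : Type*} [Field k] [CharZero k] {V : Type*} [AddCommGroup V] [Module k V]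

theorem weylModule_injective {l : n.Partition} {f : WeylModule k V l} (hf : f ≠ 0) :
    Function.Injective f := by
  rw [injective_iff_map_eq_zero]
  intro x hx
  by_contra hx0
  apply hf
  apply Representation.IntertwiningMap.ext
  ext z
  obtain ⟨a, rfl⟩ := IsSimpleModule.toSpanSingleton_surjective
    (MonoidAlgebra k (Equiv.Perm (Fin n))) hx0 z
  change f (a • x) = 0
  rw [weylModule_apply_smul, hx, map_zero]

/-- Homomorphisms out of the simple Specht module extend along a nonzero one, by Maschke's
theorem. -/
theorem exists_comp_eq {l : n.Partition} {f : WeylModule k V l} (hf : f ≠ 0)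
    (φ : WeylModule k V l) :
    ∃ T : Module.End k (PiTensorProduct k (fun _ : Fin n => V)),
      (∀ s, T ∘ₗ permRep k V n s = permRep k V n s ∘ₗ T) ∧ ∀ x, T (f x) = φ x := by
  let toHom : WeylModule k V l → Specht k l →ₗ[MonoidAlgebra k (Equiv.Perm (Fin n))]
      (permRep k V n).asModule := fun f =>
    { toFun := f
      map_add' := fun x y => map_add f x y
      map_smul' := fun a x => weylModule_apply_smul f a x }
  have : IsSemisimpleModule (MonoidAlgebra k (Equiv.Perm (Fin n))) (permRep k V n).asModule :=
    inferInstance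
  obtain ⟨h, hh⟩ := IsSemisimpleModule.extension_property (toHom f) (weylModule_injective hf)
    (toHom φ)
  let H := (Representation.IntertwiningMap.equivLinearMapAsModule (permRep k V n)
    (permRep k V n)).symm h
  exact ⟨H.toLinearMap, fun s => H.isIntertwining' s, fun x => LinearMap.congr_fun hh x⟩

/-- A homomorphism `φ` equals `T ∘ f` for some `T` that commutes with `S_n`, and `T` is a linear
combination of operators `g ⊗ ⋯ ⊗ g` by Schur–Weyl duality. -/
theorem weylRep_isIrreducible [FiniteDimensional k V] {l : n.Partition}
    (hl : numParts l ≤ Module.finrank k V) : (weylRep k V l).IsIrreducible := by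
  have hnt : Nontrivial (WeylModule k V l) := by
    rw [← not_subsingleton_iff_nontrivial, subsingleton_weylModule_iff]
    exact hl.not_gt
  refine isIrreducible_of_forall_mem_span _ fun f hf φ => ?_
  obtain ⟨T, hT, hTf⟩ := exists_comp_eq hf φ
  have hmem : evalGen k V l φ ∈ Submodule.span k (Set.range fun g =>
      evalGen k V l (weylRep k V l g f)) := by
    have h := Submodule.mem_map_of_mem (f := LinearMap.applyₗ (evalGen k V l f))
      (mem_span_range_tensorPowerRep T hT)
    rw [Submodule.map_span, ← Set.range_comp] at h
    have h' : LinearMap.applyₗ (evalGen k V l f) T = evalGen k V l φ := hTf _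
    rwa [h'] at h
  have h := Submodule.mem_map_of_mem (f := (youngScalar k l)⁻¹ • ofTensor (V := V) l) hmem
  rw [Submodule.map_span, ← Set.range_comp] at h
  have hinv : ∀ φ : WeylModule k V l,
      ((youngScalar k l)⁻¹ • ofTensor (V := V) l) (evalGen k V l φ) = φ := fun φ => by
    rw [LinearMap.smul_apply, ofTensor_evalGen, smul_smul,
      inv_mul_cancel₀ (youngScalar_ne_zero l), one_smul]
  simpa only [Function.comp_def, hinv] using h

end Irreducible

/-! ### Irreducible representations are determined by their characters -/

section Determined

/-- Simple modules with the same traces are isomorphic: otherwise, by the density theorem, some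
element of the algebra acts as the identity on one and as zero on the other. -/
theorem nonempty_linearEquiv_of_trace_eq {k R S T : Type*} [Field k] [CharZero k] [Ring R]
    [AddCommGroup S] [Module k S] [Module R S] [AddCommGroup T] [Module k T] [Module R T]
    [FiniteDimensional k S] [FiniteDimensional k T] [IsSimpleModule R S] [IsSimpleModule R T]
    {α : R → S →ₗ[k] S} {β : R → T →ₗ[k] T} (hα : ∀ r x, α r x = r • x)
    (hβ : ∀ r x, β r x = r • x)
    (h : ∀ r : R, LinearMap.trace k S (α r) = LinearMap.trace k T (β r)) :
    Nonempty (S ≃ₗ[R] T) := by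
  classical
  by_contra hne
  have h1 : ∀ φ : S →ₗ[R] T, φ = 0 := fun φ =>
    (LinearMap.bijective_or_eq_zero φ).resolve_left fun hb => hne ⟨LinearEquiv.ofBijective φ hb⟩
  have h2 : ∀ φ : T →ₗ[R] S, φ = 0 := fun φ =>
    (LinearMap.bijective_or_eq_zero φ).resolve_left fun hb =>
      hne ⟨(LinearEquiv.ofBijective φ hb).symm⟩
  have hss : IsSemisimpleModule R (S × T) := by
    have h3 : IsSemisimpleModule R (⊤ : Submodule R (S × T)) := by
      rw [← LinearMap.sup_range_inl_inr]
      exact IsSemisimpleModule.sup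
        (IsSemisimpleModule.of_surjective (LinearMap.inl R S T).rangeRestrict
          (LinearMap.surjective_rangeRestrict _))
        (IsSemisimpleModule.of_surjective (LinearMap.inr R S T).rangeRestrict
          (LinearMap.surjective_rangeRestrict _))
    exact IsSemisimpleModule.congr Submodule.topEquiv.symm
  -- the projection to the first factor commutes with all endomorphisms
  let f : Module.End (Module.End R (S × T)) (S × T) :=
    { toFun := fun m => (m.1, 0)
      map_add' := fun m m' => by simp
      map_smul' := fun Φ m => by
        have e1 := LinearMap.congr_fun (h2 (LinearMap.fst R S T ∘ₗ Φ ∘ₗ LinearMap.inr R S T)) m.2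
        have e2 := LinearMap.congr_fun (h1 (LinearMap.snd R S T ∘ₗ Φ ∘ₗ LinearMap.inl R S T)) m.1
        have e3 : m = (m.1, 0) + (0, m.2) := by simp
        simp only [LinearMap.comp_apply, LinearMap.inr_apply, LinearMap.inl_apply,
          LinearMap.fst_apply, LinearMap.snd_apply, LinearMap.zero_apply] at e1 e2
        simp only [Module.End.smul_def, RingHom.id_apply]
        conv_lhs => rw [e3, map_add]
        exact Prod.ext (by simp [e1]) e2.symm }
  let b := Module.finBasis k S
  let c := Module.finBasis k T
  obtain ⟨r, hr⟩ := jacobson_density f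
    (Finset.univ.image (fun i => (b i, (0 : T))) ∪ Finset.univ.image fun j => ((0 : S), c j))
  have hS : α r = LinearMap.id := b.ext fun i =>
    (hα _ _).trans (congrArg Prod.fst (hr (b i, 0) (by simp))).symm
  have hT : β r = 0 := c.ext fun j =>
    (hβ _ _).trans (congrArg Prod.snd (hr (0, c j) (by simp))).symm
  have := h r
  rw [hS, hT, LinearMap.trace_id, map_zero, Nat.cast_eq_zero] at this
  have hnt := IsSimpleModule.nontrivial R S
  exact absurd this (Module.finrank_pos_iff.2 hnt).ne'

variable {k G W W' : Type*} [Field k] [Monoid G] [AddCommGroup W] [Module k W]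
  [AddCommGroup W'] [Module k W'] {ρ : Representation k G W} {σ : Representation k G W'}

theorem nonempty_equiv_of_asModule (e : ρ.asModule ≃ₗ[MonoidAlgebra k G] σ.asModule) :
    Nonempty (ρ.Equiv σ) :=
  ⟨((Representation.IntertwiningMap.equivLinearMapAsModule ρ σ).symm e.toLinearMap).ofBijective
    e.bijective⟩

/-- An equivalence of representations as an isomorphism of modules over the group algebra. -/
def asModuleEquivOfEquiv (e : ρ.Equiv σ) : ρ.asModule ≃ₗ[MonoidAlgebra k G] σ.asModule :=
  LinearEquiv.ofBijective
    (Representation.IntertwiningMap.equivLinearMapAsModule ρ σ e.toIntertwiningMap)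
    e.toLinearEquiv.bijective

theorem isIrreducible_of_equiv (e : ρ.Equiv σ) (h : ρ.IsIrreducible) : σ.IsIrreducible := by
  rw [Representation.irreducible_iff_isSimpleModule_asModule] at h ⊢
  exact IsSimpleModule.congr (asModuleEquivOfEquiv e).symm

theorem trace_asAlgebraHom_eq (h : ρ.character = σ.character) (r : MonoidAlgebra k G) :
    LinearMap.trace k W (ρ.asAlgebraHom r) = LinearMap.trace k W' (σ.asAlgebraHom r) := by
  induction r using MonoidAlgebra.induction_on with
  | of g =>
    rw [Representation.asAlgebraHom_of, Representation.asAlgebraHom_of]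
    exact congrFun h g
  | add x y hx hy => rw [map_add, map_add, hx, hy, map_add, map_add]
  | smul r x hx => rw [map_smul, map_smul, hx, map_smul, map_smul]

theorem nonempty_equiv_of_character_eq [CharZero k] [FiniteDimensional k W]
    [FiniteDimensional k W'] (hρ : ρ.IsIrreducible) (hσ : σ.IsIrreducible)
    (h : ρ.character = σ.character) : Nonempty (ρ.Equiv σ) := by
  rw [Representation.irreducible_iff_isSimpleModule_asModule] at hρ hσ
  let _ : Module (MonoidAlgebra k G) W := Module.compHom W ρ.asAlgebraHom.toRingHom
  let _ : Module (MonoidAlgebra k G) W' := Module.compHom W' σ.asAlgebraHom.toRingHom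
  have : IsSimpleModule (MonoidAlgebra k G) W := hρ
  have : IsSimpleModule (MonoidAlgebra k G) W' := hσ
  obtain ⟨e⟩ := nonempty_linearEquiv_of_trace_eq (R := MonoidAlgebra k G)
    (α := fun r => ρ.asAlgebraHom r) (β := fun r => σ.asAlgebraHom r) (fun _ _ => rfl)
    (fun _ _ => rfl) (trace_asAlgebraHom_eq h)
  exact nonempty_equiv_of_asModule e

theorem mem_span_range_of_isIrreducible (hρ : ρ.IsIrreducible) {x : W} (hx : x ≠ 0) (y : W) :
    y ∈ Submodule.span k (Set.range fun g => ρ g x) := by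
  let U : Subrepresentation ρ :=
    { toSubmodule := Submodule.span k (Set.range fun g => ρ g x)
      apply_mem_toSubmodule := fun g z hz => by
        have := Submodule.mem_map_of_mem (f := ρ g) hz
        rw [Submodule.map_span, ← Set.range_comp] at this
        refine Submodule.span_mono ?_ this
        rintro _ ⟨h, rfl⟩
        exact ⟨g * h, LinearMap.congr_fun (map_mul ρ g h) x⟩ }
  have hxU : x ∈ U.toSubmodule := Submodule.subset_span ⟨1, LinearMap.congr_fun (map_one ρ) x⟩
  rcases hρ.eq_bot_or_eq_top U with h | h
  · rw [h] at hxU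
    exact absurd ((Submodule.mem_bot k).1 hxU) hx
  · have : y ∈ U.toSubmodule := by
      rw [h]
      exact Submodule.mem_top
    exact this

theorem nontrivial_of_isIrreducible (hρ : ρ.IsIrreducible) : Nontrivial W := by
  rw [Representation.irreducible_iff_isSimpleModule_asModule] at hρ
  exact IsSimpleModule.nontrivial (MonoidAlgebra k G) ρ.asModule

end Determined

/-! ### Twists by powers of the determinant -/

section Twist

variable {k G W W' : Type*} [Field k] [Group G] [AddCommGroup W] [Module k W]
  [AddCommMonoid W'] [Module k W']

/-- The twist of a representation by a one-dimensional character. -/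
def twist (χ : G →* k) (ρ : Representation k G W) : Representation k G W where
  toFun g := χ g • ρ g
  map_one' := by rw [map_one, map_one, one_smul]
  map_mul' g h := by rw [map_mul, map_mul, smul_mul_smul_comm]

theorem twist_apply (χ : G →* k) (ρ : Representation k G W) (g : G) :
    twist χ ρ g = χ g • ρ g := rfl

theorem twist_character (χ : G →* k) (ρ : Representation k G W) (g : G) :
    (twist χ ρ).character g = χ g * ρ.character g := by
  rw [Representation.character, twist_apply, map_smul]
  rfl

theorem twist_isIrreducible (χ : G →* k) {ρ : Representation k G W} (hρ : ρ.IsIrreducible) :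
    (twist χ ρ).IsIrreducible := by
  have := nontrivial_of_isIrreducible hρ
  refine isIrreducible_of_forall_mem_span _ fun x hx y => ?_
  refine Submodule.span_le.2 ?_ (mem_span_range_of_isIrreducible hρ hx y)
  rintro _ ⟨g, rfl⟩
  have hg : χ g ≠ 0 := ((Group.isUnit g).map χ).ne_zero
  have : ρ g x = (χ g)⁻¹ • twist χ ρ g x := by
    rw [twist_apply, LinearMap.smul_apply, smul_smul, inv_mul_cancel₀ hg, one_smul]
  change ρ g x ∈ _
  rw [this]
  exact Submodule.smul_mem _ _ (Submodule.subset_span ⟨g, rfl⟩)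

/-- Tensoring with a one-dimensional representation is twisting. -/
theorem nonempty_tprod_equiv_twist (χ : G →* k) (ρ : Representation k G W)
    (σ : Representation k G W') (e : W' ≃ₗ[k] k) (hσ : ∀ g, σ g = χ g • LinearMap.id) :
    Nonempty ((ρ.tprod σ).Equiv (twist χ ρ)) := by
  refine ⟨Representation.Equiv.mk
    ((TensorProduct.congr (LinearEquiv.refl k W) e).trans (TensorProduct.rid k W)) fun g => ?_⟩
  refine TensorProduct.ext' fun x t => ?_
  simp [hσ, twist_apply, smul_smul]

/-- The top exterior power is multiplication by the determinant. -/
theorem exteriorPower_map_finrank [FiniteDimensional k W] (f : W →ₗ[k] W) {N : ℕ}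
    (hN : Module.finrank k W = N) :
    exteriorPower.map N f = LinearMap.det f • LinearMap.id := by
  apply exteriorPower.linearMap_ext
  refine AlternatingMap.ext fun v => ?_
  let b := Module.finBasisOfFinrankEq k W hN
  simp only [LinearMap.compAlternatingMap_apply, LinearMap.smul_apply, LinearMap.id_apply,
    exteriorPower.map_apply_ιMulti]
  rw [← sub_eq_zero]
  refine (Module.forall_dual_apply_eq_zero_iff k _).1 fun ξ => ?_
  have h := (ξ.compAlternatingMap (exteriorPower.ιMulti k N (M := W))).eq_smul_basis_det b
  have h' : ∀ v, ξ (exteriorPower.ιMulti k N v) =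
      ξ (exteriorPower.ιMulti k N b) * b.det v := fun v => AlternatingMap.congr_fun h v
  rw [map_sub, map_smul, h' (f ∘ v), h' v, b.det_comp, smul_eq_mul]
  ring

theorem tensorPowerRep_eq_pow_smul {χ : G →* k} {ρ : Representation k G W}
    (hρ : ∀ g, ρ g = χ g • LinearMap.id) (r : ℕ) (g : G) :
    tensorPowerRep ρ r g = (χ ^ r) g • LinearMap.id := by
  apply PiTensorProduct.ext
  ext v
  change PiTensorProduct.map (fun _ => ρ g) (PiTensorProduct.tprod k v) =
    (χ ^ r) g • PiTensorProduct.tprod k v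
  rw [PiTensorProduct.map_tprod, hρ]
  simp only [LinearMap.smul_apply, LinearMap.id_apply]
  rw [MultilinearMap.map_smul_univ]
  simp

variable (k) (V : Type*) [AddCommGroup V] [Module k V]

/-- The character `g ↦ det(g)⁻¹` of the general linear group. -/
def detInv : LinearMap.GeneralLinearGroup k V →* k where
  toFun g := (LinearMap.det (stdRep k V g))⁻¹
  map_one' := by rw [map_one, map_one, inv_one]
  map_mul' g h := by rw [map_mul, map_mul, mul_inv]

theorem detInv_apply (g : LinearMap.GeneralLinearGroup k V) :
    detInv k V g = (LinearMap.det (stdRep k V g))⁻¹ := rfl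

theorem det_stdRep_ne_zero (g : LinearMap.GeneralLinearGroup k V) :
    LinearMap.det (stdRep k V g) ≠ 0 :=
  (g.isUnit.map (LinearMap.det (M := V) (A := k))).ne_zero

variable [FiniteDimensional k V]

theorem exteriorPowerRep_dual_apply (g : LinearMap.GeneralLinearGroup k V) :
    exteriorPowerRep (stdRep k V).dual (Module.finrank k V) g = detInv k V g • LinearMap.id := by
  refine (exteriorPower_map_finrank ((stdRep k V).dual g) (Subspace.dual_finrank_eq)).trans ?_
  congr 1
  have h : (stdRep k V).dual g = (stdRep k V g⁻¹).dualMap := rfl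
  rw [h, LinearMap.det_dualMap, detInv_apply]
  refine eq_inv_of_mul_eq_one_left ?_
  rw [← map_mul, ← map_mul, inv_mul_cancel, map_one, map_one]

/-- Tensoring with `(⋀^N V^*)^{⊗ r}` is twisting by `det^{-r}`. -/
theorem nonempty_twistedWeylRep_equiv {n : ℕ} (l : n.Partition) (r : ℕ) :
    Nonempty ((twistedWeylRep k V l r).Equiv (twist (detInv k V ^ r) (weylRep k V l))) := by
  have hD : Module.finrank k (⋀[k]^(Module.finrank k V) (Module.Dual k V)) = 1 := by
    rw [exteriorPower.finrank_eq, Subspace.dual_finrank_eq, Nat.choose_self]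
  let b := Module.basisUnique Unit hD
  let B := Basis.piTensorProduct fun _ : Fin r => b
  exact nonempty_tprod_equiv_twist _ _
    (tensorPowerRep (exteriorPowerRep (stdRep k V).dual (Module.finrank k V)) r)
    (B.equivFun.trans (LinearEquiv.funUnique _ k k))
    (tensorPowerRep_eq_pow_smul (exteriorPowerRep_dual_apply k V) r)

end Twist

/-! ### Highest weights -/

section Weights

theorem multiset_map_injective_of_antitone {N : ℕ} {a b : Fin N → ℕ} (ha : Antitone a)
    (hb : Antitone b) (h : Finset.univ.val.map a = Finset.univ.val.map b) : a = b := by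
  rw [Fin.univ_val_map, Fin.univ_val_map, Multiset.coe_eq_coe] at h
  exact List.ofFn_injective (List.Perm.eq_of_sortedGE (List.sortedGE_ofFn_iff.2 ha)
    (List.sortedGE_ofFn_iff.2 hb) h)

/-- A partition whose parts are the nonzero entries of a decreasing sequence `a` of length `N` has
at most `N` parts, and these are the entries of `a`. -/
theorem part_eq_of_parts_eq {n N : ℕ} {l : n.Partition} {a : Fin N → ℕ} (ha : Antitone a)
    (h : l.parts = (Finset.univ.val.map a).filter (· ≠ 0)) :
    numParts l ≤ N ∧ ∀ i : Fin N, part l i = a i := by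
  have hle : numParts l ≤ N := by
    rw [numParts, h]
    refine (Multiset.card_le_card (Multiset.filter_le _ _)).trans ?_
    simp
  refine ⟨hle, congrFun (multiset_map_injective_of_antitone (fun i j hij => antitone_part l hij)
    ha ?_)⟩
  have h1 : Finset.univ.val.map (fun i : Fin N => part l i) =
      l.parts + Multiset.replicate (N - numParts l) 0 := by
    rw [Fin.univ_val_map]
    have : List.ofFn (fun i : Fin N => part l i) =
        sortedParts l ++ List.replicate (N - numParts l) 0 := by
      refine List.ext_getElem ?_ fun i hi hi' => ?_
      · simp [length_sortedParts, hle]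
      · rw [List.getElem_ofFn, List.getElem_append]
        split_ifs with hlt
        · exact List.getD_eq_getElem _ _ hlt
        · rw [List.getElem_replicate]
          exact List.getD_eq_default _ _ (not_lt.1 hlt)
    rw [this, ← Multiset.coe_add, sortedParts, Multiset.sort_eq, Multiset.coe_replicate]
  have h2 := Multiset.filter_add_not (· ≠ 0) (Finset.univ.val.map a)
  rw [← h] at h2
  rw [h1, ← h2]
  congr 1
  symm
  have h3 := congrArg Multiset.card h2
  rw [Multiset.card_add, Multiset.card_map] at h3
  refine Multiset.eq_replicate.2 ⟨?_, fun b hb => ?_⟩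
  · have : Multiset.card (Finset.univ : Finset (Fin N)).val = N := Finset.card_fin N
    have : Multiset.card l.parts = numParts l := rfl
    omega
  · simpa using (Multiset.mem_filter.1 hb).2

variable {N : ℕ}

theorem add_shift_nonneg (w : Weight N) (i : Fin N) : 0 ≤ w.1 i + w.shift := by
  have h : (-(w.1 i)).toNat ≤ w.shift :=
    Finset.le_sup (f := fun i => (-(w.1 i)).toNat) (Finset.mem_univ i)
  omega

theorem part_partition (w : Weight N) :
    numParts w.partition ≤ N ∧ ∀ i : Fin N, (part w.partition i : ℤ) = w.1 i + w.shift := by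
  have h := part_eq_of_parts_eq (l := w.partition) (a := fun i => (w.1 i + w.shift).toNat)
    (fun i j hij => by
      have := w.2 hij
      simp only
      omega) rfl
  refine ⟨h.1, fun i => ?_⟩
  rw [h.2, Int.toNat_of_nonneg (add_shift_nonneg w i)]

theorem part_partition_ofPartition {n : ℕ} (l : n.Partition) (r : ℕ) (i : Fin N) :
    part (Weight.ofPartition N l r).partition i + r =
      part l i + (Weight.ofPartition N l r).shift := by
  have h := (part_partition (Weight.ofPartition N l r)).2 i
  have h' : (Weight.ofPartition N l r).1 i = (part l i : ℤ) - r := rfl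
  omega

end Weights

section Alternants

open MvPolynomial

theorem expAlternant_add_const {N : ℕ} (R : Type*) [CommRing R] (e : Fin N → ℕ) (c : ℕ) :
    expAlternant R (fun j => e j + c) = (∏ i, X i) ^ c * expAlternant R e := by
  rw [expAlternant, expAlternant, ← Finset.prod_pow, ← Matrix.det_mul_column]
  congr 1
  ext1 i j
  simp [pow_add, mul_comm]

theorem alternant_eq_expAlternant (N : ℕ) (a : ℕ → ℕ) :
    alternant N a = expAlternant ℤ fun j : Fin N => a j + staircase N j := rfl

/-- `S_{λ + c} = (x_1 ⋯ x_N)^c S_λ`, in a form symmetric in the two partitions. -/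
theorem prod_X_pow_mul_schurPoly {N n n' : ℕ} {l : n.Partition} {l' : n'.Partition} {r r' : ℕ}
    (h : ∀ i : Fin N, part l i + r' = part l' i + r) :
    (∏ i : Fin N, X i) ^ r' * schurPoly N l = (∏ i : Fin N, X i) ^ r * schurPoly N l' := by
  have h0 : alternant N (fun _ => 0) ≠ 0 := by
    intro h
    have := coeff_expAlternant_self (R := ℤ) (strictAnti_staircase (N := N))
    rw [alternant_eq_expAlternant] at h
    simp only [zero_add] at h
    rw [h, coeff_zero] at this
    exact zero_ne_one this
  apply mul_left_cancel₀ h0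
  rw [mul_left_comm, ← alternant_eq_mul_schurPoly, mul_left_comm, ← alternant_eq_mul_schurPoly,
    alternant_eq_expAlternant, alternant_eq_expAlternant, ← expAlternant_add_const,
    ← expAlternant_add_const]
  congr 1
  funext j
  have := h j
  omega

end Alternants

section Characters

open MvPolynomial

variable {k : Type*} [Field k] {V : Type*} [AddCommGroup V] [Module k V]
  [FiniteDimensional k V]

theorem exists_charpoly_map_eq_prod (g : V →ₗ[k] V) :
    ∃ x : Fin (Module.finrank k V) → AlgebraicClosure k,
      g.charpoly.map (algebraMap k (AlgebraicClosure k)) =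
        ∏ i, (Polynomial.X - Polynomial.C (x i)) := by
  have hs := IsAlgClosed.splits (g.charpoly.map (algebraMap k (AlgebraicClosure k)))
  have hcard : Multiset.card (g.charpoly.map (algebraMap k (AlgebraicClosure k))).roots =
      Module.finrank k V := by
    rw [← hs.natDegree_eq_card_roots, Polynomial.natDegree_map, LinearMap.charpoly_natDegree]
  obtain ⟨L, hL⟩ := Quotient.exists_rep (g.charpoly.map (algebraMap k (AlgebraicClosure k))).roots
  have hlen : L.length = Module.finrank k V := by
    rw [← hcard, ← hL]
    rfl
  refine ⟨fun i => L.get (i.cast hlen.symm), ?_⟩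
  have h1 : (∏ i, (Polynomial.X - Polynomial.C (L.get (Fin.cast hlen.symm i)))) =
      ∏ i, (Polynomial.X - Polynomial.C (L.get i)) :=
    Equiv.prod_comp (finCongr hlen.symm) fun i => Polynomial.X - Polynomial.C (L.get i)
  rw [h1, hs.eq_prod_roots_of_monic ((LinearMap.charpoly_monic g).map _), ← hL]
  exact (Fin.prod_univ_fun_getElem L fun y => Polynomial.X - Polynomial.C y).symm

theorem algebraMap_det_eq_prod {K : Type*} [Field K] [Algebra k K] (g : V →ₗ[k] V)
    {x : Fin (Module.finrank k V) → K} (hx : g.charpoly.map (algebraMap k K) =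
      ∏ i, (Polynomial.X - Polynomial.C (x i))) :
    algebraMap k K (LinearMap.det g) = ∏ i, x i := by
  have h := congrArg (Polynomial.eval 0) hx
  rw [Polynomial.eval_prod, ← Polynomial.coeff_zero_eq_eval_zero, Polynomial.coeff_map] at h
  rw [LinearMap.det_eq_sign_charpoly_coeff, map_mul, h]
  simp [Finset.prod_neg, ← mul_assoc, ← mul_pow]

variable [CharZero k]

theorem algebraMap_twist_weylRep_character {n : ℕ} {l : n.Partition}
    (hl : numParts l ≤ Module.finrank k V) (r : ℕ) {K : Type*} [Field K] [Algebra k K]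
    (g : LinearMap.GeneralLinearGroup k V) {x : Fin (Module.finrank k V) → K}
    (hx : (LinearMap.charpoly (g : V →ₗ[k] V)).map (algebraMap k K) =
      ∏ i, (Polynomial.X - Polynomial.C (x i))) :
    (∏ i, x i) ^ r * algebraMap k K ((twist (detInv k V ^ r) (weylRep k V l)).character g) =
      aeval x (schurPoly (Module.finrank k V) l) := by
  have hdet := algebraMap_det_eq_prod (g : V →ₗ[k] V) hx
  have hne : algebraMap k K (LinearMap.det (g : V →ₗ[k] V)) ≠ 0 :=
    (map_ne_zero _).2 (det_stdRep_ne_zero k V g)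
  have hχ : (detInv k V ^ r) g = (LinearMap.det (g : V →ₗ[k] V))⁻¹ ^ r := rfl
  rw [twist_character, map_mul, algebraMap_weylRep_character hl K g x hx,
    ← hdet, hχ, map_pow, map_inv₀, ← mul_assoc, ← mul_pow, mul_inv_cancel₀ hne, one_pow, one_mul]

theorem twist_weylRep_character_eq {n n' : ℕ} {l : n.Partition} {l' : n'.Partition}
    (hl : numParts l ≤ Module.finrank k V) (hl' : numParts l' ≤ Module.finrank k V) {r r' : ℕ}
    (h : ∀ i : Fin (Module.finrank k V), part l i + r' = part l' i + r)
    {K : Type*} [Field K] [Algebra k K]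
    (g : LinearMap.GeneralLinearGroup k V) {x : Fin (Module.finrank k V) → K}
    (hx : (LinearMap.charpoly (g : V →ₗ[k] V)).map (algebraMap k K) =
      ∏ i, (Polynomial.X - Polynomial.C (x i))) :
    (twist (detInv k V ^ r) (weylRep k V l)).character g =
      (twist (detInv k V ^ r') (weylRep k V l')).character g := by
  have hne : ∏ i, x i ≠ 0 := by
    rw [← algebraMap_det_eq_prod (g : V →ₗ[k] V) hx]
    exact (map_ne_zero _).2 (det_stdRep_ne_zero k V g)
  have hS := congrArg (aeval x) (prod_X_pow_mul_schurPoly h)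
  simp only [map_mul, map_pow, map_prod, aeval_X] at hS
  rw [← algebraMap_twist_weylRep_character hl r g hx,
    ← algebraMap_twist_weylRep_character hl' r' g hx, ← mul_assoc, ← mul_assoc,
    mul_comm (_ ^ r')] at hS
  exact (algebraMap k K).injective
    (mul_left_cancel₀ (mul_ne_zero (pow_ne_zero _ hne) (pow_ne_zero _ hne)) hS)

theorem twistedWeylRep_isIrreducible {n : ℕ} {l : n.Partition}
    (hl : numParts l ≤ Module.finrank k V) (r : ℕ) :
    Representation.IsIrreducible (V := TwistedWeylModule k V l r) (twistedWeylRep k V l r) := by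
  obtain ⟨e⟩ := nonempty_twistedWeylRep_equiv k V l r
  exact isIrreducible_of_equiv (W' := TwistedWeylModule k V l r) e.symm
    (twist_isIrreducible _ (weylRep_isIrreducible hl))

/-- Twisted Weyl modules of the same weight are isomorphic. -/
theorem nonempty_twistedWeylRep_equiv_of_part_add_eq {n n' : ℕ} {l : n.Partition}
    {l' : n'.Partition} (hl : numParts l ≤ Module.finrank k V)
    (hl' : numParts l' ≤ Module.finrank k V) {r r' : ℕ}
    (h : ∀ i : Fin (Module.finrank k V), part l i + r' = part l' i + r) :
    Nonempty ((twistedWeylRep k V l r).Equiv (twistedWeylRep k V l' r')) := by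
  obtain ⟨e₁⟩ := nonempty_twistedWeylRep_equiv k V l r
  obtain ⟨e₂⟩ := nonempty_twistedWeylRep_equiv k V l' r'
  suffices h : Nonempty ((twist (detInv k V ^ r) (weylRep k V l)).Equiv
      (twist (detInv k V ^ r') (weylRep k V l'))) from ⟨(e₁.trans h.some).trans e₂.symm⟩
  refine nonempty_equiv_of_character_eq (twist_isIrreducible _ (weylRep_isIrreducible hl))
    (twist_isIrreducible _ (weylRep_isIrreducible hl')) (funext fun g => ?_)
  obtain ⟨x, hx⟩ := exists_charpoly_map_eq_prod (g : V →ₗ[k] V)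
  exact twist_weylRep_character_eq hl hl' h g hx

/-- The values of a character at diagonal matrices determine the weight: they give an identity of
Schur polynomials up to powers of `x_1 ⋯ x_N`, hence one of alternants of strictly decreasing
exponents, whose leading monomials must agree. -/
theorem part_add_eq_of_character_eq {n n' : ℕ} {l : n.Partition}
    {l' : n'.Partition} (hl : numParts l ≤ Module.finrank k V)
    (hl' : numParts l' ≤ Module.finrank k V) {r r' : ℕ}
    (h : (twist (detInv k V ^ r) (weylRep k V l)).character =
      (twist (detInv k V ^ r') (weylRep k V l')).character) :
    ∀ i : Fin (Module.finrank k V), part l i + r' = part l' i + r := by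
  set N := Module.finrank k V with hN
  let b := Module.finBasis k V
  have heval : ∀ t : Fin N → k, (∀ i, t i ≠ 0) →
      (∏ i, t i) ^ r' * aeval t (schurPoly N l) = (∏ i, t i) ^ r * aeval t (schurPoly N l') := by
    intro t ht
    have hdet : LinearMap.det (Matrix.toLin b b (Matrix.diagonal t)) = ∏ i, t i := by
      rw [LinearMap.det_toLin, Matrix.det_diagonal]
    obtain ⟨g, hg⟩ := (LinearMap.isUnit_iff_isUnit_det _).2 (isUnit_iff_ne_zero.2
      (hdet.trans_ne (Finset.prod_ne_zero_iff.2 fun i _ => ht i)))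
    have hx : (LinearMap.charpoly (g : V →ₗ[k] V)).map (algebraMap k k) =
        ∏ i, (Polynomial.X - Polynomial.C (t i)) := by
      rw [hg, ← LinearMap.charpoly_toMatrix _ b, LinearMap.toMatrix_toLin, Matrix.charpoly_diagonal,
        Algebra.algebraMap_self, Polynomial.map_id]
    rw [← algebraMap_twist_weylRep_character hl r g hx,
      ← algebraMap_twist_weylRep_character hl' r' g hx, h]
    ring
  have hpoly : (∏ i : Fin N, X i) ^ r' * MvPolynomial.map (Int.castRingHom k) (schurPoly N l) =
      (∏ i : Fin N, X i) ^ r * MvPolynomial.map (Int.castRingHom k) (schurPoly N l') := by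
    have hX : (∏ i : Fin N, (X i : MvPolynomial (Fin N) k)) ≠ 0 :=
      Finset.prod_ne_zero_iff.2 fun i _ => X_ne_zero i
    -- the extra factor makes both sides vanish where some coordinate is zero
    apply mul_left_cancel₀ hX
    refine MvPolynomial.funext fun t => ?_
    by_cases ht : ∀ i, t i ≠ 0
    · have := heval t ht
      simp only [map_mul, map_pow, map_prod, eval_X, eval_map]
      rw [aeval_def, aeval_def] at this
      rw [show Int.castRingHom k = algebraMap ℤ k from RingHom.ext_int _ _, this]
    · push Not at ht
      obtain ⟨i, hi⟩ := ht
      have : eval t (∏ i : Fin N, (X i : MvPolynomial (Fin N) k)) = 0 := by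
        rw [map_prod]
        exact Finset.prod_eq_zero (Finset.mem_univ i) (by rw [eval_X, hi])
      rw [map_mul, this, zero_mul, map_mul, this, zero_mul]
  have hD : ∀ {n : ℕ} (l : n.Partition) (c : ℕ),
      expAlternant k (fun j : Fin N => part l j + staircase N j + c) =
      expAlternant k (fun j : Fin N => 0 + staircase N j) *
        ((∏ i : Fin N, X i) ^ c * MvPolynomial.map (Int.castRingHom k) (schurPoly N l)) := by
    intro n l c
    rw [expAlternant_add_const, ← map_alternant, alternant_eq_mul_schurPoly, map_mul, map_alternant]
    ring
  have hE := congrArg (expAlternant k (fun j : Fin N => 0 + staircase N j) * ·) hpoly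
  simp only [← hD] at hE
  by_contra! hne
  obtain ⟨i, hne⟩ := hne
  have hd : ∀ {n : ℕ} (l : n.Partition) (c : ℕ),
      StrictAnti fun j : Fin N => part l j + staircase N j + c := fun l c i j hij =>
    Nat.add_lt_add_right (strictAnti_part_add_staircase l hij) c
  have h1 := coeff_expAlternant_self (R := k) (hd l r')
  rw [hE, coeff_expAlternant_of_ne (hd l' r) (hd l r')] at h1
  · exact zero_ne_one h1
  · intro heq
    have : part l i + staircase N i + r' = part l' i + staircase N i + r := congrFun heq i
    omega

theorem isEmpty_highestWeightRep_equiv {w w' : Weight (Module.finrank k V)} (h : w ≠ w') :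
    IsEmpty ((highestWeightRep k V w).Equiv (highestWeightRep k V w')) := by
  refine ⟨fun e => h (Subtype.ext (funext fun i => ?_))⟩
  obtain ⟨e₁⟩ := nonempty_twistedWeylRep_equiv k V w.partition w.shift
  obtain ⟨e₂⟩ := nonempty_twistedWeylRep_equiv k V w'.partition w'.shift
  have h1 := part_add_eq_of_character_eq (part_partition w).1 (part_partition w').1
    (Representation.char_iso ((e₁.symm.trans e).trans e₂)) i
  have h2 := (part_partition w).2 i
  have h3 := (part_partition w').2 i
  omega

theorem nonempty_highestWeightRep_ofPartition_equiv {n : ℕ} {l : n.Partition}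
    (hl : numParts l ≤ Module.finrank k V) (r : ℕ) :
    Nonempty ((highestWeightRep k V (Weight.ofPartition (Module.finrank k V) l r)).Equiv
      (twistedWeylRep k V l r)) :=
  nonempty_twistedWeylRep_equiv_of_part_add_eq (part_partition _).1 hl
    (part_partition_ofPartition l r)

end Characters

/-! ### Polynomial representations -/

section Polynomial

variable {k : Type*} [Field k] {V : Type*} [AddCommGroup V] [Module k V]

theorem detInv_mem_polynomialFunctions : (fun g => detInv k V g) ∈ polynomialFunctions k V :=
  Algebra.subset_adjoin (Or.inr rfl)

theorem isPolynomialRep_of_equiv {Y Y' : Type*} [AddCommMonoid Y] [Module k Y] [AddCommMonoid Y']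
    [Module k Y'] {ρ : Representation k (LinearMap.GeneralLinearGroup k V) Y}
    {σ : Representation k (LinearMap.GeneralLinearGroup k V) Y'} (e : ρ.Equiv σ)
    (h : IsPolynomialRep k V ρ) : IsPolynomialRep k V σ := by
  intro ξ y
  obtain ⟨x, rfl⟩ := e.toLinearEquiv.surjective y
  have := h (ξ ∘ₗ e.toLinearEquiv.toLinearMap) x
  convert this using 2 with g
  exact congrArg ξ (LinearMap.congr_fun (e.isIntertwining' g) x).symm

variable [FiniteDimensional k V]

theorem apply_tensorPowerRep_mem_polynomialFunctions {n : ℕ}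
    (ξ : Module.Dual k (PiTensorProduct k (fun _ : Fin n => V)))
    (t : PiTensorProduct k (fun _ : Fin n => V)) :
    (fun g => ξ (tensorPowerRep (stdRep k V) n g t)) ∈ polynomialFunctions k V := by
  obtain ⟨η, rfl⟩ :=
    (PiTensorProduct.dualDistribEquiv (R := k) (M := fun _ : Fin n => V)).surjective ξ
  induction η using PiTensorProduct.induction_on with
  | smul_tprod a φ =>
    induction t using PiTensorProduct.induction_on with
    | smul_tprod c v =>
      have : (fun g => PiTensorProduct.dualDistribEquiv (a • PiTensorProduct.tprod k φ)
          (tensorPowerRep (stdRep k V) n g (c • PiTensorProduct.tprod k v))) =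
          (a * c) • ∏ i, fun g => φ i (stdRep k V g (v i)) := by
        funext g
        rw [map_smul, map_smul, LinearMap.smul_apply, map_smul, smul_smul, Pi.smul_apply,
          Finset.prod_apply]
        congr 1
        exact (congrArg _ (PiTensorProduct.map_tprod _ _)).trans
          (PiTensorProduct.dualDistrib_apply _ _)
      rw [this]
      refine Subalgebra.smul_mem _ (Subalgebra.prod_mem _ fun i _ => ?_) _
      exact Algebra.subset_adjoin (Or.inl ⟨φ i, v i, rfl⟩)
    | add s t hs ht =>
      simp only [map_add]
      exact Subalgebra.add_mem _ hs ht
  | add η η' h h' =>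
    simp only [map_add, LinearMap.add_apply]
    exact Subalgebra.add_mem _ h h'

/-- `L_λ` is a direct summand of a tensor power of `V`. -/
theorem isPolynomialRep_twist_weylRep [CharZero k] {n : ℕ} (l : n.Partition) (r : ℕ) :
    IsPolynomialRep k V (twist (detInv k V ^ r) (weylRep k V l)) := by
  intro ξ f
  have h := Subalgebra.mul_mem _ (Subalgebra.pow_mem _ (detInv_mem_polynomialFunctions (k := k)
    (V := V)) r) (apply_tensorPowerRep_mem_polynomialFunctions
      ((youngScalar k l)⁻¹ • ξ ∘ₗ ofTensor l) (evalGen k V l f))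
  convert h using 1
  funext g
  have h1 : weylRep k V l g f = (youngScalar k l)⁻¹ •
      ofTensor l (tensorPowerRep (stdRep k V) n g (evalGen k V l f)) := by
    rw [← evalGen_weylRep, ofTensor_evalGen, smul_smul, inv_mul_cancel₀ (youngScalar_ne_zero l),
      one_smul]
  rw [twist_apply, LinearMap.smul_apply, map_smul, h1, map_smul]
  rfl

theorem isPolynomialRep_highestWeightRep [CharZero k] (w : Weight (Module.finrank k V)) :
    IsPolynomialRep k V (highestWeightRep k V w) := by
  obtain ⟨e⟩ := nonempty_twistedWeylRep_equiv k V w.partition w.shift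
  exact isPolynomialRep_of_equiv e.symm (isPolynomialRep_twist_weylRep _ _)

end Polynomial

/-! ### Sums of copies of simple modules -/

section Copies

variable (R : Type*) [Ring R] {ι : Type*} (L : ι → Type*) [∀ i, AddCommGroup (L i)]
  [∀ i, Module R (L i)] (F : Type*) [AddCommGroup F] [Module R F]

/-- The sum of all submodules of `F` that are isomorphic to a member of the family `L`. -/
def sumOfCopies : Submodule R F := sSup {S | ∃ i, Nonempty (S ≃ₗ[R] L i)}

variable {R F} [hL : ∀ i, IsSimpleModule R (L i)]

include hL in
theorem apply_mem_sumOfCopies {i : ι} (f : L i →ₗ[R] F) (x : L i) : f x ∈ sumOfCopies R L F := by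
  rcases f.injective_or_eq_zero with hf | rfl
  · have h : LinearMap.range f ∈ {S : Submodule R F | ∃ i, Nonempty (S ≃ₗ[R] L i)} :=
      ⟨i, ⟨(LinearEquiv.ofInjective f hf).symm⟩⟩
    exact le_sSup h (LinearMap.mem_range_self f x)
  · exact Submodule.zero_mem _

variable {M : Type*} [AddCommGroup M] [Module R M] {κ : Type*} {Φ : κ → M →ₗ[R] F}

include hL in
theorem isSemisimpleModule_sumOfCopies : IsSemisimpleModule R (sumOfCopies R L F) := by
  rw [sumOfCopies, sSup_eq_iSup]
  refine isSemisimpleModule_biSup_of_isSemisimpleModule_submodule ?_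
  rintro S ⟨i, ⟨e⟩⟩
  exact IsSemisimpleModule.congr e

include hL in
theorem isSemisimpleModule_of_forall_mem_sumOfCopies [Finite κ]
    (hΦ : ∀ j y, Φ j y ∈ sumOfCopies R L F) (hinj : ∀ y, (∀ j, Φ j y = 0) → y = 0) :
    IsSemisimpleModule R M := by
  have := isSemisimpleModule_sumOfCopies (R := R) L (F := F)
  refine IsSemisimpleModule.of_injective
    (LinearMap.pi fun j => (Φ j).codRestrict (sumOfCopies R L F) (hΦ j)) ?_
  rw [injective_iff_map_eq_zero]
  exact fun y hy => hinj y fun j => congrArg Subtype.val (congrFun hy j)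

include hL in
/-- A simple submodule embeds through one of the homomorphisms `Φ j`. -/
theorem exists_linearEquiv_of_forall_mem_sumOfCopies (S : Submodule R M) [IsSimpleModule R S]
    (hΦ : ∀ j y, Φ j y ∈ sumOfCopies R L F) (hinj : ∀ y, (∀ j, Φ j y = 0) → y = 0) :
    ∃ i, Nonempty (S ≃ₗ[R] L i) := by
  have hS := IsSimpleModule.nontrivial R S
  obtain ⟨x, hx⟩ := exists_ne (0 : S)
  have : ∃ j, Φ j x ≠ 0 := by
    by_contra! h
    exact hx (Subtype.ext (hinj x h))
  obtain ⟨j, hj⟩ := this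
  have hf : Function.Injective (Φ j ∘ₗ S.subtype) :=
    LinearMap.injective_of_ne_zero fun h => hj (LinearMap.congr_fun h x)
  let e := LinearEquiv.ofInjective _ hf
  have : IsSimpleModule R (LinearMap.range (Φ j ∘ₗ S.subtype)) := IsSimpleModule.congr e.symm
  have : ∀ m : {S : Submodule R F | ∃ i, Nonempty (S ≃ₗ[R] L i)}, IsSimpleModule R m := by
    rintro ⟨m, i, ⟨e⟩⟩
    exact IsSimpleModule.congr e
  obtain ⟨T, ⟨i, ⟨e'⟩⟩, ⟨e''⟩⟩ := Submodule.linearEquiv_of_le_sSup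
    (LinearMap.range (Φ j ∘ₗ S.subtype)) {S : Submodule R F | ∃ i, Nonempty (S ≃ₗ[R] L i)} (by
      rintro _ ⟨y, rfl⟩
      exact hΦ j y)
  exact ⟨i, ⟨(e.trans e'').trans e'⟩⟩

include hL in
/-- A finite module separated by finitely many homomorphisms into a sum of copies of simple
modules `L i` is a finite direct sum of such modules. -/
theorem exists_linearEquiv_dfinsupp_of_forall_mem_sumOfCopies [Finite κ] [Module.Finite R M]
    (hΦ : ∀ j y, Φ j y ∈ sumOfCopies R L F) (hinj : ∀ y, (∀ j, Φ j y = 0) → y = 0) :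
    ∃ (m : ℕ) (w : Fin m → ι), Nonempty (M ≃ₗ[R] Π₀ i : Fin m, L (w i)) := by
  have := isSemisimpleModule_of_forall_mem_sumOfCopies L hΦ hinj
  obtain ⟨m, S, e, hS⟩ := IsSemisimpleModule.exists_linearEquiv_fin_dfinsupp R M
  choose w hw using fun i => exists_linearEquiv_of_forall_mem_sumOfCopies L (S i) hΦ hinj
  exact ⟨m, w, ⟨e.trans (DFinsupp.mapRange.linearEquiv fun i => (hw i).some)⟩⟩

end Copies

/-! ### Functions on a group -/

section Functions

variable (k G : Type*) [Field k] [Monoid G]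

/-- The action of `G` on functions by right translation: `(g F)(h) = F (h g)`. -/
def rightRegular : Representation k G (G → k) where
  toFun g := LinearMap.funLeft k k fun h => h * g
  map_one' := LinearMap.ext fun F => funext fun h => congrArg F (mul_one h)
  map_mul' a b := LinearMap.ext fun F => funext fun h => congrArg F (mul_assoc h a b).symm

variable {k G} {W W' : Type*} [AddCommGroup W] [Module k W]

/-- For a linear form `ξ`, the map which sends a vector `y` to its matrix coefficient
`g ↦ ξ (g y)`. -/
def coeffMap (ρ : Representation k G W) (ξ : Module.Dual k W) :
    Representation.IntertwiningMap ρ (rightRegular k G) where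
  toFun y g := ξ (ρ g y)
  map_add' x y := funext fun g => by simp
  map_smul' c y := funext fun g => by simp
  isIntertwining' g := LinearMap.ext fun y => funext fun h =>
    congrArg ξ (LinearMap.congr_fun (map_mul ρ h g) y).symm

/-- A decomposition of modules over the group algebra as a decomposition of representations. -/
theorem nonempty_equiv_directSum {ι : Type*} {ρ : Representation k G W} {T S : ι → Type*}
    [∀ i, AddCommGroup (T i)] [∀ i, Module k (T i)] [∀ i, AddCommMonoid (S i)]
    [∀ i, Module k (S i)] {τ : ∀ i, Representation k G (T i)} {σ : ∀ i, Representation k G (S i)}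
    (e : ρ.asModule ≃ₗ[MonoidAlgebra k G] Π₀ i, (τ i).asModule) (h : ∀ i, (τ i).Equiv (σ i)) :
    Nonempty (ρ.Equiv (Representation.directSum σ)) := by
  have he : ∀ (a : MonoidAlgebra k G) (y : W) i, e (ρ.asAlgebraHom a y) i =
      (τ i).asAlgebraHom a (e y i) :=
    fun a y i => congrArg (fun z => z i) (e.map_smul a (ρ.asModuleEquiv.symm y))
  let e' : W ≃ₗ[k] Π₀ i, T i :=
    { e.toAddEquiv with
      map_smul' := fun c y => DFinsupp.ext fun i => by
        have := he (algebraMap k _ c) y i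
        rw [AlgHom.commutes, AlgHom.commutes] at this
        exact this }
  refine ⟨Representation.Equiv.mk
    (e'.trans (DFinsupp.mapRange.linearEquiv fun i => (h i).toLinearEquiv)) fun g => ?_⟩
  refine LinearMap.ext fun y => DFinsupp.ext fun i => ?_
  have h1 := he (MonoidAlgebra.of k G g) y i
  rw [Representation.asAlgebraHom_of, Representation.asAlgebraHom_of] at h1
  exact (congrArg (h i) h1).trans (LinearMap.congr_fun ((h i).isIntertwining' g) (e' y i))

end Functions

/-! ### Complete reducibility -/

section Reducibility

theorem smul_mem_of_mem_submodule_asModule {k G W : Type*} [Field k] [Monoid G] [AddCommGroup W]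
    [Module k W] {ρ : Representation k G W} (N : Submodule (MonoidAlgebra k G) ρ.asModule) (c : k)
    {x : W} (hx : x ∈ N) : c • x ∈ N := by
  have h : ρ.asAlgebraHom (algebraMap k _ c) x ∈ N := N.smul_mem (algebraMap k _ c) hx
  rwa [AlgHom.commutes, Module.algebraMap_end_apply] at h

variable {k : Type*} [Field k] {V : Type*} [AddCommGroup V] [Module k V]

/-- A product of functions `φ (g v)` and a power of `det(g)⁻¹` is a matrix coefficient of a tensor
power of `V`, twisted. -/
theorem exists_coeff_of_mem_closure {F : LinearMap.GeneralLinearGroup k V → k}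
    (hF : F ∈ Submonoid.closure
      ({f | ∃ (φ : Module.Dual k V) (v : V), f = fun g => φ (stdRep k V g v)} ∪
        {fun g => (LinearMap.det (stdRep k V g))⁻¹})) :
    ∃ (n r : ℕ) (ξ : Module.Dual k (PiTensorProduct k (fun _ : Fin n => V)))
      (t : PiTensorProduct k (fun _ : Fin n => V)),
      coeffMap (twist (detInv k V ^ r) (tensorPowerRep (stdRep k V) n)) ξ t = F := by
  suffices h : ∃ (n r : ℕ) (φ : Fin n → Module.Dual k V) (v : Fin n → V),
      F = fun g => (∏ i, φ i (stdRep k V g (v i))) * detInv k V g ^ r by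
    obtain ⟨n, r, φ, v, rfl⟩ := h
    refine ⟨n, r, PiTensorProduct.dualDistrib (PiTensorProduct.tprod k φ),
      PiTensorProduct.tprod k v, funext fun g => ?_⟩
    change PiTensorProduct.dualDistrib (PiTensorProduct.tprod k φ) (detInv k V g ^ r •
      PiTensorProduct.map (fun _ => stdRep k V g) (PiTensorProduct.tprod k v)) = _
    rw [map_smul, PiTensorProduct.map_tprod, PiTensorProduct.dualDistrib_apply, smul_eq_mul,
      mul_comm]
  induction hF using Submonoid.closure_induction with
  | mem F hF =>
    rcases hF with ⟨φ, v, rfl⟩ | rfl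
    · exact ⟨1, 0, fun _ => φ, fun _ => v, funext fun g => by simp⟩
    · exact ⟨0, 1, Fin.elim0, Fin.elim0, funext fun g => by simp [detInv_apply]⟩
  | one => exact ⟨0, 0, Fin.elim0, Fin.elim0, funext fun g => by simp⟩
  | mul F F' _ _ h h' =>
    obtain ⟨n, r, φ, v, rfl⟩ := h
    obtain ⟨n', r', φ', v', rfl⟩ := h'
    refine ⟨n + n', r + r', Fin.append φ φ', Fin.append v v', funext fun g => ?_⟩
    rw [Fin.prod_univ_add, Pi.mul_apply]
    simp only [Fin.append_left, Fin.append_right, pow_add]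
    ring

variable [CharZero k] [FiniteDimensional k V]

/-- Tensor powers are spanned by the values of homomorphisms from Specht modules. -/
theorem mem_span_range_apply {n : ℕ} (t : PiTensorProduct k (fun _ : Fin n => V)) :
    t ∈ Submodule.span k (Set.range fun p : Σ l : n.Partition, WeylModule k V l × Specht k l =>
      p.2.1 p.2.2) := by
  let _ : Module (MonoidAlgebra k (Equiv.Perm (Fin n))) (PiTensorProduct k (fun _ : Fin n => V)) :=
    Module.compHom _ (permRep k V n).asAlgebraHom.toRingHom
  have : IsScalarTower k (MonoidAlgebra k (Equiv.Perm (Fin n)))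
      (PiTensorProduct k (fun _ : Fin n => V)) := ⟨fun c a t => by
    change (permRep k V n).asAlgebraHom (c • a) t = c • (permRep k V n).asAlgebraHom a t
    rw [map_smul]
    rfl⟩
  have h : t ∈ sSup {S : Submodule (MonoidAlgebra k (Equiv.Perm (Fin n)))
      (PiTensorProduct k (fun _ : Fin n => V)) |
      IsSimpleModule (MonoidAlgebra k (Equiv.Perm (Fin n))) S} := by
    rw [IsSemisimpleModule.sSup_simples_eq_top]
    exact Submodule.mem_top
  rw [sSup_eq_iSup'] at h
  refine Submodule.iSup_induction _ (motive := fun t => t ∈ Submodule.span k (Set.range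
    fun p : Σ l : n.Partition, WeylModule k V l × Specht k l => p.2.1 p.2.2)) h ?_
    (Submodule.zero_mem _) fun _ _ => Submodule.add_mem _
  rintro ⟨S, hS⟩ x hx
  have : IsSimpleModule (MonoidAlgebra k (Equiv.Perm (Fin n))) S := hS
  have : FiniteDimensional k S :=
    inferInstanceAs (FiniteDimensional k (S.restrictScalars k))
  obtain ⟨l, ⟨e⟩⟩ := exists_specht_equiv (k := k) (n := n) S
  let f : WeylModule k V l :=
    { toLinearMap := (S.subtype ∘ₗ e.toLinearMap).restrictScalars k
      isIntertwining' := fun s => LinearMap.ext fun z => by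
        have h1 := congrArg Subtype.val (e.map_smul (MonoidAlgebra.of k _ s) z)
        refine h1.trans ?_
        exact LinearMap.congr_fun (Representation.asAlgebraHom_of (permRep k V n) s) _ }
  refine Submodule.subset_span ⟨⟨l, f, e.symm ⟨x, hx⟩⟩, ?_⟩
  exact congrArg Subtype.val (e.apply_symm_apply ⟨x, hx⟩)

variable (k V) in
/-- A model of the irreducible representation of highest weight `w`: a Weyl module twisted by a
power of the determinant. -/
abbrev modelRep (w : Weight (Module.finrank k V)) :
    Representation k (LinearMap.GeneralLinearGroup k V) (WeylModule k V w.partition) :=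
  twist (detInv k V ^ w.shift) (weylRep k V w.partition)

instance isSimpleModule_modelRep (w : Weight (Module.finrank k V)) :
    IsSimpleModule (MonoidAlgebra k (LinearMap.GeneralLinearGroup k V))
      (modelRep k V w).asModule :=
  (Representation.irreducible_iff_isSimpleModule_asModule _).1
    (twist_isIrreducible _ (weylRep_isIrreducible (part_partition w).1))

variable (k V) in
/-- The sum of all subrepresentations of the space of functions on `GL(V)` that are isomorphic to
a representation of some highest weight. -/
abbrev highestWeightFunctions :
    Submodule (MonoidAlgebra k (LinearMap.GeneralLinearGroup k V))
      (rightRegular k (LinearMap.GeneralLinearGroup k V)).asModule :=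
  sumOfCopies _ (fun w => (modelRep k V w).asModule) _

/-- The image of a twisted Weyl module, possibly zero, consists of highest weight functions. -/
theorem apply_mem_highestWeightFunctions {n : ℕ} {l : n.Partition} {r : ℕ}
    (T : Representation.IntertwiningMap (twist (detInv k V ^ r) (weylRep k V l))
      (rightRegular k (LinearMap.GeneralLinearGroup k V))) (f : WeylModule k V l) :
    T f ∈ highestWeightFunctions k V := by
  rcases lt_or_ge (Module.finrank k V) (numParts l) with hl | hl
  · have := weylModule_subsingleton hl
    rw [Subsingleton.elim f 0, map_zero]
    exact Submodule.zero_mem _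
  · let w := Weight.ofPartition (Module.finrank k V) l r
    obtain ⟨e₁⟩ := nonempty_twistedWeylRep_equiv k V w.partition w.shift
    obtain ⟨e₂⟩ := nonempty_highestWeightRep_ofPartition_equiv hl r
    obtain ⟨e₃⟩ := nonempty_twistedWeylRep_equiv k V l r
    let e : (modelRep k V w).Equiv (twist (detInv k V ^ r) (weylRep k V l)) :=
      (e₁.symm.trans e₂).trans e₃
    obtain ⟨x, rfl⟩ := e.toLinearEquiv.surjective f
    exact apply_mem_sumOfCopies (fun w => (modelRep k V w).asModule)
      (Representation.IntertwiningMap.equivLinearMapAsModule _ _ (T.comp e.toIntertwiningMap)) x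

theorem coeff_tensorPower_mem_highestWeightFunctions {n : ℕ} (r : ℕ)
    (ξ : Module.Dual k (PiTensorProduct k (fun _ : Fin n => V)))
    (t : PiTensorProduct k (fun _ : Fin n => V)) :
    coeffMap (twist (detInv k V ^ r) (tensorPowerRep (stdRep k V) n)) ξ t ∈
      highestWeightFunctions k V := by
  induction mem_span_range_apply t using Submodule.span_induction with
  | mem _ h =>
    obtain ⟨⟨l, f, s⟩, rfl⟩ := h
    let E : Representation.IntertwiningMap (twist (detInv k V ^ r) (weylRep k V l))
        (twist (detInv k V ^ r) (tensorPowerRep (stdRep k V) n)) :=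
      { toFun := fun f => f s
        map_add' := fun _ _ => rfl
        map_smul' := fun _ _ => rfl
        isIntertwining' := fun g => rfl }
    exact apply_mem_highestWeightFunctions ((coeffMap _ ξ).comp E) f
  | zero =>
    rw [map_zero]
    exact Submodule.zero_mem _
  | add x y _ _ hx hy =>
    rw [map_add]
    exact Submodule.add_mem _ hx hy
  | smul c x _ hx =>
    rw [map_smul]
    exact smul_mem_of_mem_submodule_asModule _ c hx

/-- The algebra of polynomial functions on `GL(V)` is a sum of copies of the `L_w`. -/
theorem mem_highestWeightFunctions {F : LinearMap.GeneralLinearGroup k V → k}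
    (hF : F ∈ polynomialFunctions k V) : F ∈ highestWeightFunctions k V := by
  have h : F ∈ Subalgebra.toSubmodule (polynomialFunctions k V) := hF
  rw [polynomialFunctions, Algebra.adjoin_eq_span] at h
  clear hF
  induction h using Submodule.span_induction with
  | mem F hF =>
    obtain ⟨n, r, ξ, t, rfl⟩ := exists_coeff_of_mem_closure hF
    exact coeff_tensorPower_mem_highestWeightFunctions r ξ t
  | zero => exact Submodule.zero_mem _
  | add x y _ _ hx hy => exact Submodule.add_mem _ hx hy
  | smul c x _ hx => exact smul_mem_of_mem_submodule_asModule _ c hx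

/-- Taking matrix coefficients with respect to the coordinates of a basis embeds a polynomial
representation into a finite power of the space of polynomial functions on `GL(V)`. -/
theorem isSemisimple_and_exists_equiv_of_isPolynomialRep {Y : Type*} [AddCommGroup Y] [Module k Y]
    [FiniteDimensional k Y] {ρ : Representation k (LinearMap.GeneralLinearGroup k V) Y}
    (hρ : IsPolynomialRep k V ρ) :
    ρ.IsSemisimpleRepresentation ∧
      ∃ (m : ℕ) (w : Fin m → Weight (Module.finrank k V)),
        Nonempty (ρ.Equiv (Representation.directSum fun i : Fin m =>
          highestWeightRep k V (w i))) := by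
  let b := Module.finBasis k Y
  let Φ : Fin (Module.finrank k Y) → ρ.asModule
      →ₗ[MonoidAlgebra k (LinearMap.GeneralLinearGroup k V)]
      (rightRegular k (LinearMap.GeneralLinearGroup k V)).asModule := fun j =>
    Representation.IntertwiningMap.equivLinearMapAsModule _ _ (coeffMap ρ (b.coord j))
  have hΦ : ∀ j y, Φ j y ∈ highestWeightFunctions k V := fun j y =>
    mem_highestWeightFunctions (hρ (b.coord j) y)
  have hinj : ∀ y, (∀ j, Φ j y = 0) → y = 0 := by
    intro y hy
    refine b.forall_coord_eq_zero_iff.1 fun j => ?_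
    have h := congrFun (hy j) 1
    have h1 : ρ 1 y = y := LinearMap.congr_fun (map_one ρ) y
    exact (congrArg (b.coord j) h1.symm).trans h
  have hfin : Module.Finite (MonoidAlgebra k (LinearMap.GeneralLinearGroup k V)) ρ.asModule :=
    have : Module.Finite k ρ.asModule := inferInstanceAs (FiniteDimensional k Y)
    Module.Finite.of_restrictScalars_finite k _ _
  refine ⟨(Representation.isSemisimpleRepresentation_iff_isSemisimpleModule_asModule _).2
    (isSemisimpleModule_of_forall_mem_sumOfCopies _ hΦ hinj), ?_⟩
  obtain ⟨m, w, ⟨e⟩⟩ := exists_linearEquiv_dfinsupp_of_forall_mem_sumOfCopies _ hΦ hinj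
  exact ⟨m, w, nonempty_equiv_directSum e fun i =>
    (nonempty_twistedWeylRep_equiv k V (w i).partition (w i).shift).some.symm⟩

end Reducibility

end

end SchurWeyl

theorem mainTheorem10 {k : Type u} [Field k] [CharZero k]
    {V : Type v} [AddCommGroup V] [Module k V] [FiniteDimensional k V] :
    -- the Weyl character formula
    (∀ (n : ℕ) (l : n.Partition),
      FiniteDimensional k (SchurWeyl.WeylModule k V l) ∧
      (Subsingleton (SchurWeyl.WeylModule k V l) ↔ Module.finrank k V < SchurWeyl.numParts l) ∧
      (SchurWeyl.numParts l ≤ Module.finrank k V →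
        (∀ (K : Type w) [Field K] [Algebra k K] (g : LinearMap.GeneralLinearGroup k V)
          (x : Fin (Module.finrank k V) → K),
          (LinearMap.charpoly (g : V →ₗ[k] V)).map (algebraMap k K) =
              ∏ i, (Polynomial.X - Polynomial.C (x i)) →
            algebraMap k K ((SchurWeyl.weylRep k V l).character g) =
              MvPolynomial.aeval x (SchurWeyl.schurPoly (Module.finrank k V) l)) ∧
        (Module.finrank k (SchurWeyl.WeylModule k V l) : ℚ) =
          ∏ i : Fin (Module.finrank k V), ∏ j ∈ Finset.Ioi i,
            ((SchurWeyl.part l i : ℚ) - SchurWeyl.part l j + j - i) / ((j : ℚ) - i))) ∧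
    -- `L_w`, for a decreasing integer sequence `w`, is independent of how `w` is written as
    -- a partition minus a constant
    (∀ (n : ℕ) (l : n.Partition) (r : ℕ), SchurWeyl.numParts l ≤ Module.finrank k V →
      Nonempty ((SchurWeyl.highestWeightRep k V
        (SchurWeyl.Weight.ofPartition (Module.finrank k V) l r)).Equiv
          (SchurWeyl.twistedWeylRep k V l r))) ∧
    -- the `L_w` are irreducible polynomial representations and pairwise non-isomorphic
    (∀ w : SchurWeyl.Weight (Module.finrank k V),
      Representation.IsIrreducible (V := SchurWeyl.HighestWeightModule k V w)
        (SchurWeyl.highestWeightRep k V w) ∧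
      SchurWeyl.IsPolynomialRep k V (SchurWeyl.highestWeightRep k V w)) ∧
    (∀ w w' : SchurWeyl.Weight (Module.finrank k V), w ≠ w' →
      IsEmpty ((SchurWeyl.highestWeightRep k V w).Equiv (SchurWeyl.highestWeightRep k V w'))) ∧
    -- complete reducibility
    (∀ (Y : Type y) [AddCommGroup Y] [Module k Y] [FiniteDimensional k Y]
      (ρ : Representation k (LinearMap.GeneralLinearGroup k V) Y),
      SchurWeyl.IsPolynomialRep k V ρ →
        ρ.IsSemisimpleRepresentation ∧
        ∃ (m : ℕ) (w : Fin m → SchurWeyl.Weight (Module.finrank k V)),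
          Nonempty (ρ.Equiv (Representation.directSum fun i : Fin m =>
            SchurWeyl.highestWeightRep k V (w i)))) := by
  refine ⟨fun n l => ⟨inferInstance, SchurWeyl.subsingleton_weylModule_iff, fun hl =>
      ⟨fun K _ _ g x hx => SchurWeyl.algebraMap_weylRep_character hl K g x hx,
        SchurWeyl.finrank_weylModule hl⟩⟩,
    fun n l r hl => SchurWeyl.nonempty_highestWeightRep_ofPartition_equiv hl r,
    fun w => ⟨SchurWeyl.twistedWeylRep_isIrreducible (SchurWeyl.part_partition w).1 w.shift,
      SchurWeyl.isPolynomialRep_highestWeightRep w⟩,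
    fun w w' h => SchurWeyl.isEmpty_highestWeightRep_equiv h,
    fun Y _ _ _ ρ hρ => SchurWeyl.isSemisimple_and_exists_equiv_of_isPolynomialRep hρ⟩
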